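/- Let $d\ge 1$ and let $\omega$ be a primitive substitution of $\mathbb R^d$: finitely many labelled prototiles $i\in\mathcal V$ (compact sets that are the closure of their interior, with a puncture at $0$ in the interior), an inflation factor $>1$, and for each $i$ a finite patch $\omega(i)$ of tiles with disjoint interiors that covers the inflated prototile $i$. Let $\Omega$ be its tiling space (the tilings whose finite patches all appear, up to translation, in some $\omega^n(i)$); assume finite local complexity and aperiodicity (no tiling of $\Omega$ has a nonzero period). Let $\Xi$ be the canonical transversal, i.e. the set of $T\in\Omega$ with a puncture at $0$, with the metric $\operatorname{dist}(T,T')=\inf\bigl(\{1\}\cup\{1/(r+1): r\ge 0,\ T \text{ and } T' \text{ agree on the ball of radius } r \text{ about } 0\}\bigr)$. Let $\mathcal B$ be the stationary Bratteli diagram of the substitution: vertex set $\mathcal V$, edge set $\mathcal E$ with one edge $e$ from $s(e)=j$ to $r(e)=i$ for each occurrence of $j$ in $\omega(i)$, and a root joined to each vertex by one edge. Let $\Lambda$ be the Perron–Frobenius eigenvalue of its adjacency matrix $A$ and $\nu$ the positive eigenvector, $A\nu=\Lambda\nu$, $\sum_v\nu_v=1$. On the space $\Pi_\infty$ of infinite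 paths from the root let $\mu$ be the probability measure with $\mu[\gamma]=\nu_{r(\gamma)}\Lambda^{-n}$ for $\gamma=(e_0,\dots,e_n)$, and put $w(\gamma)=\mu[\gamma]^{1/d}$ (so $w=1$ for the empty path). Let $\Delta_s$ be the Pearson–Bellissard Laplacian, i.e. the operator on $L^2(\Pi_\infty,\mu)$ associated with the Dirichlet form $$Q_s(f,g)=\sum_{\gamma} w(\gamma)^{s-2}\,\frac{\iint_{x\wedge y=\gamma}(f(x)-f(y))(g(x)-g(y))\,d\mu(x)\,d\mu(y)}{(\mu\otimes\mu)\{(x,y):x\wedge y=\gamma\}},$$ where $\gamma$ runs over the finite paths (including the empty one) and $x\wedge y$ is the longest common prefix of $x$ and $y$. Its $\omega$-spectrum is $\operatorname{Sp}_\omega(\Delta_s)=\bigcap_n\overline{\{\text{eigenvalues of }\Delta_s\text{ on the orthogonal complement of the functions constant on the cylinders }[\gamma],\ \gamma\in\Pi_n\}}$ (the limit points of the eigenvalues). With $\Lambda_s=\Lambda^{(d+2-s)/d}$ set, for $e\in\mathcal E$, $$\beta(e,s)=R(s(e))-\Lambda_sR(r(e))+\frac{2\,\nu_{s(e)}^{(s-2)/d}\bigl(\nu_{s(e)}-\Lambda^{-1}\nu_{r(e)}\bigr)}{\sum_{a\ne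 b,\ s(a)=s(b)=s(e)}\Lambda^{-2}\nu_{r(a)}\nu_{r(b)}},\qquad R(v)=\frac{2(1-\nu_v)}{\sum_{u\neq u'}\nu_u\nu_{u'}}$$ (the fraction in $\beta(e,s)$ is read as $0$ if $e$ is the only edge with source $s(e)$); these are the constants in the recursion $\lambda_{e\gamma}(s)=\Lambda_s\lambda_\gamma(s)+\beta(e,s)$ for the eigenvalues of $\Delta_s$. Assume that all edges of $\mathcal B$ are simple (the entries of $A$ are at most $1$), that the coordinates of $\nu$ are pairwise distinct, and that there is a real $s_1\le 2(d+1)$ such that for all $s>s_1$ and all edges $e\neq f$: either $\beta(e,s)\neq\beta(f,s)$, or $\beta(e',s)\ne\beta(f',s)$ for all edges $e',f'$ with $s(e')=r(e)$, $s(f')=r(f)$. Then for every $s>2(d+1)$ for which $\operatorname{Sp}_\omega(\Delta_s)$ is not a finite set, $\Xi$ is bi-Hölder homeomorphic to $\operatorname{Sp}_\omega(\Delta_s)\subset\mathbb R$: there is a bijection between them which is Hölder continuous together with its inverse. -/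

import Mathlib

open MeasureTheory ProbabilityTheory
open scoped Pointwise NNReal ENNReal

noncomputable section

/-! ### Stationary Bratteli diagrams and their path spaces -/

/-- A stationary Bratteli diagram: `V` is the set of vertices and `E` the set of edges between two
consecutive generations `n ≥ 1`. Above generation `1` there is a root, joined to every vertex by
exactly one edge. -/
structure StationaryDiagram (V E : Type*) where
  /-- source of an edge -/
  src : E → V
  /-- range of an edge -/
  tgt : E → V

namespace StationaryDiagram

variable {V E : Type*} (D : StationaryDiagram V E)

/-- The adjacency matrix `A v v' = #{e | s(e) = v, r(e) = v'}`. -/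
def adjMatrix : Matrix V V ℝ :=
  Matrix.of fun v v' => (Nat.card {e : E // D.src e = v ∧ D.tgt e = v'} : ℝ)

/-- The Perron-Frobenius data of the adjacency matrix `A`: its Perron-Frobenius eigenvalue, and the
positive eigenvector `ν` with `A ν = Λ ν` whose coordinates add up to `1`. (For a primitive `A`
these data exist and are unique.) -/
structure PerronData [Fintype V] where
  /-- the Perron-Frobenius eigenvalue `Λ` -/
  eigenvalue : ℝ
  /-- the normalized eigenvector `ν` -/
  vec : V → ℝ
  eigenvalue_pos : 0 < eigenvalue
  vec_pos : ∀ v, 0 < vec v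
  sum_vec : ∑ v, vec v = 1
  mulVec_vec : D.adjMatrix.mulVec vec = eigenvalue • vec

/-- The set `Π_∞` of infinite paths `(e₀, e₁, e₂, …)` in the diagram. The edge `e₀` from the root is
determined by the source of `e₁`, so a path is stored as the sequence `x` with `x n = e_{n+1}`. -/
def InfPath : Type _ := {x : ℕ → E // ∀ n, D.tgt (x n) = D.src (x (n + 1))}

instance [MeasurableSpace E] : MeasurableSpace D.InfPath :=
  inferInstanceAs (MeasurableSpace {x : ℕ → E // ∀ n, D.tgt (x n) = D.src (x (n + 1))})

/-- The cylinders of the finite prefixes of `x`: `D.cylinder x 0 = Π_∞` is the cylinder of the empty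
path (the root), and `D.cylinder x (n + 1)` is the cylinder `[γ]` of the prefix
`γ = (e₀, …, eₙ)` of `x`, a path of length `n`. -/
def cylinder (x : D.InfPath) : ℕ → Set D.InfPath
  | 0 => Set.univ
  | n + 1 => {y | D.src (y.1 0) = D.src (x.1 0) ∧ ∀ i < n, y.1 i = x.1 i}

/-- The index of the longest common prefix `x ∧ y` of two distinct paths: the largest `n` such that
`y ∈ D.cylinder x n`. -/
def meetIndex (x y : D.InfPath) : ℕ := sInf {n | y ∉ D.cylinder x (n + 1)}

namespace PerronData

variable {D} [Fintype V] [Fintype E] (P : D.PerronData)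

/-- `∑_{s(e) = v} ν_{r(e)} = Λ ν_v`, the eigenvector equation written with edges. -/
theorem sum_edges [DecidableEq V] (v : V) :
    ∑ e : E, (if D.src e = v then P.vec (D.tgt e) else 0) = P.eigenvalue * P.vec v := by
  classical
  have h := congrFun P.mulVec_vec v
  simp only [Matrix.mulVec, dotProduct, adjMatrix, Matrix.of_apply, Pi.smul_apply,
    smul_eq_mul] at h
  rw [← h, ← Finset.sum_fiberwise (s := Finset.univ) (g := D.tgt)]
  refine Finset.sum_congr rfl fun w _ => ?_
  rw [Finset.sum_filter, Nat.card_eq_fintype_card, Fintype.card_subtype, Finset.card_filter,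
    Nat.cast_sum, Finset.sum_mul]
  refine Finset.sum_congr rfl fun e _ => ?_
  by_cases h1 : D.src e = v <;> by_cases h2 : D.tgt e = w <;> simp [h1, h2]

variable [DecidableEq V]

/-- The law of the first edge `e₁` of a random path: `e₁ = e` with probability `Λ⁻¹ ν_{r(e)}`. -/
def initialLaw [MeasurableSpace E] : Measure E :=
  ∑ e : E, ENNReal.ofReal (P.vec (D.tgt e) / P.eigenvalue) • Measure.dirac e

/-- Given an edge `a` of a random path, the law of the next edge:
it is `e` with probability `Λ⁻¹ ν_{r(e)} / ν_{r(a)}` if `s(e) = r(a)`, and `0` otherwise. -/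
def nextLaw [MeasurableSpace E] (a : E) : Measure E :=
  ∑ e : E, ENNReal.ofReal (if D.src e = D.tgt a then
    P.vec (D.tgt e) / (P.eigenvalue * P.vec (D.tgt a)) else 0) • Measure.dirac e

theorem isProbabilityMeasure_nextLaw [MeasurableSpace E] (a : E) :
    IsProbabilityMeasure (P.nextLaw a) := by
  constructor
  have hpos := mul_pos P.eigenvalue_pos (P.vec_pos (D.tgt a))
  simp only [nextLaw, Measure.coe_finsetSum, Finset.sum_apply, Measure.smul_apply,
    measure_univ, smul_eq_mul, mul_one]
  rw [← ENNReal.ofReal_sum_of_nonneg]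
  · have h := P.sum_edges (D.tgt a)
    have h2 : ∑ e : E, (if D.src e = D.tgt a then
        P.vec (D.tgt e) / (P.eigenvalue * P.vec (D.tgt a)) else 0) =
        (∑ e : E, if D.src e = D.tgt a then P.vec (D.tgt e) else 0) /
          (P.eigenvalue * P.vec (D.tgt a)) := by
      rw [Finset.sum_div]
      refine Finset.sum_congr rfl fun e _ => ?_
      split_ifs <;> simp
    rw [h2, h, div_self hpos.ne', ENNReal.ofReal_one]
  · intro e _
    split_ifs
    · exact div_nonneg (P.vec_pos _).le hpos.le
    · exact le_rfl

variable [MeasurableSpace E] [DiscreteMeasurableSpace E]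

/-- The Markov kernels of the random path. -/
def nextKernel (n : ℕ) : Kernel (∀ _ : Finset.Iic n, E) E :=
  (Kernel.ofFunOfCountable P.nextLaw).comap (fun x => x ⟨n, by simp⟩) (measurable_pi_apply _)

instance (n : ℕ) : IsMarkovKernel (P.nextKernel n) := by
  have : IsMarkovKernel (Kernel.ofFunOfCountable P.nextLaw) :=
    ⟨fun a => P.isProbabilityMeasure_nextLaw a⟩
  unfold nextKernel
  infer_instance

/-- The probability measure `μ` on `Π_∞` with `μ[γ] = ν_{r(γ)} Λ^{-n}` for all paths `γ` of
length `n`. It is the measure given by the Dixmier trace of the spectral triple. -/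
def measure : Measure D.InfPath :=
  (Kernel.trajMeasure (X := fun _ => E) P.initialLaw P.nextKernel).comap Subtype.val

/-- The weights `w(γ) = ν_{r(γ)}^{1/d} Λ^{-n/d}` (that is `w(γ) = μ[γ]^{1/d}`) of the prefixes `γ` of
`x`; the empty path has weight `1`. The ultrametric on `Π_∞` is `ρ(x, y) = w(x ∧ y)`. -/
def weight (d : ℕ) (x : D.InfPath) : ℕ → ℝ
  | 0 => 1
  | n + 1 => (P.vec (D.src (x.1 n)) / P.eigenvalue ^ n) ^ (1 / (d : ℝ))

/-- For the prefix `γ` of `x` of index `n`: the `μ ⊗ μ`-mass of the set of all pairs of paths whose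
longest common prefix is `γ`. -/
def splitMass (x : D.InfPath) (n : ℕ) : ℝ :=
  (P.measure.prod P.measure).real
    {p | p.1 ∈ D.cylinder x n ∧ p.2 ∈ D.cylinder x n ∧ p.2 ∉ D.cylinder p.1 (n + 1)}

/-- The kernel `J_s(x, y) = w(γ)^{s-2} / (μ ⊗ μ){(x', y') | x' ∧ y' = γ}` with `γ = x ∧ y`. -/
def jump (d : ℕ) (s : ℝ) (p : D.InfPath × D.InfPath) : ℝ :=
  P.weight d p.1 (D.meetIndex p.1 p.2) ^ (s - 2) / P.splitMass p.1 (D.meetIndex p.1 p.2)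

/-- The Dirichlet form of Pearson and Bellissard,
`Q_s(f, g) = ½ ∫ Tr(|D|^{-s} [D, π_τ(f)]^* [D, π_τ(g)]) dκ(τ)`, where the choice `τ` picks, for each
finite path `γ`, a pair `(x, y)` with `x ∧ y = γ` at random according to `μ ⊗ μ`. Explicitly,
`Q_s(f, g) = ∑_γ w(γ)^{s-2} · (mean of (f x - f y) (g x - g y) over the pairs with x ∧ y = γ)`,
which is the double integral below, since each pair `x ≠ y` belongs to exactly one `γ`. -/
def dirichletForm (d : ℕ) (s : ℝ) (f g : D.InfPath → ℝ) : ℝ :=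
  ∫ p, P.jump d s p * ((f p.1 - f p.2) * (g p.1 - g p.2)) ∂(P.measure.prod P.measure)

/-- `f` lies in the domain of `Q_s`: it has finite energy. -/
def FiniteEnergy (d : ℕ) (s : ℝ) (f : D.InfPath → ℝ) : Prop :=
  Integrable (fun p => P.jump d s p * (f p.1 - f p.2) ^ 2) (P.measure.prod P.measure)

/-- The graph of the Laplacian `Δ_s`, the operator on `L²(Π_∞, μ)` associated with the form `Q_s`:
`Δ_s f = h` iff `f` is in the domain of `Q_s` and `Q_s(g, f) = ⟨g, h⟩` for all `g` in that
domain. (For `s > d + 2` the domain is all of `L²` and `Δ_s` is bounded.) -/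
def IsLaplacian (d : ℕ) (s : ℝ) (f h : Lp ℝ 2 P.measure) : Prop :=
  P.FiniteEnergy d s f ∧
    ∀ g : Lp ℝ 2 P.measure, P.FiniteEnergy d s g → P.dirichletForm d s g f = inner ℝ g h

/-- The eigenvalues of `Δ_s` on the orthogonal complement of the functions that are constant on the
cylinders of index `n`. -/
def tailEigenvalues (d : ℕ) (s : ℝ) (n : ℕ) : Set ℝ :=
  {l | ∃ f : Lp ℝ 2 P.measure, f ≠ 0 ∧ P.IsLaplacian d s f (l • f) ∧
    ∀ x, ∫ y in D.cylinder x n, f y ∂P.measure = 0}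

/-- The `ω`-spectrum of `Δ_s`: the limit points of its eigenvalues, listed with multiplicity along
the filtration by the spaces of functions that are constant on the cylinders of index `n`. -/
def omegaSpectrum (d : ℕ) (s : ℝ) : Set ℝ := ⋂ n, closure (P.tailEigenvalues d s n)

/-- `Λ_s = Λ^{(d+2-s)/d}`. -/
def scale (d : ℕ) (s : ℝ) : ℝ := P.eigenvalue ^ (((d : ℝ) + 2 - s) / d)

/-- The part of the eigenvalue `λ_γ(s)` that comes from the root, for `γ` starting at `v`:
`2 (1 - ν_v) / ∑_{u ≠ u'} ν_u ν_{u'}`. -/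
def rootTerm (v : V) : ℝ :=
  2 * (1 - P.vec v) / ∑ u, ∑ u', if u = u' then 0 else P.vec u * P.vec u'

/-- The part of the eigenvalue `λ_γ(s)` that comes from `e₁ = e`, for `γ = (e₀, e₁, …)`:
`2 ν_{s(e)}^{(s-2)/d} (ν_{s(e)} - Λ⁻¹ ν_{r(e)}) / ∑_{a ≠ b} Λ⁻² ν_{r(a)} ν_{r(b)}`, the sum over the
pairs of distinct edges with source `s(e)`. (If `e` is the only edge with source `s(e)`, then the
numerator and the denominator vanish, and the quotient is `0`.) -/
def edgeTerm [DecidableEq E] (d : ℕ) (s : ℝ) (e : E) : ℝ :=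
  2 * P.vec (D.src e) ^ ((s - 2) / d) * (P.vec (D.src e) - P.vec (D.tgt e) / P.eigenvalue) /
    ∑ a : E, ∑ b : E, if D.src a = D.src e ∧ D.src b = D.src e ∧ a ≠ b then
      (P.vec (D.tgt a) / P.eigenvalue) * (P.vec (D.tgt b) / P.eigenvalue) else 0

/-- The constants `β(e, s)` in the recursion `λ_{eγ}(s) = Λ_s λ_γ(s) + β(e, s)` for the eigenvalues of
`Δ_s`, where `eγ` is the path `γ` starting at `r(e)` with the edge `e` put in front, so that
`λ_γ(s) = Λ_s^n λ_{r(eₙ)}(s) + ∑_{j=1}^n Λ_s^{j-1} β(e_j, s)` for `γ = (e₀, …, eₙ)`. -/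
def beta [DecidableEq E] (d : ℕ) (s : ℝ) (e : E) : ℝ :=
  P.rootTerm (D.src e) + P.edgeTerm d s e - P.scale d s * P.rootTerm (D.tgt e)

end PerronData
end StationaryDiagram

/-! ### Substitution tilings of `ℝ^d` and their canonical transversals -/

/-- A translate of a prototile: a label in `V` and the position of the puncture. -/
abbrev LabelledTile (d : ℕ) (V : Type*) : Type _ := V × EuclideanSpace ℝ (Fin d)

/-- A substitution rule in `ℝ^d` with prototiles labelled by `V`. Prototiles are compact, are the
closure of their interior, and have their puncture at the origin, in the interior. The rule
replaces the prototile `i`, inflated by the factor `expansion`, by the finite patch `rule i` of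
tiles. (Prototiles with different labels may have the same shape.) -/
structure TilingSubstitution (d : ℕ) (V : Type*) where
  supp : V → Set (EuclideanSpace ℝ (Fin d))
  isCompact_supp : ∀ i, IsCompact (supp i)
  closure_interior_supp : ∀ i, closure (interior (supp i)) = supp i
  zero_mem : ∀ i, 0 ∈ interior (supp i)
  expansion : ℝ
  one_lt_expansion : 1 < expansion
  rule : V → Finset (LabelledTile d V)
  iUnion_rule : ∀ i, ⋃ t ∈ rule i, (t.2 +ᵥ supp t.1) = expansion • supp i
  disjoint_rule : ∀ i, (rule i : Set (LabelledTile d V)).Pairwise fun t t' =>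
    Disjoint (interior (t.2 +ᵥ supp t.1)) (interior (t'.2 +ᵥ supp t'.1))

namespace TilingSubstitution

variable {d : ℕ} {V : Type*} (S : TilingSubstitution d V)

/-- The set covered by a tile. -/
def tileSupp (t : LabelledTile d V) : Set (EuclideanSpace ℝ (Fin d)) := t.2 +ᵥ S.supp t.1

/-- A tiling: a set of tiles that cover `ℝ^d` and have pairwise disjoint interiors. -/
def IsTiling (T : Set (LabelledTile d V)) : Prop :=
  ⋃ t ∈ T, S.tileSupp t = Set.univ ∧
    T.Pairwise fun t t' => Disjoint (interior (S.tileSupp t)) (interior (S.tileSupp t'))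

/-- The translate `T + x` of a set of tiles. -/
def translate (x : EuclideanSpace ℝ (Fin d)) (T : Set (LabelledTile d V)) :
    Set (LabelledTile d V) := (fun t => (t.1, t.2 + x)) '' T

/-- The action of the substitution on a set of tiles. -/
def inflate (T : Set (LabelledTile d V)) : Set (LabelledTile d V) :=
  {u | ∃ t ∈ T, ∃ w ∈ S.rule t.1, u = (w.1, S.expansion • t.2 + w.2)}

/-- The tiling space `Ω`: the tilings all of whose finite patches appear, up to translation, in an
iterated substitution of some prototile. -/
def hull : Set (Set (LabelledTile d V)) :=
  {T | S.IsTiling T ∧ ∀ p : Finset (LabelledTile d V), (p : Set (LabelledTile d V)) ⊆ T →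
    ∃ (i : V) (n : ℕ) (x : EuclideanSpace ℝ (Fin d)),
      (p : Set (LabelledTile d V)) ⊆ translate x (S.inflate^[n] {(i, 0)})}

/-- The Abelianization matrix: `A i j` is the number of tiles of type `j` in the substitution
of `i`. -/
def abelMatrix : Matrix V V ℝ :=
  Matrix.of fun i j => (Nat.card {t : S.rule i // t.1.1 = j} : ℝ)

/-- Finite local complexity: up to translation there are only finitely many two-tile patches of
bounded size in the tilings of the tiling space. -/
def FiniteLocalComplexity : Prop :=
  ∀ R : ℝ, {q : V × V × EuclideanSpace ℝ (Fin d) | ‖q.2.2‖ ≤ R ∧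
    ∃ T ∈ S.hull, ∃ x, (q.1, x) ∈ T ∧ (q.2.1, x + q.2.2) ∈ T}.Finite

/-- Aperiodicity: no tiling of the tiling space has a nonzero period. -/
def Aperiodic : Prop := ∀ T ∈ S.hull, ∀ x, translate x T = T → x = 0

/-- The canonical transversal `Ξ`: the tilings of the tiling space with a puncture at the origin. -/
def Transversal : Type _ := {T : Set (LabelledTile d V) // T ∈ S.hull ∧ ∃ i, (i, 0) ∈ T}

/-- The tiles of `T` that meet the closed ball of radius `r` about the origin. -/
def window (T : Set (LabelledTile d V)) (r : ℝ) : Set (LabelledTile d V) :=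
  {t ∈ T | (S.tileSupp t ∩ Metric.closedBall 0 r).Nonempty}

/-- The numbers `1/(r+1)` for the radii `r ≥ 0` such that `T` and `T'` agree on the ball of radius
`r` about the origin, together with `1`. -/
def agreement (T T' : Set (LabelledTile d V)) : Set ℝ :=
  insert 1 {a | ∃ r : ℝ, 0 ≤ r ∧ S.window T r = S.window T' r ∧ a = 1 / (r + 1)}

theorem pos_of_mem_agreement {T T' : Set (LabelledTile d V)} {a : ℝ}
    (ha : a ∈ S.agreement T T') : 0 < a := by
  rcases ha with rfl | ⟨r, hr, -, rfl⟩
  · exact one_pos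
  · positivity

theorem bddBelow_agreement (T T' : Set (LabelledTile d V)) : BddBelow (S.agreement T T') :=
  ⟨0, fun _ ha => (S.pos_of_mem_agreement ha).le⟩

theorem window_eq_of_le {T T' : Set (LabelledTile d V)} {r r' : ℝ} (h : r ≤ r')
    (hw : S.window T r' = S.window T' r') : S.window T r = S.window T' r := by
  have key : ∀ A B : Set (LabelledTile d V), S.window A r' = S.window B r' →
      S.window A r ⊆ S.window B r := by
    rintro A B hAB t ⟨htA, y, hy1, hy2⟩
    have : t ∈ S.window A r' := ⟨htA, y, hy1, Metric.closedBall_subset_closedBall h hy2⟩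
    rw [hAB] at this
    exact ⟨this.1, y, hy1, hy2⟩
  exact (key _ _ hw).antisymm (key _ _ hw.symm)

theorem max_mem_agreement {T T' T'' : Set (LabelledTile d V)} {a b : ℝ}
    (ha : a ∈ S.agreement T T') (hb : b ∈ S.agreement T' T'') :
    max a b ∈ S.agreement T T'' := by
  have le_one : ∀ {A B : Set (LabelledTile d V)} {c : ℝ}, c ∈ S.agreement A B → c ≤ 1 := by
    rintro A B c (rfl | ⟨r, hr, -, rfl⟩)
    · exact le_rfl
    · rw [div_le_one (by linarith)]; linarith
  have ha1 := le_one ha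
  have hb1 := le_one hb
  rcases ha with rfl | ⟨r, hr, hw, rfl⟩
  · left; exact max_eq_left hb1
  rcases hb with rfl | ⟨r', hr', hw', rfl⟩
  · left; exact max_eq_right ha1
  right
  rcases le_total r r' with h | h
  · refine ⟨r, hr, hw.trans (S.window_eq_of_le h hw'), max_eq_left ?_⟩
    exact one_div_le_one_div_of_le (by linarith) (by linarith)
  · refine ⟨r', hr', (S.window_eq_of_le h hw).trans hw', max_eq_right ?_⟩
    exact one_div_le_one_div_of_le (by linarith) (by linarith)

/-- The metric of the transversal: `dist T T'` is the infimum of `1` and of the numbers `1/(r+1)` such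
that `T` and `T'` agree on the ball of radius `r` about the origin. -/
instance : MetricSpace S.Transversal where
  dist T T' := sInf (S.agreement T.1 T'.1)
  dist_self T := by
    refine le_antisymm (le_of_forall_pos_le_add fun ε hε => ?_)
      (le_csInf ⟨1, Or.inl rfl⟩ fun _ ha => (S.pos_of_mem_agreement ha).le)
    refine (csInf_le (S.bddBelow_agreement _ _)
      (Or.inr ⟨1 / ε, by positivity, rfl, rfl⟩)).trans ?_
    rw [zero_add, div_le_iff₀ (by positivity), mul_add, mul_one_div_cancel hε.ne']
    linarith
  dist_comm T T' := by
    have : S.agreement T.1 T'.1 = S.agreement T'.1 T.1 := by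
      simp only [agreement, eq_comm]
    rw [this]
  dist_triangle T T' T'' := by
    have h0 : ∀ A B : Set (LabelledTile d V), 0 ≤ sInf (S.agreement A B) := fun A B =>
      le_csInf ⟨1, Or.inl rfl⟩ fun _ ha => (S.pos_of_mem_agreement ha).le
    refine le_of_forall_pos_le_add fun ε hε => ?_
    obtain ⟨a, ha, ha'⟩ := exists_lt_of_csInf_lt
      (⟨1, Or.inl rfl⟩ : (S.agreement T.1 T'.1).Nonempty) (lt_add_of_pos_right _ (half_pos hε))
    obtain ⟨b, hb, hb'⟩ := exists_lt_of_csInf_lt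
      (⟨1, Or.inl rfl⟩ : (S.agreement T'.1 T''.1).Nonempty) (lt_add_of_pos_right _ (half_pos hε))
    have h := csInf_le (S.bddBelow_agreement _ _) (S.max_mem_agreement ha hb)
    have := max_le_add_of_nonneg (S.pos_of_mem_agreement ha).le (S.pos_of_mem_agreement hb).le
    linarith
  eq_of_dist_eq_zero := by
    intro T T' h
    have key : ∀ t, t ∈ T.1 ↔ t ∈ T'.1 := by
      intro t
      have hpos : (0 : ℝ) < 1 / (‖t.2‖ + 1) := by positivity
      have hlt : sInf (S.agreement T.1 T'.1) < 1 / (‖t.2‖ + 1) := by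
        change sInf (S.agreement T.1 T'.1) = 0 at h
        rwa [h]
      obtain ⟨a, ha, ha'⟩ := exists_lt_of_csInf_lt
        (⟨1, Or.inl rfl⟩ : (S.agreement T.1 T'.1).Nonempty) hlt
      have hmeet : ∀ r, ‖t.2‖ ≤ r → (S.tileSupp t ∩ Metric.closedBall 0 r).Nonempty := by
        intro r hr
        refine ⟨t.2, ⟨0, interior_subset (S.zero_mem t.1), by simp⟩, ?_⟩
        simpa using hr
      rcases ha with rfl | ⟨r, hr, hw, rfl⟩
      · exfalso
        have : 1 / (‖t.2‖ + 1) ≤ 1 := by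
          rw [div_le_one (by positivity)]; linarith [norm_nonneg t.2]
        linarith
      · have hle : ‖t.2‖ ≤ r := by
          have := (one_div_lt_one_div (by positivity) (by positivity)).1 ha'
          linarith
        have hm := hmeet r hle
        have := Set.ext_iff.1 hw t
        simp only [window, Set.mem_ofPred_eq, hm, and_true] at this
        exact this
    exact Subtype.ext (Set.ext key)

/-- The edges of the Bratteli diagram of the substitution: an edge is an occurrence of a tile in the
substitution of a prototile. -/
def Edge : Type _ := (i : V) × S.rule i

instance [Fintype V] : Fintype S.Edge := inferInstanceAs (Fintype ((i : V) × S.rule i))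

instance : DecidableEq S.Edge := Classical.decEq _

instance : MeasurableSpace S.Edge := ⊤

instance : DiscreteMeasurableSpace S.Edge := ⟨fun _ => trivial⟩

/-- The stationary Bratteli diagram of the substitution: an occurrence of the tile `j` in the
substitution of `i` is an edge from `j` to `i`. -/
def diagram : StationaryDiagram V S.Edge where
  src e := e.2.1.1
  tgt e := e.1

end TilingSubstitution

/-- Two metric spaces are bi-Hölder homeomorphic if there is a bijection between them that is Hölder
continuous, as is its inverse. -/
def BiHolderHomeomorphic (X Y : Type*) [MetricSpace X] [MetricSpace Y] : Prop :=
  ∃ (h : X ≃ Y) (C C' r r' : ℝ≥0), 0 < r ∧ 0 < r' ∧ HolderWith C r h ∧ HolderWith C' r' h.symm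

end

/-! ### Compact metric spaces that are bi-Hölder equivalent to a Cantor space -/

/-! The two spaces are not compared directly. Both satisfy `IsHolderCantor`, and any two spaces with
that property are bi-Hölder homeomorphic (`IsHolderCantor.biHolderHomeomorphic`).

For the classification, fix the super-exponential scales `2^(-α^m)` and let `R m` be the relation of
being joined by a chain with steps at most `2^(-α^m)`. The bound on separated points gives at most
`2^(B α^(m+1))` classes of `R (m+1)`. Uniform perfectness and the chain condition show that for
large `α` each of these classes contains at least that many classes of `R (m+2)`. This surplus lets
the classes be regrouped into a tree whose branching numbers are exactly `2^(B α^(m+1))`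
(`exists_coding`). If two codes first differ at digit `m`, the distance lies, up to constants and a
fixed power, between the scales `m+2` and `m`. As `α^(m+2) = α^2 α^m`, this costs only a Hölder
exponent. Every large `B` and every `α` large enough for `B` are allowed, so two spaces can be coded
by one and the same sequence space.

For the spectrum, `Δ_s` is diagonalised by Haar functions of nested cylinders. Along a path the
eigenvalues converge, uniformly at the rate `ρ^n` with `ρ = Λ^(1-(s-2)/d)`, to a geometric series in
the edges. Hence the `ω`-spectrum is the compact range of `limitEigval`, a graph-directed
self-similar set of ratio `ρ`. It is covered by `C Λ^n` intervals of length comparable to `ρ^n`, and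
`s > 2(d+1)` means precisely `Λ ρ < 1`. The total length of the cover then decays exponentially, so
a chain with steps at most `ρ^n` cannot travel farther than `C (Λ ρ)^n`. An infinite spectrum and
connectedness of the diagram give every vertex two continuations with different series, hence
uniform perfectness.

For the transversal, the metric is an ultrametric, so chains gain nothing. Each window is a window
of an inflated cluster from a finite list. This gives exponentially many windows of radius `λ^n`
(polynomially many separated points) and linear repetitivity. Repetitivity with aperiodicity gives
uniform perfectness: if a window forced a much larger one, short return vectors would be periods. -/

/-- Refining a partition: if `R ≤ R' ≤ S` are equivalence relations such that `R'` has at most `M`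
classes and each class of `R'` contains at least `M` classes of `R`, then each class of `S` can be
split into exactly `M` parts that are unions of classes of `R` and finer than `R'`. -/
theorem exists_refinement {X : Type*} (R R' S : Setoid X) (hRR' : R ≤ R') (hR'S : R' ≤ S) (M : ℕ)
    (ι : X → ℕ) (hιM : ∀ x, ι x < M) (hι : ∀ x y, R' x y ↔ ι x = ι y)
    (hu : ∀ x, ∃ u : ℕ → X, (∀ i < M, R' x (u i)) ∧ ∀ i < M, ∀ j < M, i ≠ j → ¬ R (u i) (u j)) :
    ∃ c : X → ℕ, (∀ x, c x < M) ∧ (∀ x y, R x y → c x = c y) ∧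
      (∀ x y, S x y → c x = c y → R' x y) ∧ ∀ x, ∀ j < M, ∃ y, S x y ∧ c y = j := by
  classical
  choose u hu1 hu2 using hu
  let z : X → X := fun x => (Quotient.mk S x).out
  have hz : ∀ x, S x (z x) := fun x => S.symm (Quotient.mk_out (s := S) x)
  have hzz : ∀ x y, S x y → z x = z y := fun x y h => by
    have : Quotient.mk S x = Quotient.mk S y := Quotient.sound h
    simp only [z, this]
  -- In each class of `S` only the class of `R'` through `z` is cut up; all others keep their label
  -- `ι`. `used w i` says that `i` is taken by one of those others.
  let used : X → ℕ → Prop := fun w i => ∃ y, S w y ∧ ¬ R' y w ∧ ι y = i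
  have hused : ∀ w, ¬ used w (ι w) := by
    rintro w ⟨y, -, h2, h3⟩
    exact h2 ((hι _ _).2 h3)
  -- The piece through `u w i` receives the free label `i`. Everything left over receives `ι w`,
  -- which is free as well.
  let pick : X → X → ℕ := fun w x =>
    if h : ∃ i, i < M ∧ R x (u w i) ∧ ¬ used w i then h.choose else ι w
  have hpick : ∀ w x, pick w x < M ∧ ¬ used w (pick w x) := by
    intro w x
    by_cases h : ∃ i, i < M ∧ R x (u w i) ∧ ¬ used w i
    · simp only [pick, dif_pos h]
      exact ⟨h.choose_spec.1, h.choose_spec.2.2⟩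
    · simp only [pick, dif_neg h]
      exact ⟨hιM w, hused w⟩
  have hpickR : ∀ w x y, R x y → pick w x = pick w y := by
    intro w x y h
    have : ∀ i, R x (u w i) ↔ R y (u w i) := fun i =>
      ⟨fun h' => R.trans (R.symm h) h', fun h' => R.trans h h'⟩
    simp only [pick, this]
  refine ⟨fun x => if R' x (z x) then pick (z x) x else ι x, ?_, ?_, ?_, ?_⟩
  · intro x
    dsimp only
    split_ifs
    · exact (hpick _ _).1
    · exact hιM x
  · intro x y h
    have h' := hRR' h
    have hz' := hzz x y (hR'S h')
    have h1 : R' x (z x) ↔ R' y (z y) := by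
      rw [hz']
      exact ⟨fun h'' => R'.trans (R'.symm h') h'', fun h'' => R'.trans h' h''⟩
    rw [hz'] at h1
    simp only [h1, hz', hpickR _ x y h, (hι x y).1 h']
  · intro x y h hc
    have hz' := hzz x y h
    dsimp only at hc
    rw [hz'] at hc
    have key : ∀ a b, S a b → z a = z b → ¬ R' b (z b) → used (z b) (ι b) := fun a b hab hab' hb =>
      ⟨b, S.symm (hz b), hb, rfl⟩
    by_cases hx : R' x (z y) <;> by_cases hy : R' y (z y)
    · exact R'.trans hx (R'.symm hy)
    · rw [if_pos hx, if_neg hy] at hc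
      exact absurd (hc ▸ key x y h hz' hy) (hpick _ _).2
    · rw [if_neg hx, if_pos hy] at hc
      have := key y x (S.symm h) hz'.symm (hz' ▸ hx)
      rw [hz', hc] at this
      exact absurd this (hpick _ _).2
    · rw [if_neg hx, if_neg hy] at hc
      exact (hι _ _).2 hc
  · intro x j hj
    by_cases hjused : used (z x) j
    · obtain ⟨y, h1, h2, h3⟩ := hjused
      have hxy : S x y := S.trans (hz x) h1
      refine ⟨y, hxy, ?_⟩
      dsimp only
      rw [if_neg, h3]
      rwa [← hzz x y hxy]
    · refine ⟨u (z x) j, S.trans (hz x) (hR'S (hu1 _ _ hj)), ?_⟩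
      have hxy : S x (u (z x) j) := S.trans (hz x) (hR'S (hu1 _ _ hj))
      dsimp only
      rw [← hzz x _ hxy, if_pos (R'.symm (hu1 _ _ hj))]
      have h : ∃ i, i < M ∧ R (u (z x) j) (u (z x) i) ∧ ¬ used (z x) i :=
        ⟨j, hj, R.refl _, hjused⟩
      simp only [pick, dif_pos h]
      by_contra hne
      exact hu2 (z x) j hj _ h.choose_spec.1 (Ne.symm hne) h.choose_spec.2.1

/-- Given a decreasing sequence of equivalence relations with many subclasses in each class, the
classes can be grouped into a tree in which each vertex of level `m` has exactly `M m` children. -/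
theorem exists_coding {X : Type*} (R : ℕ → Setoid X) (hR : ∀ m, R (m + 1) ≤ R m)
    (M : ℕ → ℕ)
    (hι : ∀ m, ∃ ι : X → ℕ, (∀ x, ι x < M m) ∧ ∀ x y, R (m + 1) x y ↔ ι x = ι y)
    (hu : ∀ m x, ∃ u : ℕ → X, (∀ i < M m, R (m + 1) x (u i)) ∧
      ∀ i < M m, ∀ j < M m, i ≠ j → ¬ R (m + 2) (u i) (u j)) [Nonempty X] :
    ∃ c : ℕ → X → ℕ, (∀ m x, c m x < M m) ∧ (∀ m x y, R (m + 2) x y → c m x = c m y) ∧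
      (∀ m x y, (∀ i ≤ m, c i x = c i y) → R (m + 1) x y) ∧
      ∀ f : ℕ → ℕ, (∀ m, f m < M m) → ∀ m, ∃ x, ∀ i < m, c i x = f i := by
  classical
  let good : ℕ → Setoid X → (X → ℕ) → Prop := fun m S c =>
    (∀ x, c x < M m) ∧ (∀ x y, R (m + 2) x y → c x = c y) ∧
      (∀ x y, S x y → c x = c y → R (m + 1) x y) ∧ ∀ x, ∀ j < M m, ∃ y, S x y ∧ c y = j
  -- The default `0` never occurs: `hgood` shows that a good digit function exists at each stage
  -- reached.
  let step : ℕ → Setoid X → X → ℕ := fun m S =>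
    if h : ∃ c, good m S c then h.choose else fun _ => 0
  -- `S m` is agreement of the first `m` digits. The construction keeps `R (m+1) ≤ S m`, which is
  -- what `exists_refinement` requires for digit `m`.
  let S : ℕ → Setoid X := fun m => Nat.rec ⊤ (fun m S => S ⊓ Setoid.ker (step m S)) m
  have hS : ∀ m, S (m + 1) = S m ⊓ Setoid.ker (step m (S m)) := fun m => rfl
  have hgood : ∀ m, R (m + 1) ≤ S m → good m (S m) (step m (S m)) := by
    intro m h
    obtain ⟨ι, hι1, hι2⟩ := hι m
    have hex : ∃ c, good m (S m) c :=
      exists_refinement (R (m + 2)) (R (m + 1)) (S m) (hR _) h (M m) ι hι1 hι2 (hu m)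
    simp only [step, dif_pos hex]
    exact hex.choose_spec
  have hRS : ∀ m, R (m + 1) ≤ S m := by
    intro m
    induction m with
    | zero => exact fun _ _ _ => trivial
    | succ m ih =>
      intro x y h
      rw [hS]
      exact ⟨ih (hR _ h), (hgood m ih).2.1 x y h⟩
  have hg := fun m => hgood m (hRS m)
  have hSc : ∀ m x y, S m x y ↔ ∀ i < m, step i (S i) x = step i (S i) y := by
    intro m x y
    induction m with
    | zero => exact ⟨fun _ i hi => absurd hi (by simp), fun _ => trivial⟩
    | succ m ih =>
      have : S (m + 1) x y ↔ S m x y ∧ step m (S m) x = step m (S m) y := Iff.rfl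
      rw [this, ih]
      constructor
      · rintro ⟨h1, h2⟩ i hi
        rcases Nat.lt_succ_iff_lt_or_eq.1 hi with hi | rfl
        · exact h1 i hi
        · exact h2
      · exact fun h => ⟨fun i hi => h i (by omega), h m (by omega)⟩
  refine ⟨fun m => step m (S m), fun m => (hg m).1, fun m => (hg m).2.1, ?_, ?_⟩
  · intro m x y h
    exact (hg m).2.2.1 x y ((hSc _ _ _).2 fun i hi => h i hi.le) (h m le_rfl)
  · intro f hf m
    induction m with
    | zero => exact ⟨Classical.arbitrary X, fun i hi => absurd hi (by simp)⟩
    | succ m ih =>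
      obtain ⟨x, hx⟩ := ih
      obtain ⟨y, hy1, hy2⟩ := (hg m).2.2.2 x (f m) (hf m)
      refine ⟨y, fun i hi => ?_⟩
      rcases Nat.lt_succ_iff_lt_or_eq.1 hi with hi | rfl
      · rw [← hx i hi]
        exact ((hSc _ _ _).1 hy1 i hi).symm
      · exact hy2

/-! ### Metric conditions, and codings at super-exponential scales -/

/-- Quantitative conditions under which a complete metric space is bi-Hölder equivalent to a Cantor
space: it is uniformly perfect, bounded, has polynomially many separated points, and chains with
small steps stay in small sets. -/
structure IsHolderCantor (X : Type*) [MetricSpace X] : Prop where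
  complete : CompleteSpace X
  nonempty : Nonempty X
  uniformlyPerfect : ∃ p : ℕ, ∀ x : X, ∀ r : ℝ, 0 < r → r ≤ 1 →
    ∃ y, (1 / 2) ^ p * r ≤ dist x y ∧ dist x y ≤ r
  card_le : ∃ Q : ℕ, ∀ n : ℕ, 1 ≤ n → ∀ F : Finset X,
    (∀ x ∈ F, ∀ y ∈ F, x ≠ y → (1 / 2 : ℝ) ^ n < dist x y) → F.card ≤ 2 ^ (Q * n)
  chain : ∃ k q : ℕ, 1 ≤ k ∧ (∀ x y : X, dist x y ^ k ≤ 2 ^ q) ∧ ∀ n : ℕ, 1 ≤ n → ∀ x y : X,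
    Relation.ReflTransGen (fun u v : X => dist u v ≤ (1 / 2 : ℝ) ^ n) x y →
      dist x y ^ k ≤ 2 ^ q * (1 / 2) ^ n

/-- The equivalence relation of being joined by a chain with steps at most `ε`. -/
def chainSetoid (X : Type*) [MetricSpace X] (ε : ℝ) : Setoid X where
  r := Relation.ReflTransGen fun u v => dist u v ≤ ε
  iseqv := by
    refine ⟨fun _ => .refl, fun h => ?_, fun h h' => h.trans h'⟩
    have : Std.Symm fun u v : X => dist u v ≤ ε := ⟨fun x y h => by rwa [dist_comm]⟩
    exact symm h

theorem chainSetoid_mono {X : Type*} [MetricSpace X] {ε ε' : ℝ} (h : ε ≤ ε') :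
    chainSetoid X ε ≤ chainSetoid X ε' := fun {_ _} hxy =>
  Relation.ReflTransGen.mono (p := fun u v => dist u v ≤ ε') (fun _ _ h' => le_trans h' h) _ _ hxy

theorem chainSetoid_of_dist_le {X : Type*} [MetricSpace X] {ε : ℝ} {x y : X} (h : dist x y ≤ ε) :
    chainSetoid X ε x y := Relation.ReflTransGen.single h

/-- In a uniformly perfect space each ball contains many separated points. -/
theorem exists_separated {X : Type*} [MetricSpace X] {p : ℕ}
    (hp : ∀ x : X, ∀ r : ℝ, 0 < r → r ≤ 1 → ∃ y, (1 / 2) ^ p * r ≤ dist x y ∧ dist x y ≤ r)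
    (j : ℕ) : ∀ (x : X) (r : ℝ), 0 < r → r ≤ 1 → ∃ F : Finset X, F.card = 2 ^ j ∧
      (∀ y ∈ F, dist x y ≤ r) ∧
      ∀ y ∈ F, ∀ z ∈ F, y ≠ z → (1 / 2) ^ ((p + 3) * j) * r ≤ dist y z := by
  classical
  induction j with
  | zero =>
    intro x r hr _
    refine ⟨{x}, by simp, by simpa using hr.le, ?_⟩
    intro y hy z hz hne
    simp only [Finset.mem_singleton] at hy hz
    exact absurd (hy.trans hz.symm) hne
  | succ j ih =>
    intro x r hr hr1
    obtain ⟨y, hy1, hy2⟩ := hp x (r / 2) (by linarith) (by linarith)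
    have hp1 : (1 / 2 : ℝ) ^ p ≤ 1 := pow_le_one₀ (by norm_num) (by norm_num)
    have hp0 : (0 : ℝ) < (1 / 2) ^ p := by positivity
    -- The centres `x` and `y` are at least `4 r'` apart, so the families built in the balls of
    -- radius `r'` around them stay `2 r'` apart.
    set r' : ℝ := (1 / 2) ^ (p + 3) * r with hr'
    have hr'' : r' = (1 / 2) ^ p * r / 8 := by rw [hr', pow_add]; ring
    have hpr : (1 / 2 : ℝ) ^ p * r ≤ r := by nlinarith
    have hr'0 : 0 < r' := by positivity
    obtain ⟨F, hF1, hF2, hF3⟩ := ih x r' hr'0 (by linarith)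
    obtain ⟨G, hG1, hG2, hG3⟩ := ih y r' hr'0 (by linarith)
    have hFG : ∀ a ∈ F, ∀ b ∈ G, (1 / 2) ^ p * r / 8 ≤ dist a b := by
      intro a ha b hb
      have h1 := hF2 a ha
      have h2 := hG2 b hb
      have h3 := dist_triangle4 x a b y
      rw [dist_comm b y] at h3
      have h4 : 0 < (1 / 2 : ℝ) ^ p * r := by positivity
      nlinarith
    have hdisj : Disjoint F G := by
      rw [Finset.disjoint_left]
      intro a ha hb
      have := hFG a ha a hb
      rw [dist_self] at this
      have h4 : 0 < (1 / 2 : ℝ) ^ p * r := by positivity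
      linarith
    have hstep : (1 / 2 : ℝ) ^ ((p + 3) * (j + 1)) * r = (1 / 2) ^ ((p + 3) * j) * r' := by
      rw [hr', mul_add, pow_add]; ring
    have hstep' : (1 / 2 : ℝ) ^ ((p + 3) * (j + 1)) * r ≤ (1 / 2) ^ p * r / 8 := by
      rw [hstep, ← hr'']
      exact mul_le_of_le_one_left hr'0.le (pow_le_one₀ (by norm_num) (by norm_num))
    refine ⟨F ∪ G, ?_, ?_, ?_⟩
    · rw [Finset.card_union_of_disjoint hdisj, hF1, hG1, pow_succ]; ring
    · intro a ha
      rcases Finset.mem_union.1 ha with ha | ha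
      · exact (hF2 a ha).trans (by linarith)
      · have h1 := hG2 a ha
        have h2 := dist_triangle x y a
        linarith
    · intro a ha b hb hne
      rcases Finset.mem_union.1 ha with ha | ha <;> rcases Finset.mem_union.1 hb with hb | hb
      · rw [hstep]; exact hF3 a ha b hb hne
      · exact hstep'.trans (hFG a ha b hb)
      · rw [dist_comm]; exact hstep'.trans (hFG b hb a ha)
      · rw [hstep]; exact hG3 a ha b hb hne

/-- An equivalence relation all of whose finite sets of inequivalent points have at most `M` elements
has at most `M` classes. -/
theorem exists_labelling {X : Type*} (R : Setoid X) (M : ℕ)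
    (h : ∀ F : Finset X, (∀ x ∈ F, ∀ y ∈ F, x ≠ y → ¬ R x y) → F.card ≤ M) :
    ∃ ι : X → ℕ, (∀ x, ι x < M) ∧ ∀ x y, R x y ↔ ι x = ι y := by
  classical
  have hcard : ∀ F : Finset (Quotient R), F.card ≤ M := by
    intro F
    have hinj : Function.Injective (Quotient.out : Quotient R → X) := Quotient.out_injective
    rw [← Finset.card_map ⟨_, hinj⟩]
    refine h _ ?_
    intro x hx y hy hne hxy
    simp only [Finset.mem_map, Function.Embedding.coeFn_mk] at hx hy
    obtain ⟨a, -, rfl⟩ := hx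
    obtain ⟨b, -, rfl⟩ := hy
    have : Quotient.mk R a.out = Quotient.mk R b.out := Quotient.sound hxy
    rw [Quotient.out_eq, Quotient.out_eq] at this
    exact hne (by rw [this])
  have hfin : Finite (Quotient R) := by
    by_contra hinf
    rw [not_finite_iff_infinite] at hinf
    obtain ⟨F, hF⟩ := Infinite.exists_subset_card_eq (Quotient R) (M + 1)
    have := hcard F
    omega
  have := Fintype.ofFinite (Quotient R)
  let e := Fintype.equivFin (Quotient R)
  refine ⟨fun x => e (Quotient.mk R x), fun x => (e _).2.trans_le ?_, fun x y => ?_⟩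
  · exact hcard Finset.univ
  · rw [Fin.val_inj, e.apply_eq_iff_eq]
    exact Quotient.eq.symm

/-- A coding of a metric space by the sequences `f` with `f m < 2 ^ (B α ^ (m + 1))`: the distance of
two points is controlled by the first index at which their codes differ. -/
def IsHolderCoded (X : Type*) [MetricSpace X] (B α k q : ℕ) : Prop :=
  ∃ e : X ≃ {f : ℕ → ℕ // ∀ m, f m < 2 ^ (B * α ^ (m + 1))}, ∀ x y m,
    (∀ i < m, (e x).1 i = (e y).1 i) → (e x).1 m ≠ (e y).1 m →
      (1 / 2 : ℝ) ^ (α ^ (m + 2)) ≤ dist x y ∧ dist x y ^ k ≤ 2 ^ q * (1 / 2) ^ (α ^ m)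

/-- Chain classes at the scales `2^(-α^m)` meet the hypotheses of `exists_coding`. `B` only has to
dominate the growth exponent of separated sets; `α` is then taken so large that the `2^(B α^(m+1))`
separated points found at one scale are inequivalent at the next. -/
theorem IsHolderCantor.exists_isHolderCoded {X : Type*} [MetricSpace X] (hX : IsHolderCantor X) :
    ∃ B₀ k q : ℕ, 1 ≤ k ∧ ∀ B, B₀ ≤ B → ∃ α₀, ∀ α, α₀ ≤ α → IsHolderCoded X B α k q := by
  classical
  obtain ⟨p, hp⟩ := hX.uniformlyPerfect
  obtain ⟨Q, hQ⟩ := hX.card_le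
  obtain ⟨k, q, hk, hbdd, hchain⟩ := hX.chain
  have := hX.complete
  have := hX.nonempty
  -- The points found have separation exponent `((p+3)B+1) α^(m+1)`. Comparing `k`-th powers with
  -- the chain bound requires `α^(m+2)` to exceed `k` times this, plus `q`. The extra factor `2` in
  -- `2^(q+1)` pays for `(1/2)^(α^0)` when already the first digits differ.
  refine ⟨Q, k, q + 1, hk, fun B hB => ⟨k * ((p + 3) * B + 1) + q + 2, fun α hα => ?_⟩⟩
  have hα1 : 1 < α := by omega
  have hαpos : ∀ m, 1 ≤ α ^ m := fun m => Nat.one_le_pow _ _ (by omega)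
  let R : ℕ → Setoid X := fun m => chainSetoid X ((1 / 2 : ℝ) ^ (α ^ m))
  have hRdist : ∀ m x y, R m x y → dist x y ^ k ≤ 2 ^ q * (1 / 2) ^ (α ^ m) := fun m x y h =>
    hchain _ (hαpos m) x y h
  have hnR : ∀ m x y, ¬ R m x y → (1 / 2 : ℝ) ^ (α ^ m) < dist x y := fun m x y h => by
    by_contra h'
    exact h (chainSetoid_of_dist_le (not_lt.1 h'))
  obtain ⟨c, hc1, hc2, hc3, hc4⟩ := exists_coding R
    (fun m => chainSetoid_mono (pow_le_pow_of_le_one (by norm_num) (by norm_num)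
      (Nat.pow_le_pow_right (by omega) (by omega)))) (fun m => 2 ^ (B * α ^ (m + 1)))
    (fun m => exists_labelling _ _ fun F hF => by
      refine (hQ (α ^ (m + 1)) (hαpos _) F fun x hx y hy hne => hnR _ _ _ (hF x hx y hy hne)).trans ?_
      exact Nat.pow_le_pow_right (by omega) (Nat.mul_le_mul_right _ hB))
    (fun m x => by
      obtain ⟨F, hF1, hF2, hF3⟩ := exists_separated hp (B * α ^ (m + 1)) x
        ((1 / 2 : ℝ) ^ (α ^ (m + 1))) (by positivity) (pow_le_one₀ (by norm_num) (by norm_num))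
      let e := F.equivFinOfCardEq hF1
      refine ⟨fun i => if h : i < 2 ^ (B * α ^ (m + 1)) then (e.symm ⟨i, h⟩ : X) else x, ?_, ?_⟩
      · intro i hi
        simp only [dif_pos hi]
        exact chainSetoid_of_dist_le (hF2 _ (e.symm _).2)
      · intro i hi j hj hij hR
        simp only [dif_pos hi, dif_pos hj] at hR
        have hne : (e.symm ⟨i, hi⟩ : X) ≠ e.symm ⟨j, hj⟩ := by
          intro h
          have := e.symm.injective (Subtype.ext h)
          simp only [Fin.mk.injEq] at this
          exact hij this
        have h1 := hF3 _ (e.symm ⟨i, hi⟩).2 _ (e.symm ⟨j, hj⟩).2 hne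
        have h2 := hRdist _ _ _ hR
        have h3 := (pow_le_pow_left₀ (by positivity) h1 k).trans h2
        rw [← pow_add, ← pow_mul] at h3
        have h4 : (1 / 2 : ℝ) ^ (((p + 3) * (B * α ^ (m + 1)) + α ^ (m + 1)) * k + q) ≤
            (1 / 2) ^ (α ^ (m + 2)) := by
          rw [pow_add]
          calc _ ≤ 2 ^ q * (1 / 2 : ℝ) ^ (α ^ (m + 2)) * (1 / 2) ^ q := by gcongr
            _ = (2 * (1 / 2)) ^ q * (1 / 2 : ℝ) ^ (α ^ (m + 2)) := by rw [mul_pow]; ring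
            _ = _ := by norm_num
        rw [pow_le_pow_iff_right_of_lt_one₀ (by norm_num) (by norm_num)] at h4
        have h5 := hαpos (m + 1)
        have h6 : α ^ (m + 2) = α * α ^ (m + 1) := by ring
        rw [h6] at h4
        have h7 : (k * ((p + 3) * B + 1) + q + 2) * α ^ (m + 1) ≤ α * α ^ (m + 1) :=
          Nat.mul_le_mul_right _ hα
        nlinarith)
  have hinj : ∀ x y, (∀ i, c i x = c i y) → x = y := by
    intro x y h
    by_contra hne
    have hpos : 0 < dist x y ^ k := pow_pos (dist_pos.2 hne) k
    obtain ⟨n, hn⟩ := exists_pow_lt_of_lt_one (show 0 < dist x y ^ k / 2 ^ q by positivity)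
      (show (1 / 2 : ℝ) < 1 by norm_num)
    have h1 := hRdist (n + 1) x y (hc3 n x y fun i _ => h i)
    have h2 : (1 / 2 : ℝ) ^ (α ^ (n + 1)) ≤ (1 / 2) ^ n :=
      pow_le_pow_of_le_one (by norm_num) (by norm_num)
        ((Nat.lt_pow_self hα1).le.trans (Nat.pow_le_pow_right (by omega) (by omega)))
    rw [lt_div_iff₀ (by positivity)] at hn
    have h3 : (2 : ℝ) ^ q * (1 / 2) ^ (α ^ (n + 1)) ≤ 2 ^ q * (1 / 2) ^ n := by gcongr
    linarith
  -- Points realising longer and longer prefixes of `f` form a Cauchy sequence. The limit has all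
  -- the digits of `f`, because digit `m` does not change under moves of size `2^(-α^(m+2))`.
  have hsurj : ∀ f : ℕ → ℕ, (∀ m, f m < 2 ^ (B * α ^ (m + 1))) → ∃ x, ∀ m, c m x = f m := by
    intro f hf
    choose x hx using hc4 f hf
    have hdist : ∀ n m, n + 1 ≤ m → dist (x (n + 1)) (x m) ^ k ≤ 2 ^ q * (1 / 2) ^ (α ^ (n + 1)) := by
      intro n m hnm
      refine hRdist _ _ _ (hc3 n _ _ fun i hi => ?_)
      rw [hx _ i (by omega), hx _ i (by omega)]
    have hcauchy : CauchySeq x := by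
      rw [Metric.cauchySeq_iff']
      intro ε hε
      obtain ⟨n, hn⟩ := exists_pow_lt_of_lt_one (show 0 < ε ^ k / 2 ^ q by positivity)
        (show (1 / 2 : ℝ) < 1 by norm_num)
      refine ⟨n + 1, fun m hm => ?_⟩
      have h1 := hdist n m hm
      have h2 : (1 / 2 : ℝ) ^ (α ^ (n + 1)) ≤ (1 / 2) ^ n :=
        pow_le_pow_of_le_one (by norm_num) (by norm_num)
          ((Nat.lt_pow_self hα1).le.trans (Nat.pow_le_pow_right (by omega) (by omega)))
      rw [lt_div_iff₀ (by positivity)] at hn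
      have h3 : (2 : ℝ) ^ q * (1 / 2) ^ (α ^ (n + 1)) ≤ 2 ^ q * (1 / 2) ^ n := by gcongr
      rw [dist_comm]
      exact lt_of_pow_lt_pow_left₀ k hε.le (by linarith)
    obtain ⟨y, hy⟩ := cauchySeq_tendsto_of_complete hcauchy
    refine ⟨y, fun m => ?_⟩
    rw [Metric.tendsto_atTop] at hy
    obtain ⟨N, hN⟩ := hy ((1 / 2 : ℝ) ^ (α ^ (m + 2))) (by positivity)
    have h1 := hN (max N (m + 1)) (le_max_left _ _)
    rw [← hc2 m _ _ (chainSetoid_of_dist_le h1.le)]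
    exact hx _ m (lt_of_lt_of_le (Nat.lt_succ_self m) (le_max_right _ _))
  refine ⟨Equiv.ofBijective (fun x => ⟨fun m => c m x, fun m => hc1 m x⟩) ⟨?_, ?_⟩, ?_⟩
  · intro x y h
    exact hinj x y fun i => congrFun (Subtype.ext_iff.1 h) i
  · rintro ⟨f, hf⟩
    obtain ⟨x, hx⟩ := hsurj f hf
    exact ⟨x, Subtype.ext (funext hx)⟩
  · intro x y m h1 h2
    change ∀ i < m, c i x = c i y at h1
    change c m x ≠ c m y at h2
    refine ⟨(hnR _ _ _ fun h => h2 (hc2 m x y h)).le, ?_⟩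
    cases m with
    | zero =>
      refine (hbdd x y).trans (le_of_eq ?_)
      rw [pow_zero, pow_succ]; ring
    | succ m =>
      refine (hRdist _ _ _ (hc3 m x y fun i hi => h1 i (by omega))).trans ?_
      gcongr
      · norm_num
      · omega

theorem exists_holderWith_of_dist_pow_le {X Y : Type*} [MetricSpace X] [MetricSpace Y] (h : X → Y)
    (n : ℕ) (hn : 1 ≤ n) (K : ℝ) (hK : 0 ≤ K)
    (hh : ∀ x y, dist (h x) (h y) ^ n ≤ K * dist x y) :
    ∃ C r : ℝ≥0, 0 < r ∧ HolderWith C r h := by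
  have hn0 : (n : ℝ) ≠ 0 := by positivity
  refine ⟨(K ^ (1 / (n : ℝ))).toNNReal, 1 / n, by positivity, fun x y => ?_⟩
  have h1 : dist (h x) (h y) ≤ K ^ (1 / (n : ℝ)) * dist x y ^ (1 / (n : ℝ)) := by
    rw [← Real.mul_rpow hK dist_nonneg]
    calc dist (h x) (h y) = (dist (h x) (h y) ^ n) ^ (1 / (n : ℝ)) := by
          rw [one_div, Real.pow_rpow_inv_natCast dist_nonneg (by omega)]
      _ ≤ _ := Real.rpow_le_rpow (by positivity) (hh x y) (by positivity)
  rw [edist_dist, edist_dist, ENNReal.ofReal_rpow_of_nonneg dist_nonneg (by positivity),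
    ENNReal.ofNNReal_toNNReal, ← ENNReal.ofReal_mul (by positivity)]
  refine ENNReal.ofReal_le_ofReal ?_
  simpa using h1

/-- At the first differing digit `m`, raising the upper bound at scale `α^m` to the power `α^2`
gives the lower bound at scale `α^(m+2)`. The Hölder exponent is `1/(k α^2)`. -/
theorem exists_holderWith_of_codings {X Y : Type*} [MetricSpace X] [MetricSpace Y]
    {M : ℕ → ℕ} {α k q : ℕ} (hα : 1 ≤ α) (hk : 1 ≤ k)
    (e : X ≃ {f : ℕ → ℕ // ∀ m, f m < M m}) (e' : Y ≃ {f : ℕ → ℕ // ∀ m, f m < M m})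
    (h : ∀ x y m, (∀ i < m, (e x).1 i = (e y).1 i) → (e x).1 m ≠ (e y).1 m →
      (1 / 2 : ℝ) ^ (α ^ (m + 2)) ≤ dist x y)
    (h' : ∀ x y m, (∀ i < m, (e' x).1 i = (e' y).1 i) → (e' x).1 m ≠ (e' y).1 m →
      dist x y ^ k ≤ 2 ^ q * (1 / 2) ^ (α ^ m)) :
    ∃ C r : ℝ≥0, 0 < r ∧ HolderWith C r (e.trans e'.symm) := by
  classical
  have hα2 : 1 ≤ α ^ 2 := Nat.one_le_pow _ _ hα
  refine exists_holderWith_of_dist_pow_le _ (k * α ^ 2) (Nat.mul_pos hk hα2) ((2 ^ q) ^ (α ^ 2))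
    (by positivity) fun x y => ?_
  by_cases hxy : x = y
  · subst hxy
    rw [dist_self, dist_self, zero_pow (by positivity), mul_zero]
  · have hne : ∃ m, (e x).1 m ≠ (e y).1 m := by
      by_contra hcon
      push Not at hcon
      exact hxy (e.injective (Subtype.ext (funext hcon)))
    have hm := Nat.find_spec hne
    have hlt : ∀ i < Nat.find hne, (e x).1 i = (e y).1 i := fun i hi =>
      not_not.1 (Nat.find_min hne hi)
    set m := Nat.find hne
    have h1 := h x y m hlt hm
    have h2 := h' ((e.trans e'.symm) x) ((e.trans e'.symm) y) m (by simpa using hlt)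
      (by simpa using hm)
    rw [pow_mul]
    calc _ ≤ (2 ^ q * (1 / 2 : ℝ) ^ (α ^ m)) ^ (α ^ 2) := pow_le_pow_left₀ (by positivity) h2 _
      _ = (2 ^ q) ^ (α ^ 2) * (1 / 2 : ℝ) ^ (α ^ (m + 2)) := by
        rw [mul_pow, ← pow_mul (1 / 2 : ℝ), ← pow_add]
      _ ≤ _ := by gcongr

theorem IsHolderCoded.biHolderHomeomorphic {X Y : Type*} [MetricSpace X] [MetricSpace Y]
    {B α k q k' q' : ℕ} (hα : 1 ≤ α) (hk : 1 ≤ k) (hk' : 1 ≤ k') (hX : IsHolderCoded X B α k q)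
    (hY : IsHolderCoded Y B α k' q') : BiHolderHomeomorphic X Y := by
  obtain ⟨e, he⟩ := hX
  obtain ⟨e', he'⟩ := hY
  obtain ⟨C, r, hr, h⟩ := exists_holderWith_of_codings hα hk' e e'
    (fun x y m h1 h2 => (he x y m h1 h2).1) (fun x y m h1 h2 => (he' x y m h1 h2).2)
  obtain ⟨C', r', hr', h'⟩ := exists_holderWith_of_codings hα hk e' e
    (fun x y m h1 h2 => (he' x y m h1 h2).1) (fun x y m h1 h2 => (he x y m h1 h2).2)
  exact ⟨e.trans e'.symm, C, C', r, r', hr, hr', h, h'⟩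

/-- The branching numbers of a coding depend on `B` and `α` only, and both may be enlarged. A common
choice gives both spaces the same code space; the constants `k`, `q` may differ. -/
theorem IsHolderCantor.biHolderHomeomorphic {X Y : Type*} [MetricSpace X] [MetricSpace Y]
    (hX : IsHolderCantor X) (hY : IsHolderCantor Y) : BiHolderHomeomorphic X Y := by
  obtain ⟨B₁, k₁, q₁, hk₁, h₁⟩ := hX.exists_isHolderCoded
  obtain ⟨B₂, k₂, q₂, hk₂, h₂⟩ := hY.exists_isHolderCoded
  obtain ⟨α₁, h₁⟩ := h₁ (max B₁ B₂) (le_max_left _ _)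
  obtain ⟨α₂, h₂⟩ := h₂ (max B₁ B₂) (le_max_right _ _)
  have hα : max α₁ α₂ ≤ max (max α₁ α₂) 1 := le_max_left _ _
  exact (h₁ _ ((le_max_left _ _).trans hα)).biHolderHomeomorphic (le_max_right _ _) hk₁ hk₂
    (h₂ _ ((le_max_right _ _).trans hα))

/-! ### The Markov measure on the path space -/

namespace StationaryDiagram

set_option linter.unusedSectionVars false

variable {V E : Type*} {D : StationaryDiagram V E}

theorem mem_cylinder_self (x : D.InfPath) (n : ℕ) : x ∈ D.cylinder x n := by
  cases n with
  | zero => trivial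
  | succ n => exact ⟨rfl, fun _ _ => rfl⟩

theorem mem_cylinder_comm {x y : D.InfPath} {n : ℕ} :
    y ∈ D.cylinder x n ↔ x ∈ D.cylinder y n := by
  cases n with
  | zero => exact Iff.rfl
  | succ n =>
    exact ⟨fun h => ⟨h.1.symm, fun i hi => (h.2 i hi).symm⟩,
      fun h => ⟨h.1.symm, fun i hi => (h.2 i hi).symm⟩⟩

theorem cylinder_eq_of_mem {x y : D.InfPath} {n : ℕ} (h : y ∈ D.cylinder x n) :
    D.cylinder y n = D.cylinder x n := by
  cases n with
  | zero => rfl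
  | succ n =>
    ext z
    exact ⟨fun hz => ⟨hz.1.trans h.1, fun i hi => (hz.2 i hi).trans (h.2 i hi)⟩,
      fun hz => ⟨hz.1.trans h.1.symm, fun i hi => (hz.2 i hi).trans (h.2 i hi).symm⟩⟩

theorem cylinder_succ_subset (x : D.InfPath) (n : ℕ) : D.cylinder x (n + 1) ⊆ D.cylinder x n := by
  cases n with
  | zero => exact fun _ _ => trivial
  | succ n => exact fun y hy => ⟨hy.1, fun i hi => hy.2 i (hi.trans (Nat.lt_succ_self n))⟩

theorem cylinder_antitone (x : D.InfPath) : Antitone (D.cylinder x) :=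
  antitone_nat_of_succ_le fun n => cylinder_succ_subset x n

theorem src_eq_of_mem_cylinder {x y : D.InfPath} {n : ℕ} (h : y ∈ D.cylinder x (n + 1)) :
    D.src (y.1 n) = D.src (x.1 n) := by
  cases n with
  | zero => exact h.1
  | succ n => rw [← y.2 n, ← x.2 n, h.2 n (Nat.lt_succ_self n)]

theorem mem_cylinder_add_two {x y : D.InfPath} {n : ℕ} :
    y ∈ D.cylinder x (n + 2) ↔ ∀ i ≤ n, y.1 i = x.1 i :=
  ⟨fun h i hi => h.2 i (Nat.lt_succ_of_le hi),
    fun h => ⟨by rw [h 0 (Nat.zero_le n)], fun i hi => h i (Nat.le_of_lt_succ hi)⟩⟩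

theorem mem_cylinder_add_two_iff {x y : D.InfPath} {n : ℕ} :
    y ∈ D.cylinder x (n + 2) ↔ y ∈ D.cylinder x (n + 1) ∧ y.1 n = x.1 n :=
  ⟨fun h => ⟨cylinder_succ_subset x _ h, h.2 n (Nat.lt_succ_self n)⟩, fun h => ⟨h.1.1, fun i hi => by
    rcases Nat.lt_succ_iff_lt_or_eq.1 hi with hi | rfl
    · exact h.1.2 i hi
    · exact h.2⟩⟩

theorem measurable_coe [MeasurableSpace E] : Measurable fun x : D.InfPath => x.1 :=
  measurable_subtype_coe

theorem measurable_coord [MeasurableSpace E] (n : ℕ) : Measurable fun x : D.InfPath => x.1 n :=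
  (measurable_pi_apply n).comp measurable_coe

theorem measurableSet_cylinder [MeasurableSpace E] [DiscreteMeasurableSpace E] (x : D.InfPath)
    (n : ℕ) : MeasurableSet (D.cylinder x n) := by
  cases n with
  | zero => exact MeasurableSet.univ
  | succ n =>
    have : D.cylinder x (n + 1) = (fun y : D.InfPath => y.1 0) ⁻¹' {e | D.src e = D.src (x.1 0)} ∩
        ⋂ i : ℕ, ⋂ _ : i < n, (fun y : D.InfPath => y.1 i) ⁻¹' {x.1 i} := by
      ext y
      simp [cylinder]
    rw [this]
    exact (measurable_coord 0 (MeasurableSet.of_discrete)).inter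
      (.iInter fun i => .iInter fun _ => measurable_coord i (MeasurableSet.of_discrete))

theorem measurableSet_range_coe [MeasurableSpace E] [DiscreteMeasurableSpace E] [Countable E] :
    MeasurableSet {x : ℕ → E | ∀ n, D.tgt (x n) = D.src (x (n + 1))} := by
  have : {x : ℕ → E | ∀ n, D.tgt (x n) = D.src (x (n + 1))} =
      ⋂ n, (fun x : ℕ → E => (x n, x (n + 1))) ⁻¹' {p | D.tgt p.1 = D.src p.2} := by
    ext; simp
  rw [this]
  exact .iInter fun n => (by fun_prop : Measurable fun x : ℕ → E => (x n, x (n + 1)))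
    MeasurableSet.of_discrete

theorem measurableSet_coord_eq {ι : Type*} [MeasurableSpace E] [DiscreteMeasurableSpace E] (i : ι)
    (a : E) : MeasurableSet {u : ι → E | u i = a} :=
  (measurable_pi_apply (X := fun _ : ι => E) i) (MeasurableSet.of_discrete (s := {a}))

namespace PerronData

variable [Fintype V] [Fintype E] (P : D.PerronData) [DecidableEq V]
  [MeasurableSpace E] [DiscreteMeasurableSpace E]

theorem initialLaw_apply (a : E) :
    P.initialLaw {a} = ENNReal.ofReal (P.vec (D.tgt a) / P.eigenvalue) := by
  classical
  simp only [initialLaw, Measure.coe_finsetSum, Finset.sum_apply, Measure.smul_apply, smul_eq_mul,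
    Measure.dirac_apply' _ (MeasurableSet.of_discrete), Set.indicator_apply, Set.mem_singleton_iff]
  simp

theorem nextLaw_apply (a b : E) :
    P.nextLaw a {b} = ENNReal.ofReal (if D.src b = D.tgt a then
      P.vec (D.tgt b) / (P.eigenvalue * P.vec (D.tgt a)) else 0) := by
  classical
  simp only [nextLaw, Measure.coe_finsetSum, Finset.sum_apply, Measure.smul_apply, smul_eq_mul,
    Measure.dirac_apply' _ (MeasurableSet.of_discrete), Set.indicator_apply, Set.mem_singleton_iff]
  simp

theorem isProbabilityMeasure_initialLaw : IsProbabilityMeasure P.initialLaw := by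
  constructor
  simp only [initialLaw, Measure.coe_finsetSum, Finset.sum_apply, Measure.smul_apply,
    measure_univ, smul_eq_mul, mul_one]
  rw [← ENNReal.ofReal_sum_of_nonneg fun e _ => div_nonneg (P.vec_pos _).le P.eigenvalue_pos.le,
    ← Finset.sum_div, ← Finset.sum_fiberwise (s := Finset.univ) (g := D.src)]
  have h : ∀ v, ∑ e with D.src e = v, P.vec (D.tgt e) = P.eigenvalue * P.vec v := fun v => by
    rw [← P.sum_edges v, Finset.sum_filter]
  rw [Finset.sum_congr rfl fun v _ => h v, ← Finset.mul_sum, P.sum_vec, mul_one,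
    div_self P.eigenvalue_pos.ne', ENNReal.ofReal_one]

/-- The law of a random path, as a measure on all sequences of edges. -/
noncomputable def seqMeasure : Measure (ℕ → E) :=
  Kernel.trajMeasure (X := fun _ => E) P.initialLaw P.nextKernel

instance : IsProbabilityMeasure P.seqMeasure := by
  have := P.isProbabilityMeasure_initialLaw
  unfold seqMeasure
  infer_instance

/-- The Markov property: once the `n`-th edge is known to be `a`, the next edge has law `nextLaw a`,
whatever the earlier past. -/
theorem seqMeasure_inter (n : ℕ) (A : Set (∀ _ : Finset.Iic n, E)) (hA : MeasurableSet A) (a b : E)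
    (hAa : ∀ u ∈ A, u ⟨n, by simp⟩ = a) :
    P.seqMeasure {x | Preorder.frestrictLe n x ∈ A ∧ x (n + 1) = b} =
      P.nextLaw a {b} * P.seqMeasure {x | Preorder.frestrictLe n x ∈ A} := by
  have := P.isProbabilityMeasure_initialLaw
  have h := congrArg (fun m => m (A ×ˢ {b}))
    (Kernel.map_frestrictLe_trajMeasure_compProd_eq_map_trajMeasure (X := fun _ => E)
      (μ₀ := P.initialLaw) (κ := P.nextKernel) (a := n))
  rw [Measure.compProd_apply_prod hA MeasurableSet.of_discrete,
    Measure.map_apply (by fun_prop) (hA.prod MeasurableSet.of_discrete)] at h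
  have h2 : ∫⁻ u in A, P.nextKernel n u {b} ∂(Kernel.trajMeasure (X := fun _ => E) P.initialLaw P.nextKernel).map
      (Preorder.frestrictLe n) = P.nextLaw a {b} * P.seqMeasure {x | Preorder.frestrictLe n x ∈ A} := by
    rw [setLIntegral_congr_fun (g := fun _ => P.nextLaw a {b}) (s := A) hA, setLIntegral_const,
      Measure.map_apply (by fun_prop) hA]
    · rfl
    · intro u hu
      simp only [nextKernel, Kernel.comap_apply, Kernel.ofFunOfCountable, Kernel.coe_mk, hAa u hu]
  rw [← h2, h]
  rfl

theorem seqMeasure_zero (a : E) :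
    P.seqMeasure {x | x 0 = a} = ENNReal.ofReal (P.vec (D.tgt a) / P.eigenvalue) := by
  have := P.isProbabilityMeasure_initialLaw
  have h : P.seqMeasure.map (Preorder.frestrictLe 0) =
      P.initialLaw.map (MeasurableEquiv.piUnique fun _ : Finset.Iic 0 => E).symm := by
    rw [seqMeasure, Kernel.trajMeasure, Measure.map_comp _ _ (by fun_prop),
      Kernel.traj_map_frestrictLe, Kernel.partialTraj_self, Measure.id_comp]
  have h2 := congrArg (fun m => m {u | u ⟨0, by simp⟩ = a}) h
  have hms : MeasurableSet {u : ∀ _ : Finset.Iic 0, E | u ⟨0, by simp⟩ = a} :=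
    measurableSet_coord_eq _ a
  rw [Measure.map_apply (by fun_prop) hms,
    Measure.map_apply (MeasurableEquiv.measurable _) hms] at h2
  rw [← P.initialLaw_apply a]
  refine Eq.trans ?_ (h2.trans ?_)
  · rfl
  · rfl

/-- The transition probabilities telescope: each denominator cancels the coordinate of `ν` produced
by the preceding factor. -/
theorem seqMeasure_cylinder (a : D.InfPath) (n : ℕ) : P.seqMeasure {x | ∀ i ≤ n, x i = a.1 i} =
    ENNReal.ofReal (P.vec (D.tgt (a.1 n)) / P.eigenvalue ^ (n + 1)) := by
  induction n with
  | zero => simpa using P.seqMeasure_zero (a.1 0)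
  | succ n ih =>
    have hms : MeasurableSet {u : ∀ _ : Finset.Iic n, E | ∀ i, u i = a.1 i} := by
      rw [Set.ofPred_forall]
      exact .iInter fun i => measurableSet_coord_eq i _
    have h := P.seqMeasure_inter n {u | ∀ i, u i = a.1 i} hms (a.1 n) (a.1 (n + 1)) fun u hu => hu _
    have h1 : {x : ℕ → E | Preorder.frestrictLe n x ∈ {u : ∀ _ : Finset.Iic n, E | ∀ i, u i = a.1 i}}
        = {x | ∀ i ≤ n, x i = a.1 i} := by
      ext x
      simp
    have h2 : {x : ℕ → E | Preorder.frestrictLe n x ∈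
        {u : ∀ _ : Finset.Iic n, E | ∀ i, u i = a.1 i} ∧ x (n + 1) = a.1 (n + 1)}
        = {x | ∀ i ≤ n + 1, x i = a.1 i} := by
      ext x
      simp only [Set.mem_ofPred_eq, Preorder.frestrictLe_apply, Subtype.forall, Finset.mem_Iic]
      refine ⟨fun h i hi => ?_, fun h => ⟨fun i hi => h i (by omega), h _ le_rfl⟩⟩
      rcases Nat.le_succ_iff.1 hi with hi | rfl
      · exact h.1 i hi
      · exact h.2
    rw [h1, h2, ih, P.nextLaw_apply, if_pos (a.2 n).symm, ← ENNReal.ofReal_mul] at h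
    · rw [h]
      congr 1
      have := P.vec_pos (D.tgt (a.1 n))
      have := P.eigenvalue_pos
      field_simp
      ring
    · exact div_nonneg (P.vec_pos _).le (mul_pos P.eigenvalue_pos (P.vec_pos _)).le

/-- Forbidden transitions have probability zero. Hence restricting the law on edge sequences to the
path space loses no mass. -/
theorem seqMeasure_not_path :
    P.seqMeasure {x | ∀ n, D.tgt (x n) = D.src (x (n + 1))}ᶜ = 0 := by
  have : {x : ℕ → E | ∀ n, D.tgt (x n) = D.src (x (n + 1))}ᶜ =
      ⋃ n : ℕ, ⋃ a : E, ⋃ b : {b : E // D.src b ≠ D.tgt a}, {x : ℕ → E | x n = a ∧ x (n + 1) = b} := by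
    ext x
    simp only [Set.mem_compl_iff, Set.mem_ofPred_eq, not_forall, Set.mem_iUnion]
    exact ⟨fun ⟨n, hn⟩ => ⟨n, x n, ⟨x (n + 1), Ne.symm hn⟩, rfl, rfl⟩,
      fun ⟨n, a, b, h1, h2⟩ => ⟨n, by rw [h1, h2]; exact b.2.symm⟩⟩
  rw [this]
  refine measure_iUnion_null fun n => measure_iUnion_null fun a => measure_iUnion_null fun b => ?_
  have hms : MeasurableSet {u : ∀ _ : Finset.Iic n, E | u ⟨n, by simp⟩ = a} :=
    measurableSet_coord_eq _ a
  have h := P.seqMeasure_inter n _ hms a b fun u hu => hu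
  rw [P.nextLaw_apply, if_neg b.2, ENNReal.ofReal_zero, zero_mul] at h
  exact h

theorem measure_apply (A : Set D.InfPath) :
    P.measure A = P.seqMeasure (Subtype.val '' A) := by
  have he : MeasurableEmbedding (Subtype.val : D.InfPath → ℕ → E) :=
    MeasurableEmbedding.subtype_coe measurableSet_range_coe
  exact he.comap_apply _ A

theorem measure_preimage (A : Set (ℕ → E)) :
    P.measure ((fun x : D.InfPath => x.1) ⁻¹' A) = P.seqMeasure A := by
  rw [P.measure_apply]
  have : Subtype.val '' ((fun x : D.InfPath => x.1) ⁻¹' A) =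
      A ∩ {x | ∀ n, D.tgt (x n) = D.src (x (n + 1))} := by
    ext x
    exact ⟨fun ⟨y, hy, h⟩ => h ▸ ⟨hy, y.2⟩, fun h => ⟨⟨x, h.2⟩, h.1, rfl⟩⟩
  exact (congrArg P.seqMeasure this).trans (measure_inter_conull P.seqMeasure_not_path)

instance : IsProbabilityMeasure P.measure := by
  constructor
  rw [← Set.preimage_univ (f := fun x : D.InfPath => x.1), P.measure_preimage,
    measure_univ]

/-- The mass of the cylinder of the prefix of index `n` of `x`. -/
noncomputable def mass (x : D.InfPath) (n : ℕ) : ℝ := P.measure.real (D.cylinder x n)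

theorem mass_zero (x : D.InfPath) : P.mass x 0 = 1 := by
  simp [mass, cylinder]

theorem mass_succ (x : D.InfPath) (n : ℕ) :
    P.mass x (n + 1) = P.vec (D.src (x.1 n)) / P.eigenvalue ^ n := by
  have hnn : 0 ≤ P.vec (D.src (x.1 n)) / P.eigenvalue ^ n :=
    div_nonneg (P.vec_pos _).le (pow_pos P.eigenvalue_pos n).le
  rw [mass, Measure.real, ← ENNReal.toReal_ofReal hnn]
  congr 1
  cases n with
  | zero =>
    -- A prefix of index `1` fixes only the vertex below the root; the eigenvector equation sums the
    -- masses of the edges leaving it.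
    have h1 : D.cylinder x (0 + 1) =
        (fun y : D.InfPath => y.1) ⁻¹' ⋃ a ∈ (Finset.univ.filter fun a => D.src a = D.src (x.1 0)),
          {z : ℕ → E | z 0 = a} := by
      ext y
      simp [cylinder]
    have hms : ∀ a : E, MeasurableSet {z : ℕ → E | z 0 = a} := fun a =>
      measurableSet_coord_eq 0 a
    rw [h1, P.measure_preimage,
      measure_biUnion_finset (fun a _ b _ hab => ?_) (fun a _ => hms a)]
    · rw [Finset.sum_congr rfl fun a _ => P.seqMeasure_zero a, ← ENNReal.ofReal_sum_of_nonneg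
        fun e _ => div_nonneg (P.vec_pos _).le P.eigenvalue_pos.le, ← Finset.sum_div,
        Finset.sum_filter, P.sum_edges, pow_zero, div_one, mul_div_cancel_left₀ _ P.eigenvalue_pos.ne']
    · rw [Function.onFun, Set.disjoint_left]
      intro z hz hz'
      exact hab (hz.symm.trans hz')
  | succ n =>
    have h1 : D.cylinder x (n + 1 + 1) =
        (fun y : D.InfPath => y.1) ⁻¹' {z : ℕ → E | ∀ i ≤ n, z i = x.1 i} :=
      Set.ext fun y => mem_cylinder_add_two
    rw [h1, P.measure_preimage, P.seqMeasure_cylinder, x.2 n]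

theorem mass_pos (x : D.InfPath) (n : ℕ) : 0 < P.mass x n := by
  cases n with
  | zero => rw [mass_zero]; exact one_pos
  | succ n => rw [mass_succ]; exact div_pos (P.vec_pos _) (pow_pos P.eigenvalue_pos n)

end PerronData
end StationaryDiagram

namespace StationaryDiagram

set_option linter.unusedSectionVars false

variable {V E : Type*} {D : StationaryDiagram V E}

/-! ### Splicing of paths -/

/-- The path that follows `x` for `n` edges, and then `z`. -/
def splice (x : D.InfPath) (n : ℕ) (z : D.InfPath) (h : D.src (z.1 0) = D.src (x.1 n)) :
    D.InfPath :=
  ⟨fun i => if i < n then x.1 i else z.1 (i - n), fun i => by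
    by_cases h1 : i + 1 < n
    · simp only [if_pos h1, if_pos (show i < n by omega)]
      exact x.2 i
    · by_cases h2 : i < n
      · obtain rfl : n = i + 1 := by omega
        simp only [if_pos h2, if_neg h1, Nat.sub_self, h]
        exact x.2 i
      · simp only [if_neg h1, if_neg h2, show i + 1 - n = (i - n) + 1 by omega]
        exact z.2 (i - n)⟩

theorem splice_add (x : D.InfPath) (n : ℕ) (z : D.InfPath) (h : D.src (z.1 0) = D.src (x.1 n))
    (i : ℕ) : (splice x n z h).1 (n + i) = z.1 i := by
  change (if n + i < n then x.1 (n + i) else z.1 (n + i - n)) = z.1 i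
  rw [if_neg (by omega), Nat.add_sub_cancel_left]

theorem splice_of_lt (x : D.InfPath) (n : ℕ) (z : D.InfPath) (h : D.src (z.1 0) = D.src (x.1 n))
    {i : ℕ} (hi : i < n) : (splice x n z h).1 i = x.1 i :=
  if_pos hi

theorem splice_mem_cylinder (x : D.InfPath) (n : ℕ) (z : D.InfPath)
    (h : D.src (z.1 0) = D.src (x.1 n)) : splice x n z h ∈ D.cylinder x (n + 1) := by
  refine ⟨?_, fun i hi => splice_of_lt x n z h hi⟩
  cases n with
  | zero => exact h
  | succ n => rw [splice_of_lt _ _ _ _ (Nat.succ_pos n)]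

theorem exists_path_of_forall_exists (hD : ∀ v, ∃ e, D.src e = v) (a : E) :
    ∃ z : D.InfPath, z.1 0 = a := by
  choose next hnext using hD
  exact ⟨⟨fun n => Nat.rec a (fun _ e => next (D.tgt e)) n, fun n => (hnext _).symm⟩, rfl⟩

theorem meetIndex_eq {x y : D.InfPath} {n : ℕ} (h : y ∈ D.cylinder x n)
    (h' : y ∉ D.cylinder x (n + 1)) : D.meetIndex x y = n := by
  refine le_antisymm (Nat.sInf_le h') (le_csInf ⟨n, h'⟩ fun m hm => ?_)
  by_contra hlt
  exact hm (cylinder_antitone x (by omega) h)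

theorem meetIndex_comm (x y : D.InfPath) : D.meetIndex x y = D.meetIndex y x := by
  simp only [meetIndex, mem_cylinder_comm (x := x) (y := y)]

theorem mem_cylinder_meetIndex (x y : D.InfPath) : y ∈ D.cylinder x (D.meetIndex x y) := by
  cases h : D.meetIndex x y with
  | zero => trivial
  | succ n =>
    by_contra hy
    have : D.meetIndex x y ≤ n := Nat.sInf_le hy
    omega

/-! ### Masses of splitting pairs and size of the jump kernel -/

namespace PerronData

variable [Fintype V] [Fintype E] [DecidableEq V]

/-- A vertex without outgoing edge would give `(A ν)_v = 0`, while `Λ ν_v > 0`. So all finite paths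
extend to infinite ones. -/
theorem exists_src_eq (P : D.PerronData) (v : V) : ∃ e, D.src e = v := by
  by_contra h
  push Not at h
  have h1 := P.sum_edges v
  rw [Finset.sum_eq_zero fun e _ => if_neg (h e)] at h1
  exact (mul_pos P.eigenvalue_pos (P.vec_pos v)).ne h1

theorem exists_path (P : D.PerronData) (a : E) : ∃ z : D.InfPath, z.1 0 = a :=
  exists_path_of_forall_exists P.exists_src_eq a

variable (P : D.PerronData)

/-- The probability weight of an edge. -/
noncomputable def edgeMass (e : E) : ℝ := P.vec (D.tgt e) / P.eigenvalue

theorem edgeMass_pos (e : E) : 0 < P.edgeMass e := div_pos (P.vec_pos _) P.eigenvalue_pos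

theorem sum_edgeMass (v : V) : ∑ e with D.src e = v, P.edgeMass e = P.vec v := by
  simp only [edgeMass]
  rw [← Finset.sum_div, Finset.sum_filter, P.sum_edges,
    mul_div_cancel_left₀ _ P.eigenvalue_pos.ne']

theorem edgeMass_le (e : E) : P.edgeMass e ≤ P.vec (D.src e) := by
  rw [← P.sum_edgeMass]
  exact Finset.single_le_sum (fun a _ => (P.edgeMass_pos a).le)
    (Finset.mem_filter.2 ⟨Finset.mem_univ e, rfl⟩)

/-- The mass, relative to the scale, of the pairs of paths that split at the vertex `v`. -/
noncomputable def vertexSplit (v : V) : ℝ :=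
  ∑ e with D.src e = v, P.edgeMass e * (P.vec v - P.edgeMass e)

theorem vertexSplit_nonneg (v : V) : 0 ≤ P.vertexSplit v :=
  Finset.sum_nonneg fun e he => mul_nonneg (P.edgeMass_pos e).le (sub_nonneg.2 (by
    rw [← (Finset.mem_filter.1 he).2]; exact P.edgeMass_le e))

variable [MeasurableSpace E] [DiscreteMeasurableSpace E]

theorem mass_inter (x : D.InfPath) (n : ℕ) (a : E) (ha : D.src a = D.src (x.1 n)) :
    P.measure.real {y | y ∈ D.cylinder x (n + 1) ∧ y.1 n = a} = P.edgeMass a / P.eigenvalue ^ n := by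
  obtain ⟨z, hz⟩ := P.exists_path a
  let w := splice x n z (by rw [hz, ha])
  have hwn : w.1 n = a := (splice_add x n z (by rw [hz, ha]) 0).trans hz
  have h : {y | y ∈ D.cylinder x (n + 1) ∧ y.1 n = a} = D.cylinder w (n + 2) := by
    ext y
    rw [mem_cylinder_add_two_iff, cylinder_eq_of_mem (splice_mem_cylinder x n z _), hwn]
    rfl
  rw [h]
  change P.mass w (n + 2) = _
  rw [mass_succ, ← w.2 n, hwn, edgeMass, pow_succ, div_div, mul_comm]

/-- Sort the pairs by the edge `a` that the first path takes: the second path avoids `a`, so each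
piece is a product set. -/
theorem splitMass_succ (x : D.InfPath) (n : ℕ) :
    P.splitMass x (n + 1) = P.vertexSplit (D.src (x.1 n)) / (P.eigenvalue ^ n) ^ 2 := by
  let C : E → Set D.InfPath := fun a => {y | y ∈ D.cylinder x (n + 1) ∧ y.1 n = a}
  have hC : ∀ a, MeasurableSet (C a) := fun a => (measurableSet_cylinder x (n + 1)).inter
    (measurable_coord n (MeasurableSet.of_discrete (s := {a})))
  have hset : {p : D.InfPath × D.InfPath | p.1 ∈ D.cylinder x (n + 1) ∧
      p.2 ∈ D.cylinder x (n + 1) ∧ p.2 ∉ D.cylinder p.1 (n + 1 + 1)} =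
      ⋃ a ∈ (Finset.univ.filter fun a => D.src a = D.src (x.1 n)),
        C a ×ˢ (D.cylinder x (n + 1) \ C a) := by
    ext ⟨y, z⟩
    simp only [Set.mem_ofPred_eq, Finset.mem_filter, Finset.mem_univ, true_and, Set.mem_iUnion,
      Set.mem_prod, Set.mem_sdiff, exists_prop, C]
    constructor
    · rintro ⟨hy, hz, hyz⟩
      rw [mem_cylinder_add_two_iff, cylinder_eq_of_mem hy] at hyz
      exact ⟨y.1 n, src_eq_of_mem_cylinder hy, ⟨hy, rfl⟩, hz, hyz⟩
    · rintro ⟨a, -, ⟨hy, rfl⟩, hz, hyz⟩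
      rw [mem_cylinder_add_two_iff, cylinder_eq_of_mem hy]
      exact ⟨hy, hz, hyz⟩
  rw [splitMass, hset, measureReal_biUnion_finset, vertexSplit, Finset.sum_div]
  · refine Finset.sum_congr rfl fun a ha => ?_
    have ha' := (Finset.mem_filter.1 ha).2
    have h1 := P.mass_inter x n a ha'
    have h2 := P.mass_succ x n
    rw [measureReal_prod_prod, measureReal_sdiff (fun y hy => hy.1) (hC a)]
    rw [mass] at h2
    rw [h1, h2]
    ring
  · intro a _ b _ hab
    rw [Function.onFun, Set.disjoint_left]
    rintro ⟨y, z⟩ h1 h2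
    exact hab (h1.1.2.symm.trans h2.1.2)
  · exact fun a _ => (hC a).prod ((measurableSet_cylinder _ _).diff (hC a))

theorem splitMass_eq_of_mem {x y : D.InfPath} {n : ℕ} (h : y ∈ D.cylinder x n) :
    P.splitMass y n = P.splitMass x n := by
  rw [splitMass, splitMass, cylinder_eq_of_mem h]

theorem mass_eq_of_mem {x y : D.InfPath} {n : ℕ} (h : y ∈ D.cylinder x n) :
    P.mass y n = P.mass x n := by
  rw [mass, mass, cylinder_eq_of_mem h]

theorem weight_eq_of_mem (d : ℕ) {x y : D.InfPath} {n : ℕ} (h : y ∈ D.cylinder x n) :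
    P.weight d y n = P.weight d x n := by
  cases n with
  | zero => rfl
  | succ n => simp only [weight, src_eq_of_mem_cylinder h]

/-- The value of the jump kernel at the pairs that split at index `n`. -/
noncomputable def coef (d : ℕ) (s : ℝ) (x : D.InfPath) (n : ℕ) : ℝ :=
  P.weight d x n ^ (s - 2) / P.splitMass x n

theorem coef_eq_of_mem (d : ℕ) (s : ℝ) {x y : D.InfPath} {n : ℕ} (h : y ∈ D.cylinder x n) :
    P.coef d s y n = P.coef d s x n := by
  rw [coef, coef, P.splitMass_eq_of_mem h, P.weight_eq_of_mem d h]

theorem jump_eq_coef (d : ℕ) (s : ℝ) {x y : D.InfPath} {n : ℕ} (h : y ∈ D.cylinder x n)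
    (h' : y ∉ D.cylinder x (n + 1)) : P.jump d s (x, y) = P.coef d s x n := by
  simp only [jump, coef, meetIndex_eq h h']

theorem jump_swap (d : ℕ) (s : ℝ) (p : D.InfPath × D.InfPath) :
    P.jump d s p.swap = P.jump d s p :=
  (congrArg (P.coef d s p.2) (meetIndex_comm p.2 p.1)).trans
    (P.coef_eq_of_mem d s (mem_cylinder_meetIndex p.1 p.2))

/-- The exponent `(s - 2) / d` of the mass in the Dirichlet form. -/
noncomputable def massExp (d : ℕ) (s : ℝ) : ℝ := (s - 2) / d

/-- The coefficient of the Dirichlet form at a vertex, relative to the scale. -/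
noncomputable def vertexCoef (d : ℕ) (s : ℝ) (v : V) : ℝ :=
  P.vec v ^ massExp d s / P.vertexSplit v

theorem vertexCoef_nonneg (d : ℕ) (s : ℝ) (v : V) : 0 ≤ P.vertexCoef d s v :=
  div_nonneg (Real.rpow_nonneg (P.vec_pos v).le _) (P.vertexSplit_nonneg v)

/-- The weight contributes `Λ^(-n(s-2)/d)` and the split mass in the denominator `Λ^(2n)`. At a
vertex with a single outgoing edge both sides are `0`, since division by zero gives `0`. -/
theorem coef_succ (d : ℕ) (s : ℝ) (x : D.InfPath) (n : ℕ) :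
    P.coef d s x (n + 1) =
      P.vertexCoef d s (D.src (x.1 n)) * (P.eigenvalue ^ (2 - massExp d s)) ^ n := by
  have hΛ := P.eigenvalue_pos
  have hν := P.vec_pos (D.src (x.1 n))
  have h1 : P.weight d x (n + 1) ^ (s - 2) =
      P.vec (D.src (x.1 n)) ^ massExp d s / (P.eigenvalue ^ massExp d s) ^ n := by
    rw [weight, ← Real.rpow_mul (by positivity), Real.div_rpow hν.le (by positivity),
      ← Real.rpow_natCast, ← Real.rpow_natCast, ← Real.rpow_mul hΛ.le, ← Real.rpow_mul hΛ.le,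
      show 1 / (d : ℝ) * (s - 2) = massExp d s by rw [massExp]; ring, mul_comm (n : ℝ)]
  rw [coef, h1, P.splitMass_succ, vertexCoef, Real.rpow_sub hΛ, div_pow, Real.rpow_two, ← pow_mul,
    ← pow_mul, mul_comm n 2]
  rw [div_div_div_eq, div_mul_div_comm, mul_comm (_ ^ n)]

theorem measurable_mem_cylinder (n : ℕ) :
    MeasurableSet {p : D.InfPath × D.InfPath | p.2 ∈ D.cylinder p.1 n} := by
  cases n with
  | zero => exact MeasurableSet.univ
  | succ n =>
    have h : {p : D.InfPath × D.InfPath | p.2 ∈ D.cylinder p.1 (n + 1)} =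
        {p | D.src (p.2.1 0) = D.src (p.1.1 0)} ∩ ⋂ i : ℕ, ⋂ _ : i < n, {p | p.2.1 i = p.1.1 i} := by
      ext p
      simp [cylinder]
    have hm : ∀ i, Measurable fun p : D.InfPath × D.InfPath => (p.2.1 i, p.1.1 i) := fun i =>
      ((measurable_coord i).comp measurable_snd).prodMk ((measurable_coord i).comp measurable_fst)
    rw [h]
    exact (hm 0 (MeasurableSet.of_discrete (s := {q : E × E | D.src q.1 = D.src q.2}))).inter
      (.iInter fun i => .iInter fun _ =>
        hm i (MeasurableSet.of_discrete (s := {q : E × E | q.1 = q.2})))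

theorem measurable_coef (d : ℕ) (s : ℝ) (n : ℕ) : Measurable fun x => P.coef d s x n := by
  cases n with
  | zero =>
    rcases isEmpty_or_nonempty D.InfPath with _ | ⟨⟨x₀⟩⟩
    · exact measurable_of_empty _
    · have : (fun x => P.coef d s x 0) = fun _ => P.coef d s x₀ 0 :=
        funext fun x => P.coef_eq_of_mem d s trivial
      rw [this]
      exact measurable_const
  | succ n =>
    simp only [coef_succ]
    exact ((measurable_of_countable fun e : E => P.vertexCoef d s (D.src e)).comp
      (measurable_coord n)).mul_const _

theorem measurable_meetIndex : Measurable fun p : D.InfPath × D.InfPath => D.meetIndex p.1 p.2 := by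
  classical
  have hS : MeasurableSet {p : D.InfPath × D.InfPath | ∃ n, p.2 ∉ D.cylinder p.1 (n + 1)} := by
    rw [Set.ofPred_exists]
    exact .iUnion fun n => (measurable_mem_cylinder (n + 1)).compl
  refine measurable_to_countable' fun n => ?_
  have : (fun p : D.InfPath × D.InfPath => D.meetIndex p.1 p.2) ⁻¹' {n} =
      ({p | p.2 ∈ D.cylinder p.1 n} ∩ {p | p.2 ∈ D.cylinder p.1 (n + 1)}ᶜ) ∪
      -- Two equal paths have no splitting index, and there `sInf ∅ = 0` puts `meetIndex` equal to
      -- `0`.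
      ({p : D.InfPath × D.InfPath | ∃ m, p.2 ∉ D.cylinder p.1 (m + 1)}ᶜ ∩ {_p | 0 = n}) := by
    ext ⟨x, y⟩
    simp only [Set.mem_preimage, Set.mem_singleton_iff, Set.mem_union, Set.mem_inter_iff,
      Set.mem_ofPred_eq, Set.mem_compl_iff, not_exists, not_not]
    constructor
    · rintro rfl
      by_cases h : ∃ m, y ∉ D.cylinder x (m + 1)
      · exact Or.inl ⟨mem_cylinder_meetIndex x y, Nat.sInf_mem h⟩
      · push Not at h
        refine Or.inr ⟨h, ?_⟩
        have : {m | y ∉ D.cylinder x (m + 1)} = ∅ := Set.eq_empty_of_forall_notMem fun m hm => hm (h m)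
        rw [meetIndex, this, Nat.sInf_empty]
    · rintro (⟨h1, h2⟩ | ⟨h1, rfl⟩)
      · exact meetIndex_eq h1 h2
      · have : {m | y ∉ D.cylinder x (m + 1)} = ∅ :=
          Set.eq_empty_of_forall_notMem fun m hm => hm (h1 m)
        rw [meetIndex, this, Nat.sInf_empty]
  rw [this]
  exact ((measurable_mem_cylinder n).inter (measurable_mem_cylinder (n + 1)).compl).union
    (hS.compl.inter (MeasurableSet.const _))

theorem measurable_jump (d : ℕ) (s : ℝ) : Measurable (P.jump d s) := by
  have h : Measurable fun q : ℕ × D.InfPath => P.coef d s q.2 q.1 :=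
    measurable_from_prod_countable_right fun n => P.measurable_coef d s n
  exact h.comp (measurable_meetIndex.prodMk measurable_fst)

/-- If `(s-2)/d ≥ 2`, the powers of `Λ^(2-(s-2)/d)` do not grow. The bounded kernel makes all later
integrals converge and puts every `L²` function in the domain. -/
theorem exists_coef_le (hΛ : 1 ≤ P.eigenvalue) (d : ℕ) (s : ℝ) (hs : 2 ≤ massExp d s) :
    ∃ B, ∀ x n, |P.coef d s x n| ≤ B := by
  obtain ⟨x⟩ | hemp := isEmpty_or_nonempty D.InfPath
  · exact ⟨0, fun x => isEmptyElim x⟩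
  obtain ⟨x₀⟩ := hemp
  refine ⟨|P.coef d s x₀ 0| + ∑ v, P.vertexCoef d s v, fun x n => ?_⟩
  have hnn : 0 ≤ ∑ v, P.vertexCoef d s v := Finset.sum_nonneg fun v _ => P.vertexCoef_nonneg d s v
  cases n with
  | zero =>
    have : P.coef d s x 0 = P.coef d s x₀ 0 := P.coef_eq_of_mem d s trivial
    rw [this]
    linarith
  | succ n =>
    have h1 : P.vertexCoef d s (D.src (x.1 n)) ≤ ∑ v, P.vertexCoef d s v :=
      Finset.single_le_sum (fun v _ => P.vertexCoef_nonneg d s v) (Finset.mem_univ _)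
    have h2 : (P.eigenvalue ^ (2 - massExp d s)) ^ n ≤ 1 :=
      pow_le_one₀ (Real.rpow_nonneg P.eigenvalue_pos.le _)
        (Real.rpow_le_one_of_one_le_of_nonpos hΛ (by linarith))
    have h3 : 0 ≤ (P.eigenvalue ^ (2 - massExp d s)) ^ n :=
      pow_nonneg (Real.rpow_nonneg P.eigenvalue_pos.le _) _
    have h4 := P.vertexCoef_nonneg d s (D.src (x.1 n))
    rw [coef_succ, abs_of_nonneg (mul_nonneg h4 h3)]
    have := abs_nonneg (P.coef d s x₀ 0)
    nlinarith

theorem exists_jump_le (hΛ : 1 ≤ P.eigenvalue) (d : ℕ) (s : ℝ) (hs : 2 ≤ massExp d s) :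
    ∃ B, ∀ p, |P.jump d s p| ≤ B :=
  (P.exists_coef_le hΛ d s hs).imp fun _ h p => h p.1 _

/-! ### Haar functions and eigenvalues -/

theorem integrable_jump (hΛ : 1 ≤ P.eigenvalue) (d : ℕ) (s : ℝ) (hs : 2 ≤ massExp d s)
    (x : D.InfPath) : Integrable (fun y => P.jump d s (x, y)) P.measure := by
  obtain ⟨B, hB⟩ := P.exists_jump_le hΛ d s hs
  exact Integrable.of_bound
    ((P.measurable_jump d s).comp measurable_prodMk_left).aestronglyMeasurable B
    (.of_forall fun y => hB (x, y))

/-- The integral of the jump kernel over the complement of a cylinder. -/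
noncomputable def outerRate (d : ℕ) (s : ℝ) (x : D.InfPath) (n : ℕ) : ℝ :=
  ∑ k ∈ Finset.range n, P.coef d s x k * (P.mass x k - P.mass x (k + 1))

/-- The complement of a cylinder is a disjoint union of differences of consecutive cylinders around
`x`, and the kernel is constant on each of them. -/
theorem integral_jump_compl (hΛ : 1 ≤ P.eigenvalue) (d : ℕ) (s : ℝ) (hs : 2 ≤ massExp d s)
    (x : D.InfPath) (n : ℕ) :
    ∫ y in (D.cylinder x n)ᶜ, P.jump d s (x, y) ∂P.measure = P.outerRate d s x n := by
  induction n with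
  | zero => simp [cylinder, outerRate]
  | succ n ih =>
    have h : (D.cylinder x (n + 1))ᶜ = (D.cylinder x n)ᶜ ∪ (D.cylinder x n \ D.cylinder x (n + 1)) := by
      ext y
      have := @cylinder_succ_subset V E D x n y
      simp only [Set.mem_compl_iff, Set.mem_union, Set.mem_sdiff]
      tauto
    have hd : MeasurableSet (D.cylinder x n \ D.cylinder x (n + 1)) :=
      (measurableSet_cylinder x n).diff (measurableSet_cylinder x (n + 1))
    rw [h, setIntegral_union (disjoint_compl_left.mono_right fun y hy => hy.1) hd
      (P.integrable_jump hΛ d s hs x).integrableOn (P.integrable_jump hΛ d s hs x).integrableOn, ih,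
      outerRate, outerRate, Finset.sum_range_succ,
      setIntegral_congr_fun (g := fun _ => P.coef d s x n) hd
        fun y hy => P.jump_eq_coef d s hy.1 hy.2, setIntegral_const,
      measureReal_sdiff (cylinder_succ_subset x n) (measurableSet_cylinder x (n + 1)), smul_eq_mul,
      mul_comm (P.coef d s x n)]
    rfl

theorem outerRate_eq_of_mem (d : ℕ) (s : ℝ) {x y : D.InfPath} {n : ℕ} (h : y ∈ D.cylinder x n) :
    P.outerRate d s y n = P.outerRate d s x n :=
  Finset.sum_congr rfl fun k hk => by
    have hk := Finset.mem_range.1 hk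
    rw [P.coef_eq_of_mem d s (cylinder_antitone x hk.le h),
      P.mass_eq_of_mem (cylinder_antitone x hk.le h),
      P.mass_eq_of_mem (cylinder_antitone x (show k + 1 ≤ n by omega) h)]

/-- The generator of the jump process, applied to a function. -/
noncomputable def generator (d : ℕ) (s : ℝ) (g : D.InfPath → ℝ) (x : D.InfPath) : ℝ :=
  ∫ y, P.jump d s (x, y) * (g x - g y) ∂P.measure

/-- Ultrametric behaviour: seen from outside a cylinder, all of its points split off at the same
prefix. -/
theorem jump_eq_of_not_mem (d : ℕ) (s : ℝ) {x y z : D.InfPath} {n : ℕ} (hx : x ∉ D.cylinder z n)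
    (hy : y ∈ D.cylinder z n) : P.jump d s (x, y) = P.jump d s (x, z) := by
  have key : ∀ m, y ∈ D.cylinder x (m + 1) ↔ z ∈ D.cylinder x (m + 1) := by
    intro m
    rcases le_total (m + 1) n with hm | hm
    · have hyz := cylinder_eq_of_mem (cylinder_antitone z hm hy)
      rw [mem_cylinder_comm, hyz, mem_cylinder_comm]
    · refine ⟨fun h => ?_, fun h => ?_⟩
      · have h1 := cylinder_antitone x hm h
        rw [mem_cylinder_comm, cylinder_eq_of_mem hy] at h1
        exact absurd h1 hx
      · exact absurd (mem_cylinder_comm.1 (cylinder_antitone x hm h)) hx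
  have : D.meetIndex x y = D.meetIndex x z := by simp only [meetIndex, key]
  simp only [jump, this]

theorem generator_indicator_of_mem (hΛ : 1 ≤ P.eigenvalue) (d : ℕ) (s : ℝ)
    (hs : 2 ≤ massExp d s) {x z : D.InfPath} {n : ℕ} (hx : x ∈ D.cylinder z n) :
    P.generator d s ((D.cylinder z n).indicator 1) x = P.outerRate d s z n := by
  rw [← P.outerRate_eq_of_mem d s hx, ← P.integral_jump_compl hΛ d s hs,
    ← integral_indicator (measurableSet_cylinder x n).compl, cylinder_eq_of_mem hx, generator]
  refine integral_congr_ae (.of_forall fun y => ?_)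
  by_cases hy : y ∈ D.cylinder z n
  · simp [hx, hy]
  · simp [hx, hy]

theorem generator_indicator_of_not_mem (d : ℕ) (s : ℝ) {x z : D.InfPath} {n : ℕ}
    (hx : x ∉ D.cylinder z n) :
    P.generator d s ((D.cylinder z n).indicator 1) x = - P.jump d s (x, z) * P.mass z n := by
  have : ∀ y, P.jump d s (x, y) * ((D.cylinder z n).indicator (1 : D.InfPath → ℝ) x -
      (D.cylinder z n).indicator 1 y) =
      (D.cylinder z n).indicator (fun _ => - P.jump d s (x, z)) y := by
    intro y
    by_cases hy : y ∈ D.cylinder z n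
    · simp [hx, hy, P.jump_eq_of_not_mem d s hx hy]
    · simp [hx, hy]
  simp only [generator, this]
  rw [integral_indicator (measurableSet_cylinder z n), setIntegral_const, smul_eq_mul, mul_comm]
  rfl

/-- The Haar function of the prefixes of index `n` and `n + 1` of `z`. -/
noncomputable def haar (z : D.InfPath) (n : ℕ) (x : D.InfPath) : ℝ :=
  (D.cylinder z (n + 1)).indicator 1 x / P.mass z (n + 1) -
    (D.cylinder z n).indicator 1 x / P.mass z n

/-- The eigenvalue of the Laplacian at the prefix of index `n` of `z`. -/
noncomputable def eigval (d : ℕ) (s : ℝ) (z : D.InfPath) (n : ℕ) : ℝ :=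
  2 * (P.outerRate d s z n + P.coef d s z n * P.mass z n)

theorem measurable_indicator_cylinder (z : D.InfPath) (n : ℕ) :
    Measurable ((D.cylinder z n).indicator (1 : D.InfPath → ℝ)) :=
  measurable_one.indicator (measurableSet_cylinder z n)

theorem abs_indicator_le (A : Set D.InfPath) (x : D.InfPath) :
    |A.indicator (1 : D.InfPath → ℝ) x| ≤ 1 := by
  by_cases hx : x ∈ A <;> simp [hx]

theorem integrable_jump_mul (hΛ : 1 ≤ P.eigenvalue) (d : ℕ) (s : ℝ) (hs : 2 ≤ massExp d s)
    (z : D.InfPath) (n : ℕ) (x : D.InfPath) : Integrable (fun y => P.jump d s (x, y) *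
      ((D.cylinder z n).indicator (1 : D.InfPath → ℝ) x - (D.cylinder z n).indicator 1 y))
      P.measure := by
  refine (P.integrable_jump hΛ d s hs x).mul_bdd (c := 2)
    (measurable_const.sub (measurable_indicator_cylinder z n)).aestronglyMeasurable
    (.of_forall fun y => ?_)
  have h1 := abs_indicator_le (D.cylinder z n) x
  have h2 := abs_indicator_le (D.cylinder z n) y
  refine (norm_sub_le _ _).trans ?_
  rw [Real.norm_eq_abs, Real.norm_eq_abs]
  linarith

/-- The two normalised indicators have equal integrals. Seen from outside the larger cylinder their
contributions are therefore equal and cancel; the two cases inside it produce the same factor. The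
`2` reflects that the form counts ordered pairs. -/
theorem generator_haar (hΛ : 1 ≤ P.eigenvalue) (d : ℕ) (s : ℝ) (hs : 2 ≤ massExp d s)
    (z : D.InfPath) (n : ℕ) (x : D.InfPath) :
    2 * P.generator d s (P.haar z n) x = P.eigval d s z n * P.haar z n x := by
  have h : P.generator d s (P.haar z n) x =
      P.generator d s ((D.cylinder z (n + 1)).indicator 1) x / P.mass z (n + 1) -
        P.generator d s ((D.cylinder z n).indicator 1) x / P.mass z n := by
    simp only [generator]
    rw [← integral_div, ← integral_div, ← integral_sub
      ((P.integrable_jump_mul hΛ d s hs z (n + 1) x).div_const _)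
      ((P.integrable_jump_mul hΛ d s hs z n x).div_const _)]
    refine integral_congr_ae (.of_forall fun y => ?_)
    simp only [haar]
    ring
  have hm := P.mass_pos z n
  have hm' := P.mass_pos z (n + 1)
  have hrate : P.outerRate d s z (n + 1) =
      P.outerRate d s z n + P.coef d s z n * (P.mass z n - P.mass z (n + 1)) := by
    rw [outerRate, Finset.sum_range_succ, ← outerRate]
  rw [h, eigval, haar]
  by_cases h1 : x ∈ D.cylinder z n
  · rw [P.generator_indicator_of_mem hΛ d s hs h1, Set.indicator_of_mem h1]
    by_cases h2 : x ∈ D.cylinder z (n + 1)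
    · rw [P.generator_indicator_of_mem hΛ d s hs h2, Set.indicator_of_mem h2, hrate, Pi.one_apply]
      field_simp
      ring
    · have h3 : P.jump d s (x, z) = P.coef d s z n := by
        rw [← P.coef_eq_of_mem d s h1]
        exact P.jump_eq_coef d s (mem_cylinder_comm.1 h1) fun h => h2 (mem_cylinder_comm.1 h)
      rw [P.generator_indicator_of_not_mem d s h2, Set.indicator_of_notMem h2, h3, Pi.one_apply]
      field_simp
      ring
  · have h2 : x ∉ D.cylinder z (n + 1) := fun h => h1 (cylinder_succ_subset z n h)
    rw [P.generator_indicator_of_not_mem d s h2, P.generator_indicator_of_not_mem d s h1,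
      Set.indicator_of_notMem h1, Set.indicator_of_notMem h2]
    field_simp
    ring

end PerronData
end StationaryDiagram

/-! ### Completeness of the Haar functions and the list of eigenvalues -/

namespace StationaryDiagram

set_option linter.unusedSectionVars false

variable {V E : Type*} {D : StationaryDiagram V E}

/-- The set of paths with given first `m` edges. -/
def initialSet (D : StationaryDiagram V E) {m : ℕ} (u : Fin m → E) : Set D.InfPath :=
  {x | ∀ j : Fin m, x.1 j = u j}

theorem initialSet_eq_cylinder {m : ℕ} (hm : 1 ≤ m) {u : Fin m → E} {y : D.InfPath}
    (hy : y ∈ D.initialSet u) : D.initialSet u = D.cylinder y (m + 1) := by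
  obtain ⟨m, rfl⟩ := Nat.exists_eq_add_of_le' hm
  ext x
  rw [mem_cylinder_add_two]
  exact ⟨fun h i hi => (h ⟨i, by omega⟩).trans (hy ⟨i, by omega⟩).symm,
    fun h j => (h j (by omega)).trans (hy j)⟩

/-- The cylinders of index at least `n` generate the measurable structure of the path space. -/
theorem generateFrom_cylinders [Finite E] [MeasurableSpace E] [DiscreteMeasurableSpace E] (n : ℕ) :
    (inferInstance : MeasurableSpace D.InfPath) =
      MeasurableSpace.generateFrom {A | ∃ z m, n ≤ m ∧ A = D.cylinder z m} := by
  refine le_antisymm ?_ (MeasurableSpace.generateFrom_le ?_)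
  · have hle : ∀ i, Measurable[MeasurableSpace.generateFrom {A | ∃ z m, n ≤ m ∧ A = D.cylinder z m}]
        fun x : D.InfPath => x.1 i := by
      intro i
      let _ : MeasurableSpace D.InfPath :=
        MeasurableSpace.generateFrom {A | ∃ z m, n ≤ m ∧ A = D.cylinder z m}
      refine measurable_to_countable' fun e => ?_
      -- Fixing `max (i+1) n` edges makes the sets fine enough to see coordinate `i` and deep enough
      -- to be cylinders of index at least `n`.
      have h : (fun x : D.InfPath => x.1 i) ⁻¹' {e} =
          ⋃ u : {u : Fin (max (i + 1) n) → E // u ⟨i, by omega⟩ = e}, D.initialSet u.1 := by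
        ext x
        simp only [Set.mem_preimage, Set.mem_singleton_iff, Set.mem_iUnion]
        exact ⟨fun h => ⟨⟨fun j => x.1 j, h⟩, fun j => rfl⟩, fun ⟨u, hu⟩ => (hu ⟨i, by omega⟩).trans u.2⟩
      rw [h]
      refine MeasurableSet.iUnion fun u => ?_
      rcases (D.initialSet u.1).eq_empty_or_nonempty with h0 | ⟨y, hy⟩
      · rw [h0]; exact MeasurableSet.empty
      · rw [initialSet_eq_cylinder (by omega) hy]
        exact MeasurableSpace.measurableSet_generateFrom ⟨y, _, by omega, rfl⟩
    have hval : Measurable[MeasurableSpace.generateFrom {A | ∃ z m, n ≤ m ∧ A = D.cylinder z m}]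
        fun x : D.InfPath => x.1 := by
      let _ : MeasurableSpace D.InfPath :=
        MeasurableSpace.generateFrom {A | ∃ z m, n ≤ m ∧ A = D.cylinder z m}
      exact measurable_pi_iff.2 hle
    exact hval.comap_le
  · rintro _ ⟨z, m, -, rfl⟩
    exact measurableSet_cylinder z m

theorem isPiSystem_cylinders (n : ℕ) : IsPiSystem {A | ∃ z m, n ≤ m ∧ A = D.cylinder z m} := by
  rintro _ ⟨z, m, hm, rfl⟩ _ ⟨z', m', hm', rfl⟩ ⟨y, hy, hy'⟩
  rw [← cylinder_eq_of_mem hy, ← cylinder_eq_of_mem hy']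
  rcases le_total m m' with h | h
  · exact ⟨y, m', hm', Set.inter_eq_right.2 (cylinder_antitone y h)⟩
  · exact ⟨y, m, hm, Set.inter_eq_left.2 (cylinder_antitone y h)⟩

namespace PerronData

variable [Fintype V] [Fintype E] (P : D.PerronData) [DecidableEq V]
  [MeasurableSpace E] [DiscreteMeasurableSpace E]

/-- An integrable function with vanishing integrals over all cylinders vanishes. -/
theorem ae_eq_zero_of_forall_cylinder {f : D.InfPath → ℝ} (hf : Integrable f P.measure) (n : ℕ)
    (h : ∀ z m, n ≤ m → ∫ y in D.cylinder z m, f y ∂P.measure = 0) : f =ᵐ[P.measure] 0 := by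
  -- Complements in the π-λ induction need the total integral. The whole space has index `0`, which
  -- may be below `n`, so it is decomposed into deep cylinders.
  have htotal : ∫ y, f y ∂P.measure = 0 := by
    have hU : (⋃ u : Fin (n + 1) → E, D.initialSet u) = Set.univ :=
      Set.eq_univ_of_forall fun x => Set.mem_iUnion.2 ⟨fun j => x.1 j, fun j => rfl⟩
    have hcyl : ∀ u : Fin (n + 1) → E, D.initialSet u = ∅ ∨
        ∃ y, D.initialSet u = D.cylinder y (n + 2) := fun u => by
      rcases (D.initialSet u).eq_empty_or_nonempty with h0 | ⟨y, hy⟩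
      · exact Or.inl h0
      · exact Or.inr ⟨y, initialSet_eq_cylinder (by omega) hy⟩
    rw [← setIntegral_univ, ← hU, integral_iUnion_fintype]
    · refine Finset.sum_eq_zero fun u _ => ?_
      rcases hcyl u with h0 | ⟨y, hy⟩
      · rw [h0, Measure.restrict_empty, integral_zero_measure]
      · rw [hy]; exact h y _ (by omega)
    · intro u
      rcases hcyl u with h0 | ⟨y, hy⟩
      · rw [h0]; exact MeasurableSet.empty
      · rw [hy]; exact measurableSet_cylinder y _
    · intro u u' hne
      rw [Function.onFun, Set.disjoint_left]
      exact fun x hx hx' => hne (funext fun j => (hx j).symm.trans (hx' j))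
    · exact fun u => hf.integrableOn
  suffices hall : ∀ A, MeasurableSet A → ∫ x in A, f x ∂P.measure = 0 from
    hf.ae_eq_zero_of_forall_setIntegral_eq_zero fun A hA _ => hall A hA
  intro A hA
  refine MeasurableSpace.induction_on_inter (C := fun A _ => ∫ x in A, f x ∂P.measure = 0)
    (generateFrom_cylinders n) (isPiSystem_cylinders n) ?_ ?_ ?_ ?_ A hA
  · simp
  · rintro _ ⟨z, m, hm, rfl⟩
    exact h z m hm
  · intro A hA ih
    have := integral_add_compl hA hf
    rwa [ih, htotal, zero_add] at this
  · intro A hd hA ih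
    rw [integral_iUnion hA hd hf.integrableOn]
    simp [ih]

theorem measurable_haar (z : D.InfPath) (n : ℕ) : Measurable (P.haar z n) :=
  ((measurable_indicator_cylinder z (n + 1)).div_const _).sub
    ((measurable_indicator_cylinder z n).div_const _)

theorem exists_haar_le (z : D.InfPath) (n : ℕ) : ∃ B, ∀ x, |P.haar z n x| ≤ B := by
  refine ⟨1 / P.mass z (n + 1) + 1 / P.mass z n, fun x => ?_⟩
  have h : ∀ m, |(D.cylinder z m).indicator (1 : D.InfPath → ℝ) x / P.mass z m| ≤ 1 / P.mass z m :=
    fun m => by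
      rw [abs_div, abs_of_pos (P.mass_pos z m)]
      exact div_le_div_of_nonneg_right (abs_indicator_le _ _) (P.mass_pos z m).le
  refine (abs_sub _ _).trans (add_le_add (h _) (h _))

/-- Pairing with a Haar function compares the means of `f` over two nested cylinders. Thus
orthogonality carries vanishing means from one level to the next. -/
theorem integral_mul_haar {f : D.InfPath → ℝ} (hf : Integrable f P.measure) (z : D.InfPath)
    (n : ℕ) : ∫ x, f x * P.haar z n x ∂P.measure =
      (∫ x in D.cylinder z (n + 1), f x ∂P.measure) / P.mass z (n + 1) -
        (∫ x in D.cylinder z n, f x ∂P.measure) / P.mass z n := by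
  have h : ∀ m, Integrable ((D.cylinder z m).indicator f) P.measure := fun m =>
    hf.indicator (measurableSet_cylinder z m)
  rw [← integral_indicator (measurableSet_cylinder z _), ← integral_indicator
    (measurableSet_cylinder z _), ← integral_div, ← integral_div,
    ← integral_sub ((h _).div_const _) ((h _).div_const _)]
  refine integral_congr_ae (.of_forall fun x => ?_)
  by_cases h1 : x ∈ D.cylinder z (n + 1) <;> by_cases h2 : x ∈ D.cylinder z n <;>
    simp [haar, h1, h2] <;> ring

theorem integral_haar (z : D.InfPath) {m n : ℕ} (hmn : m ≤ n) (w : D.InfPath) :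
    ∫ x in D.cylinder w m, P.haar z n x ∂P.measure = 0 := by
  rw [← integral_indicator (measurableSet_cylinder w m)]
  have h : ∀ x, (D.cylinder w m).indicator (P.haar z n) x =
      (D.cylinder w m).indicator 1 x * P.haar z n x := fun x => by
    by_cases hx : x ∈ D.cylinder w m <;> simp [hx]
  simp only [h]
  have h1 : Integrable ((D.cylinder w m).indicator (1 : D.InfPath → ℝ)) P.measure :=
    (integrable_const (1 : ℝ)).indicator (measurableSet_cylinder w m)
  rw [P.integral_mul_haar h1]
  by_cases hz : z ∈ D.cylinder w m
  · have hsub : ∀ k, m ≤ k → D.cylinder z k ⊆ D.cylinder w m := fun k hk => by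
      rw [← cylinder_eq_of_mem hz]; exact cylinder_antitone z hk
    have h1 : ∀ k, m ≤ k → ∫ x in D.cylinder z k, (D.cylinder w m).indicator (1 : D.InfPath → ℝ) x
        ∂P.measure = P.mass z k := fun k hk => by
      rw [setIntegral_congr_fun (g := fun _ => (1 : ℝ)) (measurableSet_cylinder z k) fun x hx => by
        simp [hsub k hk hx], setIntegral_const, smul_eq_mul, mul_one, mass]
    rw [h1 _ hmn, h1 _ (by omega), div_self (P.mass_pos _ _).ne', div_self (P.mass_pos _ _).ne',
      sub_self]
  · have h1 : ∀ k, m ≤ k → ∫ x in D.cylinder z k, (D.cylinder w m).indicator (1 : D.InfPath → ℝ) x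
        ∂P.measure = 0 := fun k hk => by
      rw [setIntegral_congr_fun (g := fun _ => (0 : ℝ)) (measurableSet_cylinder z k) fun x hx => ?_]
      · simp
      · refine Set.indicator_of_notMem (fun hx' => hz ?_) _
        rw [← cylinder_eq_of_mem hx', cylinder_eq_of_mem (cylinder_antitone z hk hx)]
        exact mem_cylinder_self z m
    rw [h1 _ hmn, h1 _ (by omega), zero_div, zero_div, sub_self]

/-- By symmetry of the kernel the integrand is `A p + A p.swap`. Fubini then gives twice the pairing
of `f` with the generator applied to the Haar function. -/
theorem dirichletForm_haar (hΛ : 1 ≤ P.eigenvalue) (d : ℕ) (s : ℝ) (hs : 2 ≤ massExp d s)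
    {f : D.InfPath → ℝ} (hf : Integrable f P.measure) (z : D.InfPath) (n : ℕ) :
    P.dirichletForm d s f (P.haar z n) =
      P.eigval d s z n * ∫ x, f x * P.haar z n x ∂P.measure := by
  obtain ⟨B, hB⟩ := P.exists_jump_le hΛ d s hs
  obtain ⟨B', hB'⟩ := P.exists_haar_le z n
  let A : D.InfPath × D.InfPath → ℝ := fun p =>
    f p.1 * (P.jump d s p * (P.haar z n p.1 - P.haar z n p.2))
  have hA : Integrable A (P.measure.prod P.measure) := by
    refine (hf.comp_fst P.measure).mul_bdd (c := B * (B' + B')) ?_ (.of_forall fun p => ?_)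
    · exact ((P.measurable_jump d s).mul (((P.measurable_haar z n).comp measurable_fst).sub
        ((P.measurable_haar z n).comp measurable_snd))).aestronglyMeasurable
    · rw [norm_mul]
      exact mul_le_mul (hB p) ((norm_sub_le _ _).trans (add_le_add (hB' _) (hB' _)))
        (norm_nonneg _) ((abs_nonneg _).trans (hB p))
  have h1 : P.dirichletForm d s f (P.haar z n) =
      ∫ p, (A p + A p.swap) ∂P.measure.prod P.measure := by
    refine integral_congr_ae (.of_forall fun p => ?_)
    simp only [A, P.jump_swap, Prod.fst_swap, Prod.snd_swap]
    ring
  have h2 : ∫ p, A p.swap ∂P.measure.prod P.measure = ∫ p, A p ∂P.measure.prod P.measure :=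
    integral_prod_swap A
  have h3 : Integrable (fun p => A p.swap) (P.measure.prod P.measure) := hA.swap
  rw [h1, integral_add hA h3, h2, ← two_mul, integral_prod _ hA,
    ← integral_const_mul, ← integral_const_mul]
  refine integral_congr_ae (.of_forall fun x => ?_)
  simp only [A]
  rw [integral_const_mul]
  have := P.generator_haar hΛ d s hs z n x
  rw [generator] at this
  linear_combination f x * this

theorem dirichletForm_comm (d : ℕ) (s : ℝ) (f g : D.InfPath → ℝ) :
    P.dirichletForm d s f g = P.dirichletForm d s g f := by
  simp only [dirichletForm, mul_comm]

theorem dirichletForm_congr (d : ℕ) (s : ℝ) {f f' g g' : D.InfPath → ℝ}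
    (hf : f =ᵐ[P.measure] f') (hg : g =ᵐ[P.measure] g') :
    P.dirichletForm d s f g = P.dirichletForm d s f' g' := by
  have h1 := Measure.quasiMeasurePreserving_fst (μ := P.measure) (ν := P.measure)
  have h2 := Measure.quasiMeasurePreserving_snd (μ := P.measure) (ν := P.measure)
  refine integral_congr_ae ?_
  filter_upwards [h1.ae_eq_comp hf, h1.ae_eq_comp hg, h2.ae_eq_comp hf, h2.ae_eq_comp hg]
    with p hp1 hp2 hp3 hp4
  simp only [Function.comp_apply] at hp1 hp2 hp3 hp4
  rw [hp1, hp2, hp3, hp4]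

theorem finiteEnergy (hΛ : 1 ≤ P.eigenvalue) (d : ℕ) (s : ℝ) (hs : 2 ≤ massExp d s)
    (f : Lp ℝ 2 P.measure) : P.FiniteEnergy d s f := by
  obtain ⟨B, hB⟩ := P.exists_jump_le hΛ d s hs
  have h1 : MemLp (fun p : D.InfPath × D.InfPath => f p.1) 2 (P.measure.prod P.measure) :=
    (Lp.memLp f).comp_measurePreserving measurePreserving_fst
  have h2 : MemLp (fun p : D.InfPath × D.InfPath => f p.2) 2 (P.measure.prod P.measure) :=
    (Lp.memLp f).comp_measurePreserving measurePreserving_snd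
  exact (h1.sub h2).integrable_sq.bdd_mul (P.measurable_jump d s).aestronglyMeasurable
    (.of_forall hB)

theorem integrable_coe (f : Lp ℝ 2 P.measure) : Integrable f P.measure :=
  (Lp.memLp f).integrable (by norm_num)

theorem memLp_haar (z : D.InfPath) (n : ℕ) : MemLp (P.haar z n) 2 P.measure := by
  obtain ⟨B, hB⟩ := P.exists_haar_le z n
  exact MemLp.of_bound (P.measurable_haar z n).aestronglyMeasurable B (.of_forall hB)

theorem inner_haar (f : Lp ℝ 2 P.measure) (z : D.InfPath) (n : ℕ) :
    inner ℝ f (P.memLp_haar z n).toLp = ∫ x, f x * P.haar z n x ∂P.measure := by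
  rw [L2.inner_def]
  refine integral_congr_ae ?_
  filter_upwards [(P.memLp_haar z n).coeFn_toLp] with x hx
  rw [hx]
  simp [mul_comm]

theorem dirichletForm_toLp_haar (hΛ : 1 ≤ P.eigenvalue) (d : ℕ) (s : ℝ) (hs : 2 ≤ massExp d s)
    (f : Lp ℝ 2 P.measure) (z : D.InfPath) (n : ℕ) :
    P.dirichletForm d s f (P.memLp_haar z n).toLp =
      P.eigval d s z n * inner ℝ f (P.memLp_haar z n).toLp := by
  rw [P.dirichletForm_congr d s (ae_eq_refl _) (P.memLp_haar z n).coeFn_toLp,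
    P.dirichletForm_haar hΛ d s hs (P.integrable_coe f), P.inner_haar]

theorem isLaplacian_haar (hΛ : 1 ≤ P.eigenvalue) (d : ℕ) (s : ℝ) (hs : 2 ≤ massExp d s)
    (z : D.InfPath) (n : ℕ) :
    P.IsLaplacian d s (P.memLp_haar z n).toLp (P.eigval d s z n • (P.memLp_haar z n).toLp) :=
  ⟨P.finiteEnergy hΛ d s hs _, fun g _ => by
    rw [P.dirichletForm_toLp_haar hΛ d s hs, inner_smul_right]⟩

/-- The eigenvalue at a branching prefix is an eigenvalue of the Laplacian. -/
theorem eigval_mem_tailEigenvalues (hΛ : 1 ≤ P.eigenvalue) (d : ℕ) (s : ℝ) (hs : 2 ≤ massExp d s)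
    (z : D.InfPath) {m n : ℕ} (hmn : m ≤ n) (hz : P.mass z (n + 1) ≠ P.mass z n) :
    P.eigval d s z n ∈ P.tailEigenvalues d s m := by
  refine ⟨(P.memLp_haar z n).toLp, fun h0 => hz ?_, P.isLaplacian_haar hΛ d s hs z n, fun w => ?_⟩
  · have h1 : P.haar z n =ᵐ[P.measure] 0 :=
      (P.memLp_haar z n).coeFn_toLp.symm.trans ((Lp.eq_zero_iff_ae_eq_zero).1 h0)
    -- On the smaller cylinder the Haar function is a constant that vanishes only if the two masses
    -- agree, that is, if nothing branches off.
    have h2 : ∫ x in D.cylinder z (n + 1), P.haar z n x ∂P.measure = 0 := by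
      rw [integral_congr_ae (ae_restrict_of_ae h1)]
      simp
    rw [setIntegral_congr_fun (g := fun _ => 1 / P.mass z (n + 1) - 1 / P.mass z n)
      (measurableSet_cylinder z (n + 1)) fun x hx => by
        simp [haar, hx, cylinder_succ_subset z n hx], setIntegral_const, smul_eq_mul] at h2
    have h3 := P.mass_pos z (n + 1)
    have h4 := P.mass_pos z n
    change P.mass z (n + 1) * _ = 0 at h2
    field_simp at h2
    linarith
  · rw [integral_congr_ae (ae_restrict_of_ae (P.memLp_haar z n).coeFn_toLp)]
    exact P.integral_haar z hmn w

/-- All eigenvalues of the Laplacian are of this form. -/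
theorem exists_eigval_eq (hΛ : 1 ≤ P.eigenvalue) (d : ℕ) (s : ℝ) (hs : 2 ≤ massExp d s)
    {n : ℕ} {l : ℝ} (hl : l ∈ P.tailEigenvalues d s n) :
    ∃ z m, n ≤ m ∧ P.eigval d s z m = l := by
  obtain ⟨f, hf0, ⟨-, hf⟩, hmean⟩ := hl
  by_contra hcon
  push Not at hcon
  have hint := P.integrable_coe f
  -- Symmetry of the form: an eigenvector is orthogonal to every Haar function with a different
  -- eigenvalue.
  have horth : ∀ z m, n ≤ m → ∫ x, f x * P.haar z m x ∂P.measure = 0 := by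
    intro z m hm
    have h1 := hf (P.memLp_haar z m).toLp (P.finiteEnergy hΛ d s hs _)
    rw [P.dirichletForm_comm, P.dirichletForm_toLp_haar hΛ d s hs, inner_smul_right,
      real_inner_comm f, P.inner_haar] at h1
    exact (mul_eq_mul_right_iff.1 h1).resolve_left (hcon z m hm)
  refine hf0 ((Lp.eq_zero_iff_ae_eq_zero).2 (P.ae_eq_zero_of_forall_cylinder hint n fun z m hm => ?_))
  induction m, hm using Nat.le_induction with
  | base => exact hmean z
  | succ m hm ih =>
    have h := horth z m hm
    rw [P.integral_mul_haar hint, ih, zero_div, sub_zero, div_eq_zero_iff] at h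
    exact h.resolve_right (P.mass_pos _ _).ne'

end PerronData
end StationaryDiagram

/-! ### The limit set of the eigenvalues -/

namespace StationaryDiagram

set_option linter.unusedSectionVars false

variable {V E : Type*} {D : StationaryDiagram V E}

namespace PerronData

variable [Fintype V] [Fintype E] (P : D.PerronData) [DecidableEq V]
  [MeasurableSpace E] [DiscreteMeasurableSpace E]

/-- The contraction ratio `Λ ^ (1 - (s - 2) / d)` of the eigenvalues. -/
noncomputable def ratio (d : ℕ) (s : ℝ) : ℝ := P.eigenvalue ^ (1 - massExp d s)

theorem ratio_pos (d : ℕ) (s : ℝ) : 0 < P.ratio d s := Real.rpow_pos_of_pos P.eigenvalue_pos _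

theorem ratio_lt_one (hΛ : 1 < P.eigenvalue) (d : ℕ) (s : ℝ) (hs : 2 < massExp d s) :
    P.ratio d s < 1 :=
  Real.rpow_lt_one_of_one_lt_of_neg hΛ (by linarith)

theorem eigenvalue_mul_ratio_lt_one (hΛ : 1 < P.eigenvalue) (d : ℕ) (s : ℝ)
    (hs : 2 < massExp d s) : P.eigenvalue * P.ratio d s < 1 := by
  have h : P.eigenvalue * P.ratio d s = P.eigenvalue ^ (2 - massExp d s) := by
    rw [ratio, ← Real.rpow_one_add' P.eigenvalue_pos.le (by linarith)]
    congr 1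
    ring
  rw [h]
  exact Real.rpow_lt_one_of_one_lt_of_neg hΛ (by linarith)

/-- The contribution of an edge to the eigenvalues, relative to the scale. -/
noncomputable def gain (d : ℕ) (s : ℝ) (e : E) : ℝ :=
  P.vertexCoef d s (D.src e) * (P.vec (D.src e) - P.edgeMass e)

theorem gain_nonneg (d : ℕ) (s : ℝ) (e : E) : 0 ≤ P.gain d s e :=
  mul_nonneg (P.vertexCoef_nonneg d s _) (sub_nonneg.2 (P.edgeMass_le e))

/-- An upper bound of the contributions of the edges. -/
noncomputable def maxGain (d : ℕ) (s : ℝ) : ℝ := ∑ e, P.gain d s e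

theorem gain_le (d : ℕ) (s : ℝ) (e : E) : P.gain d s e ≤ P.maxGain d s :=
  Finset.single_le_sum (fun a _ => P.gain_nonneg d s a) (Finset.mem_univ e)

theorem maxGain_nonneg (d : ℕ) (s : ℝ) : 0 ≤ P.maxGain d s :=
  Finset.sum_nonneg fun a _ => P.gain_nonneg d s a

/-- The total contribution of a sequence of edges. -/
noncomputable def seqGain (d : ℕ) (s : ℝ) (u : ℕ → E) : ℝ :=
  ∑' k, P.ratio d s ^ k * P.gain d s (u k)

theorem abs_gain_le (d : ℕ) (s : ℝ) (u : ℕ → E) (k : ℕ) :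
    ‖P.ratio d s ^ k * P.gain d s (u k)‖ ≤ P.maxGain d s * P.ratio d s ^ k := by
  have h := pow_pos (P.ratio_pos d s) k
  rw [Real.norm_of_nonneg (mul_nonneg h.le (P.gain_nonneg d s _)), mul_comm]
  exact mul_le_mul_of_nonneg_right (P.gain_le d s _) h.le

variable {P} {d : ℕ} {s : ℝ}

theorem summable_bound (h1 : P.ratio d s < 1) :
    Summable fun k => P.maxGain d s * P.ratio d s ^ k :=
  (summable_geometric_of_lt_one (P.ratio_pos d s).le h1).mul_left _

theorem summable_gain (h1 : P.ratio d s < 1) (u : ℕ → E) :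
    Summable fun k => P.ratio d s ^ k * P.gain d s (u k) :=
  (summable_bound h1).of_norm_bounded (P.abs_gain_le d s u)

theorem seqGain_nonneg (u : ℕ → E) : 0 ≤ P.seqGain d s u :=
  tsum_nonneg fun k => mul_nonneg (pow_pos (P.ratio_pos d s) k).le (P.gain_nonneg d s _)

theorem seqGain_le (h1 : P.ratio d s < 1) (u : ℕ → E) :
    P.seqGain d s u ≤ P.maxGain d s / (1 - P.ratio d s) := by
  rw [div_eq_mul_inv, ← tsum_geometric_of_lt_one (P.ratio_pos d s).le h1, ← tsum_mul_left]
  exact (summable_gain h1 u).tsum_le_tsum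
    (fun k => (le_abs_self _).trans (P.abs_gain_le d s u k)) (summable_bound h1)

theorem seqGain_eq_add (h1 : P.ratio d s < 1) (u : ℕ → E) (n : ℕ) :
    P.seqGain d s u = ∑ k ∈ Finset.range n, P.ratio d s ^ k * P.gain d s (u k) +
      P.ratio d s ^ n * P.seqGain d s fun i => u (n + i) := by
  rw [seqGain, ← (summable_gain h1 u).sum_add_tsum_nat_add n, seqGain, ← tsum_mul_left]
  congr 2
  funext k
  rw [pow_add, add_comm k n]
  ring

variable (P d s) in
/-- The limit of the eigenvalues along a path. -/
noncomputable def limitEigval (x : D.InfPath) : ℝ :=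
  2 * (P.coef d s x 0 * (1 - P.vec (D.src (x.1 0))) + P.seqGain d s x.1)

/-- The jump coefficient grows like `(Λ ρ)^k` and the mass that splits off like `Λ^(-k)`, so the
outer rates are partial sums of a series of ratio `ρ`. -/
theorem outerRate_succ (x : D.InfPath) (n : ℕ) : P.outerRate d s x (n + 1) =
    P.coef d s x 0 * (1 - P.vec (D.src (x.1 0))) +
      ∑ k ∈ Finset.range n, P.ratio d s ^ k * P.gain d s (x.1 k) := by
  rw [outerRate, Finset.sum_range_succ', add_comm]
  congr 1
  · rw [mass_zero, mass_succ, pow_zero, div_one]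
  · refine Finset.sum_congr rfl fun k _ => ?_
    have hΛ := P.eigenvalue_pos
    have hr : P.eigenvalue ^ (2 - massExp d s) = P.eigenvalue * P.ratio d s := by
      rw [ratio, show 2 - massExp d s = 1 + (1 - massExp d s) by ring, Real.rpow_add hΛ,
        Real.rpow_one]
    rw [coef_succ, mass_succ, mass_succ, ← x.2 k, gain, edgeMass, hr, mul_pow]
    field_simp
    ring

theorem coef_mul_mass (x : D.InfPath) (n : ℕ) : P.coef d s x (n + 1) * P.mass x (n + 1) =
    P.ratio d s ^ n * (P.vertexCoef d s (D.src (x.1 n)) * P.vec (D.src (x.1 n))) := by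
  have hΛ := P.eigenvalue_pos
  have hr : P.eigenvalue ^ (2 - massExp d s) = P.eigenvalue * P.ratio d s := by
    rw [ratio, show 2 - massExp d s = 1 + (1 - massExp d s) by ring, Real.rpow_add hΛ,
      Real.rpow_one]
  rw [coef_succ, mass_succ, hr, mul_pow]
  field_simp

/-- The omitted tail of the series and the boundary term `coef * mass` both carry the factor `ρ^n`;
the remaining factors are bounded uniformly in the path. -/
theorem exists_abs_eigval_sub_le (h1 : P.ratio d s < 1) :
    ∃ C, ∀ (x : D.InfPath) (n : ℕ),
      |P.eigval d s x (n + 1) - P.limitEigval d s x| ≤ C * P.ratio d s ^ n := by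
  refine ⟨2 * (∑ v, P.vertexCoef d s v * P.vec v + P.maxGain d s / (1 - P.ratio d s)),
    fun x n => ?_⟩
  have hr := pow_pos (P.ratio_pos d s) n
  have h : P.eigval d s x (n + 1) - P.limitEigval d s x = 2 * P.ratio d s ^ n *
      (P.vertexCoef d s (D.src (x.1 n)) * P.vec (D.src (x.1 n)) -
        P.seqGain d s fun i => x.1 (n + i)) := by
    rw [eigval, limitEigval, outerRate_succ, coef_mul_mass, seqGain_eq_add h1 x.1 n]
    ring
  have hnn : ∀ v, 0 ≤ P.vertexCoef d s v * P.vec v := fun v =>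
    mul_nonneg (P.vertexCoef_nonneg d s v) (P.vec_pos v).le
  have h2 : P.vertexCoef d s (D.src (x.1 n)) * P.vec (D.src (x.1 n)) ≤
      ∑ v, P.vertexCoef d s v * P.vec v :=
    Finset.single_le_sum (fun v _ => hnn v) (Finset.mem_univ _)
  have h3 := seqGain_le h1 fun i => x.1 (n + i)
  have h4 := seqGain_nonneg (P := P) (d := d) (s := s) fun i => x.1 (n + i)
  have h5 := hnn (D.src (x.1 n))
  rw [h, abs_mul, abs_of_pos (by positivity), mul_right_comm]
  refine mul_le_mul_of_nonneg_right (mul_le_mul_of_nonneg_left ?_ zero_le_two) hr.le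
  rw [abs_le]
  constructor <;> linarith

/-- Self-similarity of the limit set: a common prefix of `n` edges scales the difference of the
tails by `ρ^n`. The hypothesis on sources only matters for `n = 0`, where it equates the root terms.
-/
theorem limitEigval_sub (h1 : P.ratio d s < 1) (x y : D.InfPath) (n : ℕ)
    (h : ∀ i < n, y.1 i = x.1 i) (h0 : D.src (y.1 0) = D.src (x.1 0)) :
    P.limitEigval d s y - P.limitEigval d s x = 2 * P.ratio d s ^ n *
      ((P.seqGain d s fun i => y.1 (n + i)) - P.seqGain d s fun i => x.1 (n + i)) := by
  have h2 : P.coef d s y 0 = P.coef d s x 0 := P.coef_eq_of_mem d s trivial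
  rw [limitEigval, limitEigval, seqGain_eq_add h1 x.1 n, seqGain_eq_add h1 y.1 n, h0, h2,
    Finset.sum_congr rfl fun i hi => by rw [h i (Finset.mem_range.1 hi)]]
  ring

theorem abs_limitEigval_sub_le (h1 : P.ratio d s < 1) {x y : D.InfPath} {n : ℕ}
    (h : y ∈ D.cylinder x (n + 1)) : |P.limitEigval d s y - P.limitEigval d s x| ≤
      2 * (P.maxGain d s / (1 - P.ratio d s)) * P.ratio d s ^ n := by
  have hr := pow_pos (P.ratio_pos d s) n
  rw [limitEigval_sub h1 x y n h.2 h.1, abs_mul, abs_of_pos (by positivity), mul_right_comm]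
  refine mul_le_mul_of_nonneg_right (mul_le_mul_of_nonneg_left ?_ zero_le_two) hr.le
  have h2 := seqGain_le h1 fun i => x.1 (n + i)
  have h3 := seqGain_le h1 fun i => y.1 (n + i)
  have h4 := seqGain_nonneg (P := P) (d := d) (s := s) fun i => x.1 (n + i)
  have h5 := seqGain_nonneg (P := P) (d := d) (s := s) fun i => y.1 (n + i)
  rw [abs_le]
  constructor <;> linarith

theorem limitEigval_splice_sub (h1 : P.ratio d s < 1) (x : D.InfPath) (n : ℕ) (z z' : D.InfPath)
    (hz : D.src (z.1 0) = D.src (x.1 n)) (hz' : D.src (z'.1 0) = D.src (x.1 n)) :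
    P.limitEigval d s (splice x n z hz) - P.limitEigval d s (splice x n z' hz') =
      2 * P.ratio d s ^ n * (P.seqGain d s z.1 - P.seqGain d s z'.1) := by
  rw [limitEigval_sub h1 (splice x n z' hz') (splice x n z hz) n
    (fun i hi => by rw [splice_of_lt _ _ _ _ hi, splice_of_lt _ _ _ _ hi])
    ((splice_mem_cylinder x n z hz).1.trans (splice_mem_cylinder x n z' hz').1.symm)]
  simp only [splice_add]

/-- The paths form a closed subset of the compact product of copies of the discrete finite set `E`,
and the series converges uniformly on it. -/
theorem isCompact_range_limitEigval (h1 : P.ratio d s < 1) :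
    IsCompact (Set.range (P.limitEigval d s : D.InfPath → ℝ)) := by
  rcases isEmpty_or_nonempty D.InfPath with _ | ⟨⟨x₀⟩⟩
  · rw [Set.range_eq_empty]; exact isCompact_empty
  let _ : TopologicalSpace E := ⊥
  have : DiscreteTopology E := ⟨rfl⟩
  have hK : IsClosed {u : ℕ → E | ∀ n, D.tgt (u n) = D.src (u (n + 1))} := by
    rw [Set.ofPred_forall]
    refine isClosed_iInter fun n => ?_
    have hc : Continuous fun u : ℕ → E => (u n, u (n + 1)) := by fun_prop
    exact (isClosed_discrete {p : E × E | D.tgt p.1 = D.src p.2}).preimage hc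
  have hev : ∀ (g : E → ℝ) (k : ℕ), Continuous fun u : ℕ → E => g (u k) := fun g k =>
    continuous_of_discreteTopology.comp (continuous_apply k)
  have hF : Continuous fun u : ℕ → E =>
      2 * (P.coef d s x₀ 0 * (1 - P.vec (D.src (u 0))) + P.seqGain d s u) := by
    refine continuous_const.mul ((continuous_const.mul (continuous_const.sub
      (hev (fun e => P.vec (D.src e)) 0))).add ?_)
    exact continuous_tsum (fun k => continuous_const.mul (hev (P.gain d s) k)) (summable_bound h1)
      fun k u => P.abs_gain_le d s u k
  convert hK.isCompact.image hF using 1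
  ext l
  constructor
  · rintro ⟨x, rfl⟩
    exact ⟨x.1, x.2, by rw [limitEigval, P.coef_eq_of_mem d s (x := x₀) (y := x) (n := 0) trivial]⟩
  · rintro ⟨u, hu, rfl⟩
    refine ⟨⟨u, hu⟩, ?_⟩
    change 2 * (P.coef d s ⟨u, hu⟩ 0 * _ + _) = _
    rw [P.coef_eq_of_mem d s (x := x₀) (y := ⟨u, hu⟩) (n := 0) trivial]

/-- Masses along a path are at most `Λ^(-n)` and cannot become constant. So every path branches at
arbitrarily deep prefixes, which are the ones carrying nonzero Haar functions. -/
theorem exists_mass_ne (hΛ : 1 < P.eigenvalue) (x : D.InfPath) (N : ℕ) :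
    ∃ n, N ≤ n ∧ P.mass x (n + 2) ≠ P.mass x (n + 1) := by
  by_contra h
  push Not at h
  have hconst : ∀ n, N ≤ n → P.mass x (n + 1) = P.mass x (N + 1) := fun n hn => by
    induction n, hn using Nat.le_induction with
    | base => rfl
    | succ n hn ih => rw [h n hn, ih]
  have hle : ∀ n, P.mass x (n + 1) ≤ (P.eigenvalue⁻¹) ^ n := fun n => by
    rw [mass_succ, inv_pow, div_eq_mul_inv]
    refine mul_le_of_le_one_left (by have := P.eigenvalue_pos; positivity) ?_
    rw [← P.sum_vec]
    exact Finset.single_le_sum (fun v _ => (P.vec_pos v).le) (Finset.mem_univ _)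
  obtain ⟨n, hn⟩ := exists_pow_lt_of_lt_one (P.mass_pos x (N + 1)) (inv_lt_one_of_one_lt₀ hΛ)
  have h1 := hconst (max N n) (le_max_left _ _)
  have h2 := hle (max N n)
  have h3 : (P.eigenvalue⁻¹) ^ (max N n) ≤ (P.eigenvalue⁻¹) ^ n :=
    pow_le_pow_of_le_one (inv_nonneg.2 P.eigenvalue_pos.le) (inv_lt_one_of_one_lt₀ hΛ).le
      (le_max_right _ _)
  linarith

/-- Tail eigenvalues sit at deep prefixes, hence uniformly close to limit values, and the set of
limit values is closed. Conversely, each limit value is approached along its path through branching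
prefixes. -/
theorem omegaSpectrum_eq_range (hΛ : 1 < P.eigenvalue) (hs : 2 < massExp d s) :
    P.omegaSpectrum d s = Set.range (P.limitEigval d s) := by
  have h1 := P.ratio_lt_one hΛ d s hs
  obtain ⟨C, hC⟩ := exists_abs_eigval_sub_le (P := P) h1
  have hsmall : ∀ ε > 0, ∃ N, ∀ n, N ≤ n → ∀ x : D.InfPath,
      |P.eigval d s x (n + 1) - P.limitEigval d s x| < ε := by
    intro ε hε
    obtain ⟨N, hN⟩ := exists_pow_lt_of_lt_one (show 0 < ε / (|C| + 1) by positivity) h1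
    refine ⟨N, fun n hn x => (hC x n).trans_lt ?_⟩
    have h2 : P.ratio d s ^ n ≤ P.ratio d s ^ N := pow_le_pow_of_le_one (P.ratio_pos d s).le h1.le hn
    have h3 := pow_pos (P.ratio_pos d s) n
    rw [lt_div_iff₀ (by positivity)] at hN
    have h4 := mul_le_mul_of_nonneg_right (le_abs_self C) h3.le
    have h5 := mul_le_mul_of_nonneg_left h2 (abs_nonneg C)
    linarith
  refine Set.Subset.antisymm (fun l hl => ?_) ?_
  · rw [← (isCompact_range_limitEigval h1).isClosed.closure_eq, Metric.mem_closure_iff]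
    intro ε hε
    obtain ⟨N, hN⟩ := hsmall (ε / 2) (by linarith)
    obtain ⟨l', hl', hd⟩ := Metric.mem_closure_iff.1 (Set.mem_iInter.1 hl (N + 1)) (ε / 2)
      (by linarith)
    obtain ⟨z, m, hm, rfl⟩ := P.exists_eigval_eq hΛ.le d s hs.le hl'
    obtain ⟨m, rfl⟩ := Nat.exists_eq_add_of_le' (show 1 ≤ m by omega)
    refine ⟨_, ⟨z, rfl⟩, (dist_triangle _ (P.eigval d s z (m + 1)) _).trans_lt ?_⟩
    have := hN m (by omega) z
    rw [← Real.dist_eq] at this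
    linarith
  · rintro _ ⟨x, rfl⟩
    refine Set.mem_iInter.2 fun m => Metric.mem_closure_iff.2 fun ε hε => ?_
    obtain ⟨N, hN⟩ := hsmall ε hε
    obtain ⟨n, hn, hne⟩ := exists_mass_ne (P := P) hΛ x (max N m)
    refine ⟨_, P.eigval_mem_tailEigenvalues hΛ.le d s hs.le x (n := n + 1) (m := m) (by omega) hne,
      ?_⟩
    rw [dist_comm, Real.dist_eq]
    exact hN n (by omega) x

end PerronData
end StationaryDiagram

/-! ### Uniform perfectness and smallness of chains in the limit set -/

/-- A bounded set of real numbers contains polynomially many separated points. -/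
theorem card_le_of_separated {m n : ℕ} (hn : 1 ≤ n) (F : Finset ℝ) (hF : ∀ x ∈ F, |x| ≤ 2 ^ m)
    (hsep : ∀ x ∈ F, ∀ y ∈ F, x ≠ y → (1 / 2 : ℝ) ^ n < dist x y) :
    F.card ≤ 2 ^ ((m + 3) * n) := by
  have hinj : Set.InjOn (fun x : ℝ => ⌊x * 2 ^ n⌋) F := by
    intro x hx y hy hxy
    by_contra hne
    have h1 := hsep x hx y hy hne
    have h2 := Int.abs_sub_lt_one_of_floor_eq_floor hxy
    rw [← sub_mul, abs_mul, abs_of_pos (show (0 : ℝ) < 2 ^ n by positivity), ← Real.dist_eq] at h2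
    have h3 : (1 / 2 : ℝ) ^ n * 2 ^ n = 1 := by rw [← mul_pow]; norm_num
    have h4 : (0 : ℝ) < 2 ^ n := by positivity
    nlinarith
  have hmem : ∀ x ∈ F, ⌊x * 2 ^ n⌋ ∈ Finset.Icc (-(2 ^ (m + n) : ℤ)) (2 ^ (m + n)) := by
    intro x hx
    have h := abs_le.1 (hF x hx)
    have h4 : (0 : ℝ) < 2 ^ n := by positivity
    rw [Finset.mem_Icc]
    constructor
    · rw [Int.le_floor]
      push_cast
      rw [pow_add]
      nlinarith
    · have h5 : ((⌊x * 2 ^ n⌋ : ℤ) : ℝ) ≤ ((2 ^ (m + n) : ℤ) : ℝ) := by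
        refine (Int.floor_le _).trans ?_
        push_cast
        rw [pow_add]
        nlinarith
      exact_mod_cast h5
  have h1 := Finset.card_le_card_of_injOn _ hmem hinj
  rw [Int.card_Icc] at h1
  have h2 : (2 ^ (m + n) + 1 - -(2 ^ (m + n)) : ℤ).toNat ≤ 2 ^ (m + n + 2) := by
    rw [Int.toNat_le]
    push_cast
    rw [pow_add _ (m + n) 2]
    have : (1 : ℤ) ≤ 2 ^ (m + n) := one_le_pow₀ (by norm_num)
    linarith
  exact (h1.trans h2).trans (Nat.pow_le_pow_right (by norm_num) (by nlinarith))

/-- A chain of real numbers with small steps comes close to every number between its ends. -/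
theorem exists_near_of_chain {Y : Set ℝ} {ε : ℝ} (hε : 0 ≤ ε) {x y : Y}
    (h : Relation.ReflTransGen (fun u v : Y => dist u v ≤ ε) x y) :
    ∀ t ∈ Set.uIcc (x : ℝ) y, ∃ u ∈ Y, |t - u| ≤ ε := by
  induction h with
  | refl =>
    intro t ht
    rw [Set.uIcc_self, Set.mem_singleton_iff] at ht
    exact ⟨x, x.2, by rw [ht, sub_self, abs_zero]; exact hε⟩
  | @tail y z _ hyz ih =>
    intro t ht
    rcases Set.uIcc_subset_uIcc_union_uIcc (b := (y : ℝ)) ht with ht | ht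
    · exact ih t ht
    · exact ⟨y, y.2, (Set.abs_sub_left_of_mem_uIcc ht).trans (by
        rw [abs_sub_comm]; exact hyz)⟩

namespace StationaryDiagram

set_option linter.unusedSectionVars false

variable {V E : Type*} {D : StationaryDiagram V E}

namespace PerronData

variable [Fintype V] [Fintype E] {P : D.PerronData} [DecidableEq V]
  [MeasurableSpace E] [DiscreteMeasurableSpace E] {d : ℕ} {s : ℝ}

variable (P) in
/-- There are at most `C Λ ^ n` cylinders of index `n + 1`. -/
theorem exists_cover : ∃ C, 0 < C ∧ ∀ n, 1 ≤ n → ∃ F : Finset D.InfPath,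
    (F.card : ℝ) ≤ C * P.eigenvalue ^ n ∧ ∀ x, ∃ z ∈ F, x ∈ D.cylinder z (n + 1) := by
  classical
  obtain ⟨ν₀, hν₀, hν⟩ : ∃ ν₀ > 0, ∀ v, ν₀ ≤ P.vec v := by
    rcases isEmpty_or_nonempty V with _ | _
    · exact ⟨1, one_pos, fun v => isEmptyElim v⟩
    · obtain ⟨v, hv⟩ := Finite.exists_min P.vec
      exact ⟨_, P.vec_pos v, hv⟩
  refine ⟨ν₀⁻¹, inv_pos.2 hν₀, fun n hn => ?_⟩
  let G : Finset (Fin n → E) := Finset.univ.filter fun u => (D.initialSet u).Nonempty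
  have hG : ∀ u : G, ∃ y, y ∈ D.initialSet u.1 := fun u => (Finset.mem_filter.1 u.2).2
  choose y hy using hG
  refine ⟨Finset.univ.image y, ?_, fun x => ?_⟩
  · have hmeas : ∀ u : G, MeasurableSet (D.initialSet u.1) := fun u => by
      rw [initialSet_eq_cylinder hn (hy u)]; exact measurableSet_cylinder _ _
    -- Disjoint cylinders, each of mass at least `ν₀ Λ^(-n)`, have total mass at most `1`; this
    -- bounds their number.
    have h1 : ∑ u : G, P.measure.real (D.initialSet u.1) ≤ 1 := by
      rw [← measureReal_biUnion_finset (fun u _ u' _ hne => ?_) fun u _ => hmeas u]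
      · exact measureReal_le_one
      · rw [Function.onFun, Set.disjoint_left]
        exact fun x hx hx' => hne (Subtype.ext (funext fun j => (hx j).symm.trans (hx' j)))
    have h2 : ∀ u : G, ν₀ / P.eigenvalue ^ n ≤ P.measure.real (D.initialSet u.1) := fun u => by
      rw [initialSet_eq_cylinder hn (hy u)]
      change _ ≤ P.mass (y u) (n + 1)
      rw [mass_succ]
      exact div_le_div_of_nonneg_right (hν _) (pow_pos P.eigenvalue_pos n).le
    have h3 := (Finset.card_nsmul_le_sum Finset.univ _ _ fun u _ => h2 u).trans h1
    have h4 : ((Finset.univ.image y).card : ℝ) ≤ (Finset.univ : Finset G).card :=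
      Nat.cast_le.2 Finset.card_image_le
    have hp := pow_pos P.eigenvalue_pos n
    rw [nsmul_eq_mul, mul_div_assoc', div_le_one hp] at h3
    refine h4.trans ?_
    rw [inv_mul_eq_div, le_div_iff₀ hν₀]
    exact h3
  · have hx : x ∈ D.initialSet fun j : Fin n => x.1 j := fun _ => rfl
    let u : G := ⟨fun j => x.1 j, Finset.mem_filter.2 ⟨Finset.mem_univ _, x, hx⟩⟩
    refine ⟨y u, Finset.mem_image_of_mem y (Finset.mem_univ u), ?_⟩
    rw [← initialSet_eq_cylinder hn (hy u)]
    exact hx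

/-- If the series depended only on the starting vertex, there would be finitely many limit values.
So some vertex has two continuations with different sums, and a connecting path from `v` transports
them to `v`, scaling the difference by a power of `ρ`. -/
theorem exists_seqGain_ne (h1 : P.ratio d s < 1)
    (hconn : ∀ v w, ∃ (x : D.InfPath) (n : ℕ), D.src (x.1 0) = v ∧ D.src (x.1 n) = w)
    (hinf : (Set.range (P.limitEigval d s)).Infinite) (v : V) :
    ∃ z z' : D.InfPath, D.src (z.1 0) = v ∧ D.src (z'.1 0) = v ∧
      P.seqGain d s z.1 ≠ P.seqGain d s z'.1 := by
  obtain ⟨z, z', hzz', hne⟩ : ∃ z z' : D.InfPath, D.src (z.1 0) = D.src (z'.1 0) ∧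
      P.seqGain d s z.1 ≠ P.seqGain d s z'.1 := by
    by_contra h
    push Not at h
    classical
    refine hinf ((Set.finite_range fun v : V => if hv : ∃ x : D.InfPath, D.src (x.1 0) = v then
      P.limitEigval d s hv.choose else 0).subset ?_)
    rintro _ ⟨x, rfl⟩
    have hv : ∃ y : D.InfPath, D.src (y.1 0) = D.src (x.1 0) := ⟨x, rfl⟩
    refine ⟨D.src (x.1 0), ?_⟩
    simp only [dif_pos hv]
    rw [limitEigval, limitEigval, hv.choose_spec, h _ _ hv.choose_spec,
      P.coef_eq_of_mem d s (x := x) (y := hv.choose) (n := 0) trivial]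
  obtain ⟨x, n, hx, hxn⟩ := hconn v (D.src (z.1 0))
  refine ⟨splice x n z hxn.symm, splice x n z' (hzz'.symm.trans hxn.symm),
    (splice_mem_cylinder x n z _).1.trans hx, (splice_mem_cylinder x n z' _).1.trans hx, fun h => ?_⟩
  have h2 := limitEigval_splice_sub h1 x n z z' hxn.symm (hzz'.symm.trans hxn.symm)
  rw [limitEigval, limitEigval, h, (splice_mem_cylinder x n z _).1,
    (splice_mem_cylinder x n z' _).1, P.coef_eq_of_mem d s (x := splice x n z' (hzz'.symm.trans hxn.symm))
    (y := splice x n z hxn.symm) (n := 0) trivial, sub_self] at h2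
  have hr := pow_pos (P.ratio_pos d s) n
  exact hne (sub_eq_zero.1 ((mul_eq_zero.1 h2.symm).resolve_left (by positivity)))

/-- Replacing a deep tail of a path by two continuations with distinct sums gives two nearby values
that are apart at a comparable scale; at least one of them is not too close to the given value. -/
theorem uniformlyPerfect_range (h1 : P.ratio d s < 1)
    (hconn : ∀ v w, ∃ (x : D.InfPath) (n : ℕ), D.src (x.1 0) = v ∧ D.src (x.1 n) = w)
    (hinf : (Set.range (P.limitEigval d s)).Infinite) :
    ∃ p : ℕ, ∀ x : Set.range (P.limitEigval d s), ∀ r : ℝ, 0 < r → r ≤ 1 →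
      ∃ y, (1 / 2) ^ p * r ≤ dist x y ∧ dist x y ≤ r := by
  choose z z' hz hz' hne using exists_seqGain_ne h1 hconn hinf
  obtain ⟨δ, hδ, hδz⟩ : ∃ δ > 0, ∀ v, δ ≤ |P.seqGain d s (z v).1 - P.seqGain d s (z' v).1| := by
    rcases isEmpty_or_nonempty V with _ | _
    · exact ⟨1, one_pos, fun v => isEmptyElim v⟩
    · obtain ⟨v, hv⟩ := Finite.exists_min fun v => |P.seqGain d s (z v).1 - P.seqGain d s (z' v).1|
      exact ⟨_, abs_pos.2 (sub_ne_zero.2 (hne v)), hv⟩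
  set ρ := P.ratio d s with hρ
  have hρ0 : 0 < ρ := P.ratio_pos d s
  set B := 2 * (P.maxGain d s / (1 - ρ)) + 1 with hB
  have hB1 : 1 ≤ B := by
    have : 0 ≤ P.maxGain d s / (1 - ρ) := div_nonneg (P.maxGain_nonneg d s) (by linarith)
    linarith
  -- With `n` chosen so that `ρ^(n+1) < r/B ≤ ρ^n`, this `p` makes `2^(-p) r` at most `δ ρ^(n+1)`,
  -- half of the gap between the two spliced values.
  obtain ⟨p, hp⟩ := exists_pow_lt_of_lt_one (show 0 < δ * ρ / B by positivity)
    (show (1 / 2 : ℝ) < 1 by norm_num)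
  refine ⟨p, ?_⟩
  rintro ⟨_, x, rfl⟩ r hr hr1
  obtain ⟨n, hn1, hn2⟩ := exists_nat_pow_near_of_lt_one (show 0 < r / B by positivity)
    ((div_le_one (by linarith)).2 (hr1.trans hB1)) hρ0 h1
  rw [lt_div_iff₀ (by linarith)] at hn1
  rw [div_le_iff₀ (by linarith)] at hn2
  have hpos := pow_pos hρ0 (n + 1)
  have hnear : ∀ w h, |P.limitEigval d s (splice x (n + 1) w h) - P.limitEigval d s x| ≤ r :=
    fun w h => by
      refine (abs_limitEigval_sub_le h1 (splice_mem_cylinder x (n + 1) w h)).trans ?_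
      nlinarith
  set v := D.src (x.1 (n + 1))
  have hfar := limitEigval_splice_sub h1 x (n + 1) (z v) (z' v) (hz v) (hz' v)
  have hfar' : 2 * (δ * ρ ^ (n + 1)) ≤ |P.limitEigval d s (splice x (n + 1) (z v) (hz v)) -
      P.limitEigval d s (splice x (n + 1) (z' v) (hz' v))| := by
    rw [hfar, abs_mul, abs_of_pos (by positivity)]
    have := mul_le_mul_of_nonneg_left (hδz v) hpos.le
    linarith
  have hlow : (1 / 2) ^ p * r ≤ δ * ρ ^ (n + 1) := by
    rw [lt_div_iff₀ (by linarith)] at hp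
    have hhalf : (0 : ℝ) < (1 / 2) ^ p := by positivity
    calc (1 / 2) ^ p * r ≤ (1 / 2) ^ p * (ρ ^ n * B) := by gcongr
      _ = ((1 / 2) ^ p * B) * ρ ^ n := by ring
      _ ≤ (δ * ρ) * ρ ^ n := by gcongr
      _ = δ * ρ ^ (n + 1) := by ring
  have hdist : ∀ w h, dist (⟨_, x, rfl⟩ : Set.range (P.limitEigval d s))
      ⟨_, splice x (n + 1) w h, rfl⟩ =
      |P.limitEigval d s (splice x (n + 1) w h) - P.limitEigval d s x| := fun w h => by
    rw [Subtype.dist_eq, dist_comm, Real.dist_eq]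
  rcases le_or_gt (δ * ρ ^ (n + 1))
    |P.limitEigval d s (splice x (n + 1) (z v) (hz v)) - P.limitEigval d s x| with hc | hc
  · exact ⟨⟨_, splice x (n + 1) (z v) (hz v), rfl⟩, by rw [hdist]; exact hlow.trans hc,
      by rw [hdist]; exact hnear _ _⟩
  · refine ⟨⟨_, splice x (n + 1) (z' v) (hz' v), rfl⟩, ?_, by rw [hdist]; exact hnear _ _⟩
    rw [hdist]
    have h3 := abs_sub_le (P.limitEigval d s (splice x (n + 1) (z v) (hz v)))
      (P.limitEigval d s x) (P.limitEigval d s (splice x (n + 1) (z' v) (hz' v)))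
    rw [abs_sub_comm (P.limitEigval d s x)] at h3
    linarith

/-- Two points of the limit set that are joined by a chain with small steps are close. -/
theorem exists_dist_le_of_chain (h1 : P.ratio d s < 1) : ∃ C, 0 < C ∧
    ∀ (n : ℕ) (ε : ℝ), 0 ≤ ε → ε ≤ P.ratio d s ^ n → ∀ x y : Set.range (P.limitEigval d s),
      Relation.ReflTransGen (fun u v : Set.range (P.limitEigval d s) => dist u v ≤ ε) x y →
        dist x y ≤ C * (P.eigenvalue * P.ratio d s) ^ n := by
  obtain ⟨C, hC, hcover⟩ := P.exists_cover
  obtain ⟨B, hB⟩ := (isCompact_range_limitEigval (P := P) h1).isBounded.exists_norm_le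
  set ρ := P.ratio d s with hρ
  have hρ0 : 0 < ρ := P.ratio_pos d s
  set K := 2 * (P.maxGain d s / (1 - ρ)) + 1 with hK
  have hK1 : 1 ≤ K := by
    have : 0 ≤ P.maxGain d s / (1 - ρ) := div_nonneg (P.maxGain_nonneg d s) (by linarith)
    linarith
  -- The term `2 |B|` serves `n = 0`, where the cover is not available; the `+ 1` in `K` absorbs the
  -- step `ε ≤ ρ^n` of the chain.
  refine ⟨2 * |B| + C * (2 * K) + 1, by positivity, fun n ε hε hεn x y hxy => ?_⟩
  have hCK : 0 ≤ C * (2 * K) := by positivity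
  rcases Nat.eq_zero_or_pos n with rfl | hn
  · have h2 := hB x x.2
    have h3 := hB y y.2
    have h4 := dist_le_norm_add_norm (x : ℝ) y
    have h5 := le_abs_self B
    rw [Subtype.dist_eq, pow_zero, mul_one]
    linarith
  obtain ⟨F, hF, hFc⟩ := hcover n hn
  -- The interval spanned by the chain lies within `ε` of the limit set, hence in the union of `C
  -- Λ^n` balls of radius `K ρ^n`. Lebesgue measure then bounds its length.
  have hsub : Set.uIcc (x : ℝ) y ⊆ ⋃ z ∈ F, Metric.closedBall (P.limitEigval d s z) (K * ρ ^ n) := by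
    intro t ht
    obtain ⟨_, ⟨w, rfl⟩, hw⟩ := exists_near_of_chain hε hxy t ht
    obtain ⟨z, hz, hwz⟩ := hFc w
    refine Set.mem_biUnion hz ?_
    have h2 := abs_limitEigval_sub_le h1 hwz
    have h3 := abs_sub_le t (P.limitEigval d s w) (P.limitEigval d s z)
    rw [Metric.mem_closedBall, Real.dist_eq]
    rw [hK, add_mul, one_mul]
    linarith
  have hvol := (measure_mono hsub).trans (measure_biUnion_finset_le (μ := volume) F _)
  rw [Real.volume_interval] at hvol
  simp only [Real.volume_closedBall, Finset.sum_const, nsmul_eq_mul] at hvol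
  rw [← ENNReal.ofReal_natCast, ← ENNReal.ofReal_mul (Nat.cast_nonneg _),
    ENNReal.ofReal_le_ofReal_iff (by positivity)] at hvol
  rw [Subtype.dist_eq, dist_comm, Real.dist_eq]
  have hpow : 0 < (P.eigenvalue * ρ) ^ n := pow_pos (mul_pos P.eigenvalue_pos hρ0) n
  calc |(y : ℝ) - x| ≤ F.card * (2 * (K * ρ ^ n)) := hvol
    _ ≤ (C * P.eigenvalue ^ n) * (2 * (K * ρ ^ n)) := by gcongr
    _ = C * (2 * K) * (P.eigenvalue * ρ) ^ n := by rw [mul_pow]; ring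
    _ ≤ _ := by
      refine mul_le_mul_of_nonneg_right ?_ hpow.le
      have := abs_nonneg B
      linarith

/-- The chain bound `C (Λ ρ)^n` at step `ρ^n` becomes a power law in the step size because `Λ ρ <
1`. -/
theorem isHolderCantor_range (hΛ : 1 < P.eigenvalue) (hs : 2 < massExp d s)
    (hconn : ∀ v w, ∃ (x : D.InfPath) (n : ℕ), D.src (x.1 0) = v ∧ D.src (x.1 n) = w)
    (hinf : (Set.range (P.limitEigval d s)).Infinite) :
    IsHolderCantor (Set.range (P.limitEigval d s)) := by
  classical
  have h1 := P.ratio_lt_one hΛ d s hs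
  have hcomp := isCompact_range_limitEigval (P := P) h1
  refine ⟨hcomp.isClosed.completeSpace_coe, hinf.nonempty.to_subtype,
    uniformlyPerfect_range h1 hconn hinf, ?_, ?_⟩
  · obtain ⟨B, hB⟩ := hcomp.isBounded.exists_norm_le
    obtain ⟨m, hm⟩ := pow_unbounded_of_one_lt B (one_lt_two : (1 : ℝ) < 2)
    refine ⟨m + 3, fun n hn F hF => ?_⟩
    rw [← Finset.card_map (Function.Embedding.subtype _)]
    refine card_le_of_separated hn _ ?_ ?_
    · intro x hx
      obtain ⟨a, -, rfl⟩ := Finset.mem_map.1 hx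
      exact (hB a a.2).trans hm.le
    · intro x hx y hy hne
      obtain ⟨a, ha, rfl⟩ := Finset.mem_map.1 hx
      obtain ⟨b, hb, rfl⟩ := Finset.mem_map.1 hy
      exact hF a ha b hb fun h => hne (by rw [h])
  · obtain ⟨C, hC, hchain⟩ := exists_dist_le_of_chain (P := P) h1
    obtain ⟨B, hB⟩ := hcomp.isBounded.exists_norm_le
    have hρ0 := P.ratio_pos d s
    have hθ0 : 0 < P.eigenvalue * P.ratio d s := mul_pos P.eigenvalue_pos hρ0
    -- From `(Λ ρ)^k < ρ`, the power `k + 1` of the chain bound is `O(ρ^N)`, where `ρ^(N+1) < 2^(-n)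
    -- ≤ ρ^N`. The division by `ρ` in the choice of `q` pays for the shift from `N` to `N + 1`.
    obtain ⟨k, hk⟩ := exists_pow_lt_of_lt_one hρ0 (P.eigenvalue_mul_ratio_lt_one hΛ d s hs)
    obtain ⟨q, hq⟩ := pow_unbounded_of_one_lt (max ((2 * |B|) ^ (k + 1)) (C ^ (k + 1) / P.ratio d s))
      (one_lt_two : (1 : ℝ) < 2)
    refine ⟨k + 1, q, by omega, fun x y => ?_, fun n hn x y hxy => ?_⟩
    · refine le_trans (pow_le_pow_left₀ dist_nonneg ?_ _) ((le_max_left _ _).trans hq.le)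
      have h2 := hB x x.2
      have h3 := hB y y.2
      have h4 := dist_le_norm_add_norm (x : ℝ) y
      have h5 := le_abs_self B
      rw [Subtype.dist_eq]
      linarith
    · obtain ⟨N, hN1, hN2⟩ := exists_nat_pow_near_of_lt_one (show (0 : ℝ) < (1 / 2) ^ n by positivity)
        (pow_le_one₀ (by norm_num) (by norm_num)) hρ0 h1
      have h2 := hchain N _ (by positivity) hN2 x y hxy
      have h3 : (P.eigenvalue * P.ratio d s) ^ (k + 1) ≤ P.ratio d s :=
        (pow_le_pow_of_le_one hθ0.le (P.eigenvalue_mul_ratio_lt_one hΛ d s hs).le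
          (Nat.le_succ k)).trans hk.le
      calc dist x y ^ (k + 1) ≤ (C * (P.eigenvalue * P.ratio d s) ^ N) ^ (k + 1) :=
            pow_le_pow_left₀ dist_nonneg h2 _
        _ = C ^ (k + 1) * ((P.eigenvalue * P.ratio d s) ^ (k + 1)) ^ N := by
            rw [mul_pow, ← pow_mul, ← pow_mul, mul_comm N]
        _ ≤ C ^ (k + 1) * P.ratio d s ^ N := by gcongr
        _ = C ^ (k + 1) / P.ratio d s * P.ratio d s ^ (N + 1) := by
            field_simp; rw [pow_succ]
        _ ≤ 2 ^ q * (1 / 2) ^ n := by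
            gcongr
            exact (le_max_right _ _).trans hq.le

/-- The `ω`-spectrum is bi-Hölder equivalent to a Cantor space. -/
theorem isHolderCantor_omegaSpectrum (hΛ : 1 < P.eigenvalue) (hs : 2 < massExp d s)
    (hconn : ∀ v w, ∃ (x : D.InfPath) (n : ℕ), D.src (x.1 0) = v ∧ D.src (x.1 n) = w)
    (hinf : (P.omegaSpectrum d s).Infinite) : IsHolderCantor (P.omegaSpectrum d s) := by
  rw [omegaSpectrum_eq_range hΛ hs] at hinf ⊢
  exact isHolderCantor_range hΛ hs hconn hinf

end PerronData
end StationaryDiagram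

/-! ### Substitution tilings -/

namespace TilingSubstitution

set_option linter.unusedSectionVars false

variable {d : ℕ} {V : Type*} (S : TilingSubstitution d V)

/-- A packing: a set of tiles with pairwise disjoint interiors. -/
def IsPacking (T : Set (LabelledTile d V)) : Prop :=
  T.Pairwise fun t t' => Disjoint (interior (S.tileSupp t)) (interior (S.tileSupp t'))

/-- The set covered by a set of tiles. -/
def cover (T : Set (LabelledTile d V)) : Set (EuclideanSpace ℝ (Fin d)) :=
  ⋃ t ∈ T, S.tileSupp t

/-- The iterated substitution of a prototile. -/
def superTile (n : ℕ) (i : V) : Set (LabelledTile d V) := S.inflate^[n] {(i, 0)}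

variable {S}

theorem mem_tileSupp {t : LabelledTile d V} {p : EuclideanSpace ℝ (Fin d)} :
    p ∈ S.tileSupp t ↔ p - t.2 ∈ S.supp t.1 := by
  rw [tileSupp, Set.mem_vadd_set_iff_neg_vadd_mem, vadd_eq_add, neg_add_eq_sub]

theorem mem_interior_tileSupp {t : LabelledTile d V} {p : EuclideanSpace ℝ (Fin d)} :
    p ∈ interior (S.tileSupp t) ↔ p - t.2 ∈ interior (S.supp t.1) := by
  rw [tileSupp, interior_vadd, Set.mem_vadd_set_iff_neg_vadd_mem, vadd_eq_add, neg_add_eq_sub]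

theorem closure_interior_tileSupp (t : LabelledTile d V) :
    closure (interior (S.tileSupp t)) = S.tileSupp t := by
  rw [tileSupp, interior_vadd, closure_vadd, S.closure_interior_supp]

theorem puncture_mem_interior (t : LabelledTile d V) : t.2 ∈ interior (S.tileSupp t) := by
  rw [mem_interior_tileSupp, sub_self]
  exact S.zero_mem t.1

theorem puncture_mem (t : LabelledTile d V) : t.2 ∈ S.tileSupp t :=
  interior_subset (puncture_mem_interior t)

theorem expansion_pos : 0 < S.expansion := zero_lt_one.trans S.one_lt_expansion

theorem pow_expansion_pos (n : ℕ) : 0 < S.expansion ^ n := pow_pos S.expansion_pos n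

theorem mem_cover {T : Set (LabelledTile d V)} {p : EuclideanSpace ℝ (Fin d)} :
    p ∈ S.cover T ↔ ∃ t ∈ T, p ∈ S.tileSupp t := by
  simp only [cover, Set.mem_iUnion, exists_prop]

theorem cover_mono {T T' : Set (LabelledTile d V)} (h : T ⊆ T') : S.cover T ⊆ S.cover T' :=
  Set.biUnion_subset_biUnion_left h

theorem mem_translate {x : EuclideanSpace ℝ (Fin d)} {T : Set (LabelledTile d V)}
    {t : LabelledTile d V} : t ∈ translate x T ↔ (t.1, t.2 - x) ∈ T := by
  constructor
  · rintro ⟨u, hu, rfl⟩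
    simpa using hu
  · exact fun h => ⟨_, h, by simp⟩

theorem translate_mono {x : EuclideanSpace ℝ (Fin d)} {T T' : Set (LabelledTile d V)}
    (h : T ⊆ T') : translate x T ⊆ translate x T' :=
  Set.image_mono h

theorem translate_translate (x y : EuclideanSpace ℝ (Fin d)) (T : Set (LabelledTile d V)) :
    translate x (translate y T) = translate (y + x) T := by
  ext t
  simp only [mem_translate, sub_sub, add_comm]

theorem translate_zero (T : Set (LabelledTile d V)) :
    translate (0 : EuclideanSpace ℝ (Fin d)) T = T := by
  ext t
  simp [mem_translate]

theorem translate_singleton (x : EuclideanSpace ℝ (Fin d)) (i : V) :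
    translate x {((i, 0) : LabelledTile d V)} = {(i, x)} := by
  simp [translate]

theorem mem_tileSupp_translate {t : LabelledTile d V} {x p : EuclideanSpace ℝ (Fin d)} :
    p ∈ S.tileSupp (t.1, t.2 - x) ↔ p + x ∈ S.tileSupp t := by
  simp only [mem_tileSupp, sub_sub_eq_add_sub]

theorem mem_cover_translate {T : Set (LabelledTile d V)} {x p : EuclideanSpace ℝ (Fin d)} :
    p ∈ S.cover (translate x T) ↔ p - x ∈ S.cover T := by
  rw [mem_cover, mem_cover]
  constructor
  · rintro ⟨t, ht, hp⟩
    refine ⟨_, mem_translate.1 ht, ?_⟩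
    rwa [mem_tileSupp_translate, sub_add_cancel]
  · rintro ⟨t, ht, hp⟩
    refine ⟨(t.1, t.2 + x), mem_translate.2 (by simpa using ht), ?_⟩
    rw [mem_tileSupp] at hp ⊢
    rwa [sub_sub, add_comm x] at hp

/-! #### The action of the substitution -/

theorem mem_inflate {T : Set (LabelledTile d V)} {u : LabelledTile d V} :
    u ∈ S.inflate T ↔ ∃ t ∈ T, ∃ w ∈ S.rule t.1, u = (w.1, S.expansion • t.2 + w.2) := Iff.rfl

theorem inflate_mono {T T' : Set (LabelledTile d V)} (h : T ⊆ T') : S.inflate T ⊆ S.inflate T' := by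
  rintro u ⟨t, ht, hu⟩
  exact ⟨t, h ht, hu⟩

theorem iterate_inflate_mono (n : ℕ) {T T' : Set (LabelledTile d V)} (h : T ⊆ T') :
    S.inflate^[n] T ⊆ S.inflate^[n] T' := by
  induction n generalizing T T' with
  | zero => exact h
  | succ n ih => exact ih (inflate_mono h)

theorem mem_iterate_inflate {n : ℕ} {T : Set (LabelledTile d V)} {u : LabelledTile d V} :
    u ∈ S.inflate^[n] T ↔ ∃ t ∈ T, u ∈ S.inflate^[n] {t} := by
  induction n generalizing u with
  | zero => simp
  | succ n ih =>
    simp only [Function.iterate_succ_apply', mem_inflate]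
    constructor
    · rintro ⟨v, hv, hu⟩
      obtain ⟨t, ht, hvt⟩ := ih.1 hv
      exact ⟨t, ht, v, hvt, hu⟩
    · rintro ⟨t, ht, v, hvt, hu⟩
      exact ⟨v, ih.2 ⟨t, ht, hvt⟩, hu⟩

theorem inflate_translate (x : EuclideanSpace ℝ (Fin d)) (T : Set (LabelledTile d V)) :
    S.inflate (translate x T) = translate (S.expansion • x) (S.inflate T) := by
  ext u
  rw [mem_translate, mem_inflate, mem_inflate]
  constructor
  · rintro ⟨t, ht, w, hw, rfl⟩
    refine ⟨_, mem_translate.1 ht, w, hw, ?_⟩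
    simp only [smul_sub]
    congr 1
    abel
  · rintro ⟨t, ht, w, hw, hu⟩
    refine ⟨(t.1, t.2 + x), mem_translate.2 (by simpa using ht), w, hw, ?_⟩
    rw [Prod.ext_iff] at hu ⊢
    refine ⟨hu.1, ?_⟩
    have := eq_add_of_sub_eq hu.2
    rw [this]
    simp only [smul_add]
    abel

theorem iterate_inflate_translate (n : ℕ) (x : EuclideanSpace ℝ (Fin d))
    (T : Set (LabelledTile d V)) :
    S.inflate^[n] (translate x T) = translate (S.expansion ^ n • x) (S.inflate^[n] T) := by
  induction n with
  | zero => simp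
  | succ n ih =>
    rw [Function.iterate_succ_apply', ih, inflate_translate, Function.iterate_succ_apply', smul_smul,
      pow_succ']

theorem iterate_inflate_singleton (n : ℕ) (t : LabelledTile d V) :
    S.inflate^[n] {t} = translate (S.expansion ^ n • t.2) (S.superTile n t.1) := by
  rw [superTile, ← iterate_inflate_translate, translate_singleton]

theorem iterate_inflate_superTile (m n : ℕ) (i : V) :
    S.inflate^[m] (S.superTile n i) = S.superTile (m + n) i :=
  (Function.iterate_add_apply _ _ _ _).symm

theorem mem_cover_rule {i : V} {p : EuclideanSpace ℝ (Fin d)} :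
    (∃ w ∈ S.rule i, p ∈ S.tileSupp w) ↔ S.expansion⁻¹ • p ∈ S.supp i := by
  rw [← Set.mem_smul_set_iff_inv_smul_mem₀ S.expansion_pos.ne', ← S.iUnion_rule]
  simp only [Set.mem_iUnion, exists_prop]
  rfl

theorem cover_inflate (T : Set (LabelledTile d V)) :
    S.cover (S.inflate T) = S.expansion • S.cover T := by
  ext p
  rw [Set.mem_smul_set_iff_inv_smul_mem₀ S.expansion_pos.ne', mem_cover, mem_cover]
  have key : ∀ t : LabelledTile d V, S.expansion⁻¹ • p ∈ S.tileSupp t ↔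
      ∃ w ∈ S.rule t.1, p ∈ S.tileSupp (w.1, S.expansion • t.2 + w.2) := by
    intro t
    have h : S.expansion⁻¹ • p - t.2 = S.expansion⁻¹ • (p - S.expansion • t.2) := by
      rw [smul_sub, smul_smul, inv_mul_cancel₀ S.expansion_pos.ne', one_smul]
    rw [mem_tileSupp, h, ← mem_cover_rule]
    simp only [mem_tileSupp, sub_sub]
  constructor
  · rintro ⟨u, ⟨t, ht, w, hw, rfl⟩, hp⟩
    exact ⟨t, ht, (key t).2 ⟨w, hw, hp⟩⟩
  · rintro ⟨t, ht, hp⟩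
    obtain ⟨w, hw, hp⟩ := (key t).1 hp
    exact ⟨_, ⟨t, ht, w, hw, rfl⟩, hp⟩

theorem cover_iterate_inflate (n : ℕ) (T : Set (LabelledTile d V)) :
    S.cover (S.inflate^[n] T) = S.expansion ^ n • S.cover T := by
  induction n with
  | zero => simp
  | succ n ih => rw [Function.iterate_succ_apply', cover_inflate, ih, smul_smul, pow_succ']

theorem cover_singleton (t : LabelledTile d V) : S.cover {t} = S.tileSupp t := by
  simp [cover]

theorem tileSupp_subset_cover {T : Set (LabelledTile d V)} {t : LabelledTile d V} (h : t ∈ T) :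
    S.tileSupp t ⊆ S.cover T := fun _ hp => mem_cover.2 ⟨t, h, hp⟩

theorem cover_superTile (n : ℕ) (i : V) :
    S.cover (S.superTile n i) = S.expansion ^ n • S.supp i := by
  rw [superTile, cover_iterate_inflate, cover_singleton, tileSupp, zero_vadd]

theorem isPacking_inflate {T : Set (LabelledTile d V)} (hT : S.IsPacking T) :
    S.IsPacking (S.inflate T) := by
  rintro _ ⟨t, ht, w, hw, rfl⟩ _ ⟨t', ht', w', hw', rfl⟩ hne
  rw [Set.disjoint_left]
  intro p hp hp'
  by_cases h : t = t'
  · subst h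
    have hww' : w ≠ w' := fun h => hne (by rw [h])
    have hdis : Disjoint (interior (S.tileSupp w)) (interior (S.tileSupp w')) :=
      S.disjoint_rule t.1 hw hw' hww'
    have key : ∀ w : LabelledTile d V, p ∈ interior (S.tileSupp (w.1, S.expansion • t.2 + w.2)) →
        p - S.expansion • t.2 ∈ interior (S.tileSupp w) := by
      intro w hp
      rw [mem_interior_tileSupp] at hp ⊢
      rwa [sub_sub]
    exact Set.disjoint_left.1 hdis (key w hp) (key w' hp')
  · have key : ∀ (t w : LabelledTile d V), w ∈ S.rule t.1 →
        p ∈ interior (S.tileSupp (w.1, S.expansion • t.2 + w.2)) →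
        S.expansion⁻¹ • p ∈ interior (S.tileSupp t) := by
      intro t w hw hp
      rw [← Set.mem_smul_set_iff_inv_smul_mem₀ S.expansion_pos.ne',
        ← interior_smul₀ S.expansion_pos.ne', ← cover_singleton, ← cover_inflate]
      have hmem : (w.1, S.expansion • t.2 + w.2) ∈ S.inflate {t} := ⟨t, rfl, w, hw, rfl⟩
      exact interior_mono (tileSupp_subset_cover hmem) hp
    have hdis : Disjoint (interior (S.tileSupp t)) (interior (S.tileSupp t')) := hT ht ht' h
    exact Set.disjoint_left.1 hdis (key t w hw hp) (key t' w' hw' hp')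

theorem isPacking_iterate_inflate (n : ℕ) {T : Set (LabelledTile d V)} (hT : S.IsPacking T) :
    S.IsPacking (S.inflate^[n] T) := by
  induction n generalizing T with
  | zero => exact hT
  | succ n ih => exact ih (isPacking_inflate hT)

theorem isPacking_superTile (n : ℕ) (i : V) : S.IsPacking (S.superTile n i) :=
  isPacking_iterate_inflate n (Set.pairwise_singleton _ _)

theorem isPacking_translate {T : Set (LabelledTile d V)} (x : EuclideanSpace ℝ (Fin d))
    (hT : S.IsPacking T) : S.IsPacking (translate x T) := by
  intro t ht t' ht' hne
  rw [mem_translate] at ht ht'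
  have h : Disjoint (interior (S.tileSupp (t.1, t.2 - x)))
      (interior (S.tileSupp (t'.1, t'.2 - x))) := hT ht ht' fun h => hne (by
    rw [Prod.ext_iff] at h ⊢
    exact ⟨h.1, sub_left_injective h.2⟩)
  rw [Set.disjoint_left] at h ⊢
  intro p hp hp'
  have key : ∀ t : LabelledTile d V, p ∈ interior (S.tileSupp t) →
      p - x ∈ interior (S.tileSupp (t.1, t.2 - x)) := by
    intro t hp
    rw [mem_interior_tileSupp] at hp ⊢
    simpa using hp
  exact h (key t hp) (key t' hp')

/-- In a packing, a tile that meets the interior of another tile is equal to it. -/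
theorem IsPacking.eq_of_mem {T : Set (LabelledTile d V)} (hT : S.IsPacking T)
    {t t' : LabelledTile d V} (ht : t ∈ T) (ht' : t' ∈ T) {p : EuclideanSpace ℝ (Fin d)}
    (hp : p ∈ interior (S.tileSupp t)) (hp' : p ∈ S.tileSupp t') : t = t' := by
  by_contra hne
  rw [← closure_interior_tileSupp t', mem_closure_iff] at hp'
  obtain ⟨q, hq, hq'⟩ := hp' _ isOpen_interior hp
  have hdis : Disjoint (interior (S.tileSupp t)) (interior (S.tileSupp t')) := hT ht ht' hne
  exact Set.disjoint_left.1 hdis hq hq'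

/-- In a packing, a tile that meets an open set covered by some of the tiles is one of them. -/
theorem IsPacking.mem_of_inter {T p : Set (LabelledTile d V)} (hT : S.IsPacking T) (hp : p ⊆ T)
    {W : Set (EuclideanSpace ℝ (Fin d))} (hW : IsOpen W) (hWp : W ⊆ S.cover p)
    {t : LabelledTile d V} (ht : t ∈ T) (htW : (S.tileSupp t ∩ W).Nonempty) : t ∈ p := by
  obtain ⟨a, ha, haW⟩ := htW
  rw [← closure_interior_tileSupp t, mem_closure_iff] at ha
  obtain ⟨q, hq, hq'⟩ := ha W hW haW
  obtain ⟨t', ht', hqt'⟩ := mem_cover.1 (hWp hq)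
  rwa [hT.eq_of_mem ht (hp ht') hq' hqt']

theorem IsTiling.isPacking {T : Set (LabelledTile d V)} (hT : S.IsTiling T) : S.IsPacking T := hT.2

theorem IsTiling.cover_eq {T : Set (LabelledTile d V)} (hT : S.IsTiling T) :
    S.cover T = Set.univ := hT.1

theorem isTiling_translate {T : Set (LabelledTile d V)} (x : EuclideanSpace ℝ (Fin d))
    (hT : S.IsTiling T) : S.IsTiling (translate x T) := by
  refine ⟨Set.eq_univ_of_forall fun p => mem_cover_translate.2 ?_, isPacking_translate x hT.2⟩
  rw [hT.cover_eq]
  trivial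

theorem translate_mem_hull {T : Set (LabelledTile d V)} (x : EuclideanSpace ℝ (Fin d))
    (hT : T ∈ S.hull) : translate x T ∈ S.hull := by
  classical
  refine ⟨isTiling_translate x hT.1, fun p hp => ?_⟩
  obtain ⟨i, n, y, h⟩ := hT.2 (p.image fun t => (t.1, t.2 - x)) fun t ht => by
    rw [Finset.coe_image] at ht
    obtain ⟨u, hu, rfl⟩ := ht
    exact mem_translate.1 (hp hu)
  refine ⟨i, n, y + x, fun t ht => ?_⟩
  rw [← translate_translate, mem_translate]
  exact h (by
    rw [Finset.coe_image]
    exact ⟨t, ht, rfl⟩)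

/-- A tiling that contains another tiling is equal to it. -/
theorem IsTiling.eq_of_subset {T T' : Set (LabelledTile d V)} (hT : S.IsTiling T)
    (hT' : S.IsTiling T') (h : T ⊆ T') : T = T' :=
  h.antisymm fun t ht => hT'.isPacking.mem_of_inter h isOpen_univ (by rw [hT.cover_eq]) ht
    ⟨t.2, puncture_mem t, trivial⟩

variable (S) in
/-- All prototiles are contained in a ball. -/
theorem exists_radius [Finite V] : ∃ r : ℝ, 0 < r ∧ ∀ i, ∀ p ∈ S.supp i, ‖p‖ ≤ r := by
  have h : Bornology.IsBounded (⋃ i, S.supp i) :=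
    (Bornology.isBounded_iUnion).2 fun i => (S.isCompact_supp i).isBounded
  obtain ⟨r, hr⟩ := h.exists_norm_le
  refine ⟨max r 1, by positivity, fun i p hp => (hr p (Set.mem_iUnion.2 ⟨i, hp⟩)).trans
    (le_max_left _ _)⟩

variable (S) in
/-- All prototiles contain a ball. -/
theorem exists_inradius [Finite V] [Nonempty V] :
    ∃ r : ℝ, 0 < r ∧ ∀ i, Metric.ball 0 r ⊆ S.supp i := by
  have h : ∀ i, ∃ r : ℝ, 0 < r ∧ Metric.ball 0 r ⊆ S.supp i := fun i => by
    obtain ⟨r, hr, h⟩ := Metric.isOpen_iff.1 isOpen_interior _ (S.zero_mem i)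
    exact ⟨r, hr, h.trans interior_subset⟩
  choose r hr h using h
  obtain ⟨i, hi⟩ := Finite.exists_min r
  exact ⟨r i, hr i, fun j => (Metric.ball_subset_ball (hi j)).trans (h j)⟩

theorem rule_nonempty (i : V) : ∃ w, w ∈ S.rule i := by
  have h : S.expansion⁻¹ • (0 : EuclideanSpace ℝ (Fin d)) ∈ S.supp i := by
    rw [smul_zero]; exact interior_subset (S.zero_mem i)
  obtain ⟨w, hw, -⟩ := mem_cover_rule.2 h
  exact ⟨w, hw⟩

/-! #### Primitivity -/

theorem superTile_succ_of_mem {n : ℕ} {i : V} {w : LabelledTile d V} (hw : w ∈ S.rule i) :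
    translate (S.expansion ^ n • w.2) (S.superTile n w.1) ⊆ S.superTile (n + 1) i := by
  rw [← iterate_inflate_singleton, superTile, Function.iterate_succ_apply]
  exact iterate_inflate_mono n (Set.singleton_subset_iff.2 ⟨(i, 0), rfl, w, hw, by simp⟩)

theorem exists_mem_superTile_of_pow_pos [Fintype V] [DecidableEq V] {n : ℕ} {i j : V}
    (h : 0 < (S.abelMatrix ^ n) i j) : ∃ y, (j, y) ∈ S.superTile n i := by
  induction n generalizing i j with
  | zero =>
    rw [pow_zero, Matrix.one_apply] at h
    split_ifs at h with hij
    · subst hij; exact ⟨0, rfl⟩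
    · exact absurd h (lt_irrefl _)
  | succ n ih =>
    rw [pow_succ', Matrix.mul_apply] at h
    obtain ⟨l, -, hl⟩ := Finset.exists_ne_zero_of_sum_ne_zero h.ne'
    have hA : ∀ a b, 0 ≤ S.abelMatrix a b := fun a b => by
      simp only [abelMatrix, Matrix.of_apply]; positivity
    have hAn : 0 ≤ (S.abelMatrix ^ n) l j := by
      have : ∀ m a b, 0 ≤ (S.abelMatrix ^ m) a b := fun m => by
        induction m with
        | zero => intro a b; rw [pow_zero, Matrix.one_apply]; split_ifs <;> norm_num
        | succ m ihm =>
          intro a b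
          rw [pow_succ, Matrix.mul_apply]
          exact Finset.sum_nonneg fun c _ => mul_nonneg (ihm a c) (hA c b)
      exact this n l j
    obtain ⟨y, hy⟩ := ih (lt_of_le_of_ne hAn (right_ne_zero_of_mul hl).symm)
    have hil : Nat.card {t : S.rule i // t.1.1 = l} ≠ 0 := by
      have h1 := left_ne_zero_of_mul hl
      simp only [abelMatrix, Matrix.of_apply] at h1
      exact_mod_cast h1
    obtain ⟨⟨⟨w, hw⟩, rfl⟩⟩ := (Nat.card_ne_zero.1 hil).1
    exact ⟨y + S.expansion ^ n • w.2, superTile_succ_of_mem hw (mem_translate.2 (by simpa using hy))⟩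

/-- In a primitive substitution all labels occur in all supertiles of high order. -/
theorem exists_forall_mem_superTile [Fintype V] [DecidableEq V] (hprim : S.abelMatrix.IsPrimitive) :
    ∃ k, ∀ n, k ≤ n → ∀ i j, ∃ y, (j, y) ∈ S.superTile n i := by
  obtain ⟨k, -, hk⟩ := hprim.exists_pos_pow
  refine ⟨k, fun n hn => ?_⟩
  induction n, hn using Nat.le_induction with
  | base => exact fun i j => exists_mem_superTile_of_pow_pos (hk i j)
  | succ n hn ih =>
    intro i j
    obtain ⟨w, hw⟩ := S.rule_nonempty i
    obtain ⟨y, hy⟩ := ih w.1 j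
    exact ⟨y + S.expansion ^ n • w.2, superTile_succ_of_mem hw (mem_translate.2 (by simpa using hy))⟩

theorem translate_superTile_subset {m n : ℕ} {i j : V} {y : EuclideanSpace ℝ (Fin d)}
    (h : (j, y) ∈ S.superTile n i) :
    translate (S.expansion ^ m • y) (S.superTile m j) ⊆ S.superTile (m + n) i := by
  rw [← iterate_inflate_superTile, ← iterate_inflate_singleton m (j, y)]
  exact iterate_inflate_mono m (Set.singleton_subset_iff.2 h)

theorem tileSupp_subset_closedBall {r : ℝ} (hr : ∀ i, ∀ p ∈ S.supp i, ‖p‖ ≤ r)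
    {t : LabelledTile d V} {p : EuclideanSpace ℝ (Fin d)} (hp : p ∈ S.tileSupp t) :
    ‖p - t.2‖ ≤ r := hr _ _ (mem_tileSupp.1 hp)

/-! #### A self-similar tiling -/

/-- Some supertile contains a tile of its own type in its interior. -/
theorem exists_interior_tile [Fintype V] [DecidableEq V] [Nonempty V]
    (hprim : S.abelMatrix.IsPrimitive) :
    ∃ (i : V) (n : ℕ) (x : EuclideanSpace ℝ (Fin d)), 1 ≤ n ∧ (i, x) ∈ S.superTile n i ∧
      S.tileSupp (i, x) ⊆ interior (S.expansion ^ n • S.supp i) := by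
  obtain ⟨k, hk⟩ := exists_forall_mem_superTile hprim
  obtain ⟨r, hr0, hr⟩ := S.exists_radius
  obtain ⟨r', hr'0, hr'⟩ := S.exists_inradius
  -- For this `m` the inflated prototile contains the tile over the origin in its interior. A tile
  -- of type `i` is then found inside a supertile of that tile; using order `k + 1` ensures `n ≥ 1`.
  obtain ⟨m, hm⟩ := pow_unbounded_of_one_lt (2 * r / r') S.one_lt_expansion
  rw [div_lt_iff₀ hr'0] at hm
  let i : V := Classical.arbitrary V
  have h0 : (0 : EuclideanSpace ℝ (Fin d)) ∈ S.cover (S.superTile m i) := by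
    rw [cover_superTile, Set.mem_smul_set_iff_inv_smul_mem₀ (pow_expansion_pos m).ne', smul_zero]
    exact interior_subset (S.zero_mem i)
  obtain ⟨t, ht, h0t⟩ := mem_cover.1 h0
  obtain ⟨y, hy⟩ := hk (k + 1) (Nat.le_succ k) t.1 i
  refine ⟨i, k + 1 + m, y + S.expansion ^ (k + 1) • t.2, by omega,
    translate_superTile_subset ht (mem_translate.2 (by simpa using hy)), ?_⟩
  have hsub : S.tileSupp (i, y + S.expansion ^ (k + 1) • t.2) ⊆
      S.expansion ^ (k + 1) • S.tileSupp t := by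
    rw [← cover_singleton t, ← cover_iterate_inflate, iterate_inflate_singleton]
    exact tileSupp_subset_cover (mem_translate.2 (by simpa using hy))
  refine hsub.trans ?_
  rintro _ ⟨p, hp, rfl⟩
  have hpn : ‖p‖ < S.expansion ^ m * r' := by
    have h1 := tileSupp_subset_closedBall hr hp
    have h2 := tileSupp_subset_closedBall hr h0t
    have h3 : p = (p - t.2) - (0 - t.2) := by abel
    rw [h3]
    exact (norm_sub_le _ _).trans_lt (by linarith)
  rw [pow_add, ← smul_smul, interior_smul₀ (pow_expansion_pos (k + 1)).ne']
  refine Set.smul_mem_smul_set ?_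
  have hball : Metric.ball (0 : EuclideanSpace ℝ (Fin d)) (S.expansion ^ m * r') ⊆
      S.expansion ^ m • S.supp i := by
    intro q hq
    rw [Set.mem_smul_set_iff_inv_smul_mem₀ (pow_expansion_pos m).ne']
    apply hr' i
    rw [mem_ball_zero_iff] at hq ⊢
    rw [norm_smul, norm_inv, Real.norm_of_nonneg (pow_expansion_pos m).le,
      inv_mul_lt_iff₀ (pow_expansion_pos m)]
    exact hq
  exact interior_maximal hball Metric.isOpen_ball (mem_ball_zero_iff.2 hpn)

/-- A primitive substitution has a tiling that contains all supertiles. -/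
theorem exists_tiling [Fintype V] [DecidableEq V] [Nonempty V] (hprim : S.abelMatrix.IsPrimitive) :
    ∃ T ∈ S.hull, ∀ m i, ∃ x, translate x (S.superTile m i) ⊆ T := by
  obtain ⟨k, hk⟩ := exists_forall_mem_superTile hprim
  obtain ⟨i, n, x, hn, hx, hint⟩ := exists_interior_tile hprim
  set a := S.expansion ^ n with ha
  have ha1 : 1 < a := one_lt_pow₀ S.one_lt_expansion (by omega)
  have ha0 : 0 < a := zero_lt_one.trans ha1
  -- `x₀` is the fixed point of `q ↦ x + a q`. The tile `t₀` at `x₀` therefore belongs to its own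
  -- `n`-fold inflation, and the iterates increase.
  let x₀ : EuclideanSpace ℝ (Fin d) := -(a - 1)⁻¹ • x
  have hx₀ : x + a • x₀ = x₀ := by
    have h1 : (a - 1) • x₀ = -x := by
      simp only [x₀, neg_smul, smul_neg, smul_smul]
      rw [mul_inv_cancel₀ (by linarith), one_smul]
    rw [sub_smul, one_smul, sub_eq_iff_eq_add] at h1
    rw [h1]; abel
  let t₀ : LabelledTile d V := (i, x₀)
  have ht₀ : {t₀} ⊆ S.inflate^[n] {t₀} := by
    rw [iterate_inflate_singleton, Set.singleton_subset_iff, mem_translate]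
    have : x₀ - a • x₀ = x := by rw [sub_eq_iff_eq_add]; exact hx₀.symm
    change (i, x₀ - a • x₀) ∈ _
    rwa [this]
  let p : ℕ → Set (LabelledTile d V) := fun k => S.inflate^[n * k] {t₀}
  have hp_succ : ∀ k, p k ⊆ p (k + 1) := fun k => by
    simp only [p]
    rw [Nat.mul_succ, Function.iterate_add_apply]
    exact iterate_inflate_mono _ ht₀
  have hp_mono : Monotone p := monotone_nat_of_le_succ hp_succ
  have hKint : S.tileSupp t₀ ⊆ interior (a • S.tileSupp t₀) := by
    intro q hq
    have h1 : q - a • x₀ ∈ S.tileSupp (i, x) := by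
      rw [mem_tileSupp] at hq ⊢
      have h2 : q - a • x₀ - x = q - x₀ := by rw [sub_sub, add_comm (a • x₀), hx₀]
      change q - a • x₀ - x ∈ _
      rw [h2]
      exact hq
    have h2 := hint h1
    have h3 : a • S.tileSupp t₀ = a • x₀ +ᵥ a • S.supp i := by
      ext z
      rw [Set.mem_smul_set_iff_inv_smul_mem₀ ha0.ne', mem_tileSupp,
        Set.mem_vadd_set_iff_neg_vadd_mem, Set.mem_smul_set_iff_inv_smul_mem₀ ha0.ne', vadd_eq_add,
        smul_add, smul_neg, smul_smul, inv_mul_cancel₀ ha0.ne', one_smul, neg_add_eq_sub]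
    rw [h3, interior_vadd, Set.mem_vadd_set_iff_neg_vadd_mem, vadd_eq_add, neg_add_eq_sub]
    exact h2
  have hclosed : IsClosed (S.tileSupp t₀) := by
    rw [← closure_interior_tileSupp]; exact isClosed_closure
  have hstep : ∀ q ∈ S.tileSupp t₀, a⁻¹ • q ∈ interior (S.tileSupp t₀) := fun q hq => by
    have := hKint hq
    rwa [interior_smul₀ ha0.ne', Set.mem_smul_set_iff_inv_smul_mem₀ ha0.ne'] at this
  -- Contraction by `a⁻¹` maps the closed tile into its interior, so the origin, the limit of `a⁻ᵏ
  -- x₀`, lies in the tile and then in its interior. Hence the inflations exhaust the space.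
  have h0 : (0 : EuclideanSpace ℝ (Fin d)) ∈ S.tileSupp t₀ := by
    have hq : ∀ k : ℕ, (a⁻¹) ^ k • x₀ ∈ S.tileSupp t₀ := fun k => by
      induction k with
      | zero => rw [pow_zero, one_smul]; exact puncture_mem t₀
      | succ k ih => rw [pow_succ', ← smul_smul]; exact interior_subset (hstep _ ih)
    have hlim : Filter.Tendsto (fun k : ℕ => (a⁻¹) ^ k • x₀) Filter.atTop (nhds 0) := by
      have := (tendsto_pow_atTop_nhds_zero_of_lt_one (inv_nonneg.2 ha0.le)
        (inv_lt_one_of_one_lt₀ ha1)).smul_const x₀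
      rwa [zero_smul] at this
    exact hclosed.mem_of_tendsto hlim (.of_forall hq)
  have h0' : (0 : EuclideanSpace ℝ (Fin d)) ∈ interior (S.tileSupp t₀) := by
    have := hstep 0 h0
    rwa [smul_zero] at this
  obtain ⟨r, hr, hball⟩ := Metric.isOpen_iff.1 isOpen_interior _ h0'
  have hpt : ∀ t ∈ ⋃ k, p k, ∃ k, t ∈ p k := fun t ht => Set.mem_iUnion.1 ht
  refine ⟨⋃ k, p k, ⟨⟨Set.eq_univ_of_forall fun q => ?_, ?_⟩, ?_⟩, ?_⟩
  · obtain ⟨k, hk⟩ := pow_unbounded_of_one_lt (‖q‖ / r) ha1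
    have hq : q ∈ S.cover (p k) := by
      simp only [p]
      rw [cover_iterate_inflate, cover_singleton, pow_mul,
        Set.mem_smul_set_iff_inv_smul_mem₀ (pow_pos ha0 k).ne']
      apply interior_subset
      apply hball
      rw [mem_ball_zero_iff, norm_smul, norm_inv, Real.norm_of_nonneg (pow_pos ha0 k).le,
        inv_mul_lt_iff₀ (pow_pos ha0 k)]
      rwa [div_lt_iff₀ hr] at hk
    exact cover_mono (Set.subset_iUnion p k) hq
  · intro t ht t' ht' hne
    obtain ⟨k, hk⟩ := hpt t ht
    obtain ⟨k', hk'⟩ := hpt t' ht'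
    exact isPacking_iterate_inflate (n * max k k') (Set.pairwise_singleton _ _)
      (hp_mono (le_max_left k k') hk) (hp_mono (le_max_right k k') hk') hne
  · intro F hF
    have : ∃ k, (F : Set (LabelledTile d V)) ⊆ p k :=
      (hp_mono.directed_le).exists_mem_subset_of_finset_subset_biUnion (by simpa using hF)
    obtain ⟨k, hk⟩ := this
    exact ⟨i, n * k, S.expansion ^ (n * k) • x₀, hk.trans (iterate_inflate_singleton _ t₀).le⟩
  · intro m j
    -- The order is at least `k`, so type `j` occurs there; `m` further inflations turn this tile
    -- into an `m`-supertile inside `p (m + k)`.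
    obtain ⟨y, hy⟩ := hk (n * (m + k) - m) (by
      have : m + k ≤ n * (m + k) := Nat.le_mul_of_pos_left _ (by omega)
      omega) i j
    have h1 := translate_superTile_subset (m := m) hy
    have h2 : m + (n * (m + k) - m) = n * (m + k) := by
      have : m + k ≤ n * (m + k) := Nat.le_mul_of_pos_left _ (by omega)
      omega
    rw [h2] at h1
    refine ⟨S.expansion ^ m • y + S.expansion ^ (n * (m + k)) • x₀, ?_⟩
    refine Set.Subset.trans ?_ (Set.subset_iUnion p (m + k))
    rw [← translate_translate]
    exact (translate_mono h1).trans (iterate_inflate_singleton _ t₀).ge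

end TilingSubstitution

/-! ### Repetitivity and complexity of substitution tilings -/

namespace TilingSubstitution

set_option linter.unusedSectionVars false

variable {d : ℕ} {V : Type*} {S : TilingSubstitution d V}

/-! #### Windows -/

theorem window_mono {T T' : Set (LabelledTile d V)} (h : T ⊆ T') (ρ : ℝ) :
    S.window T ρ ⊆ S.window T' ρ := fun _ ht => ⟨h ht.1, ht.2⟩

theorem mem_window_of_norm_le {T : Set (LabelledTile d V)} {t : LabelledTile d V} (ht : t ∈ T)
    {ρ : ℝ} (h : ‖t.2‖ ≤ ρ) : t ∈ S.window T ρ :=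
  ⟨ht, t.2, puncture_mem t, mem_closedBall_zero_iff.2 h⟩

theorem norm_le_of_mem_window {r : ℝ} (hr : ∀ i, ∀ p ∈ S.supp i, ‖p‖ ≤ r)
    {T : Set (LabelledTile d V)} {t : LabelledTile d V} {ρ : ℝ} (ht : t ∈ S.window T ρ) :
    ‖t.2‖ ≤ ρ + r := by
  obtain ⟨-, p, hp, hpρ⟩ := ht
  have h1 := tileSupp_subset_closedBall hr hp
  rw [mem_closedBall_zero_iff] at hpρ
  have h2 : t.2 = p - (p - t.2) := by abel
  rw [h2]
  exact (norm_sub_le _ _).trans (add_le_add hpρ h1)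

theorem closedBall_subset_cover_window {T : Set (LabelledTile d V)} {ρ : ℝ}
    (h : Metric.closedBall 0 ρ ⊆ S.cover T) :
    Metric.closedBall 0 ρ ⊆ S.cover (S.window T ρ) := by
  intro p hp
  obtain ⟨t, ht, hpt⟩ := mem_cover.1 (h hp)
  exact mem_cover.2 ⟨t, ⟨ht, p, hpt, hp⟩, hpt⟩

/-- Tiles of a packing that cover a ball determine the windows of the packing. -/
theorem IsPacking.window_eq {T p : Set (LabelledTile d V)} (hT : S.IsPacking T) (hp : p ⊆ T)
    {ρ ρ' : ℝ} (h : ρ < ρ') (hcov : Metric.ball 0 ρ' ⊆ S.cover p) :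
    S.window T ρ = S.window p ρ := by
  refine Set.Subset.antisymm (fun t ht => ⟨?_, ht.2⟩) (window_mono hp ρ)
  refine hT.mem_of_inter hp Metric.isOpen_ball hcov ht.1 (ht.2.mono ?_)
  exact Set.inter_subset_inter_right _ (Metric.closedBall_subset_ball h)

/-- Relative to one fixed tile of the window, every other tile forms a two-tile patch of bounded
size. -/
theorem finite_window [Finite V] (hflc : S.FiniteLocalComplexity) {T : Set (LabelledTile d V)}
    (hT : T ∈ S.hull) (ρ : ℝ) : (S.window T ρ).Finite := by
  obtain ⟨r, hr0, hr⟩ := S.exists_radius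
  rcases (S.window T ρ).eq_empty_or_nonempty with h | ⟨t₀, ht₀⟩
  · rw [h]; exact Set.finite_empty
  refine Set.Finite.of_finite_image (f := fun t => (t₀.1, t.1, t.2 - t₀.2))
    ((hflc (2 * (ρ + r))).subset ?_) ?_
  · rintro _ ⟨t, ht, rfl⟩
    refine ⟨?_, T, hT, t₀.2, ht₀.1, ?_⟩
    · have h1 := norm_le_of_mem_window hr ht
      have h2 := norm_le_of_mem_window hr ht₀
      exact (norm_sub_le _ _).trans (by linarith)
    · simpa using ht.1
  · intro t _ t' _ h
    simp only [Prod.mk.injEq, true_and] at h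
    exact Prod.ext h.1 (sub_left_injective h.2)

/-! #### Desubstitution -/

theorem exists_norm_eq (hd : 0 < d) {a : ℝ} (ha : 0 ≤ a) :
    ∃ p : EuclideanSpace ℝ (Fin d), ‖p‖ = a := by
  refine ⟨EuclideanSpace.single ⟨0, hd⟩ a, ?_⟩
  simp [abs_of_nonneg ha]

theorem norm_sub_le_of_mem_cover_superTile {r : ℝ} (hr : ∀ i, ∀ p ∈ S.supp i, ‖p‖ ≤ r)
    {n : ℕ} {i : V} {x p : EuclideanSpace ℝ (Fin d)}
    (hp : p ∈ S.cover (translate x (S.superTile n i))) : ‖p - x‖ ≤ S.expansion ^ n * r := by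
  rw [mem_cover_translate, cover_superTile,
    Set.mem_smul_set_iff_inv_smul_mem₀ (pow_expansion_pos n).ne'] at hp
  have := hr _ _ hp
  rwa [norm_smul, norm_inv, Real.norm_of_nonneg (pow_expansion_pos n).le,
    inv_mul_le_iff₀ (pow_expansion_pos n)] at this

/-- Every window of a tiling of the hull is a window of an `n` times inflated supertile. -/
theorem exists_desubstitution [Finite V] (hd : 0 < d) (hflc : S.FiniteLocalComplexity)
    {T : Set (LabelledTile d V)} (hT : T ∈ S.hull) (n : ℕ) (ρ : ℝ) :
    ∃ (x : EuclideanSpace ℝ (Fin d)) (m : ℕ) (i : V),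
      S.window T ρ = S.window (S.inflate^[n] (translate x (S.superTile m i))) ρ ∧
      Metric.closedBall 0 ρ ⊆ S.cover (S.inflate^[n] (translate x (S.superTile m i))) := by
  obtain ⟨r, hr0, hr⟩ := S.exists_radius
  have hpos := S.pow_expansion_pos n
  -- A ball of radius greater than `λ^n r` fits into no supertile of order at most `n`, as two
  -- antipodal points of norm `ρ'` show. The `ρ + 1` leaves room to compare windows of radius `ρ`.
  set ρ' := max (ρ + 1) (S.expansion ^ n * r + 1) with hρ'
  have hρ1 : ρ < ρ' := lt_of_lt_of_le (lt_add_one ρ) (le_max_left _ _)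
  have hρ2 : S.expansion ^ n * r < ρ' := lt_of_lt_of_le (lt_add_one _) (le_max_right _ _)
  have hρ0 : 0 < ρ' := lt_of_le_of_lt (by positivity) hρ2
  have hfin := finite_window hflc hT ρ'
  obtain ⟨i, N, x, hsub⟩ := hT.2 hfin.toFinset (by
    rw [hfin.coe_toFinset]; exact fun t ht => ht.1)
  rw [hfin.coe_toFinset] at hsub
  have hcov : Metric.closedBall 0 ρ' ⊆ S.cover (S.window T ρ') :=
    closedBall_subset_cover_window (by rw [hT.1.cover_eq]; exact Set.subset_univ _)
  have hN : n < N := by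
    obtain ⟨u, hu⟩ := exists_norm_eq hd hρ0.le
    have h1 : ‖u - x‖ ≤ S.expansion ^ N * r := norm_sub_le_of_mem_cover_superTile hr
      (cover_mono hsub (hcov (mem_closedBall_zero_iff.2 hu.le)))
    have h2 : ‖-u - x‖ ≤ S.expansion ^ N * r := norm_sub_le_of_mem_cover_superTile hr
      (cover_mono hsub (hcov (mem_closedBall_zero_iff.2 (by rw [norm_neg, hu]))))
    have h3 : ‖(u - x) - (-u - x)‖ = 2 * ρ' := by
      have : (u - x) - (-u - x) = (2 : ℝ) • u := by rw [two_smul]; abel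
      rw [this, norm_smul, hu, Real.norm_two]
    have h4 : ρ' ≤ S.expansion ^ N * r := by
      have := norm_sub_le (u - x) (-u - x)
      linarith
    have h5 : S.expansion ^ n < S.expansion ^ N := lt_of_mul_lt_mul_right (hρ2.trans_le h4) hr0.le
    exact (pow_lt_pow_iff_right₀ S.one_lt_expansion).1 h5
  obtain ⟨m, rfl⟩ := Nat.exists_eq_add_of_lt hN
  have hQ : S.inflate^[n] (translate ((S.expansion ^ n)⁻¹ • x) (S.superTile (m + 1) i)) =
      translate x (S.superTile (n + m + 1) i) := by
    rw [iterate_inflate_translate, smul_smul, mul_inv_cancel₀ hpos.ne', one_smul,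
      iterate_inflate_superTile, add_assoc]
  refine ⟨(S.expansion ^ n)⁻¹ • x, m + 1, i, ?_, ?_⟩
  · rw [hQ, hT.1.isPacking.window_eq (fun t ht => ht.1) hρ1 (Metric.ball_subset_closedBall.trans hcov),
      (isPacking_translate x (isPacking_superTile _ i)).window_eq hsub hρ1
        (Metric.ball_subset_closedBall.trans hcov)]
  · rw [hQ]
    exact (Metric.closedBall_subset_closedBall hρ1.le).trans (hcov.trans (cover_mono hsub))

theorem exists_hull_superset [Fintype V] [DecidableEq V] [Nonempty V]
    (hprim : S.abelMatrix.IsPrimitive) (x : EuclideanSpace ℝ (Fin d)) (m : ℕ) (i : V) :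
    ∃ T ∈ S.hull, translate x (S.superTile m i) ⊆ T := by
  obtain ⟨T, hT, h⟩ := exists_tiling hprim
  obtain ⟨y, hy⟩ := h m i
  refine ⟨translate (x - y) T, translate_mem_hull _ hT, ?_⟩
  have := translate_mono (x := x - y) hy
  rwa [translate_translate, add_sub_cancel] at this

theorem closedBall_subset_cover_iterate_inflate_iff {T : Set (LabelledTile d V)} {ρ : ℝ} (n : ℕ) :
    Metric.closedBall 0 (S.expansion ^ n * ρ) ⊆ S.cover (S.inflate^[n] T) ↔
      Metric.closedBall 0 ρ ⊆ S.cover T := by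
  have hpos := S.pow_expansion_pos n
  rw [cover_iterate_inflate]
  constructor
  · intro h p hp
    rw [mem_closedBall_zero_iff] at hp
    have := h (mem_closedBall_zero_iff.2 (show ‖S.expansion ^ n • p‖ ≤ _ by
      rw [norm_smul, Real.norm_of_nonneg hpos.le]
      exact mul_le_mul_of_nonneg_left hp hpos.le))
    rwa [Set.smul_mem_smul_set_iff₀ hpos.ne'] at this
  · intro h p hp
    rw [mem_closedBall_zero_iff] at hp
    rw [Set.mem_smul_set_iff_inv_smul_mem₀ hpos.ne']
    apply h
    rw [mem_closedBall_zero_iff, norm_smul, norm_inv, Real.norm_of_nonneg hpos.le,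
      inv_mul_le_iff₀ hpos]
    exact hp

/-! #### Clusters -/

/-- There are finitely many clusters such that the window of radius `2 λ ^ n` of a tiling of the hull
is always a window of an `n` times inflated cluster. -/
theorem exists_clusters [Fintype V] [DecidableEq V] [Nonempty V] (hd : 0 < d)
    (hprim : S.abelMatrix.IsPrimitive) (hflc : S.FiniteLocalComplexity) :
    ∃ K : Set (Set (LabelledTile d V)), K.Finite ∧
      (∀ C ∈ K, C.Finite ∧ ∃ x m i, C ⊆ translate x (S.superTile m i)) ∧
      ∀ T ∈ S.hull, ∀ n, ∃ C ∈ K, ∃ v y, (v, 0) ∈ C ∧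
        (0 : EuclideanSpace ℝ (Fin d)) ∈ S.tileSupp (v, y) ∧
        Metric.closedBall 0 (S.expansion ^ n * 3) ⊆ S.cover (S.inflate^[n] (translate y C)) ∧
        ∀ ρ, ρ ≤ S.expansion ^ n * 2 →
          S.window T ρ = S.window (S.inflate^[n] (translate y C)) ρ := by
  obtain ⟨r, hr0, hr⟩ := S.exists_radius
  -- All tiles that can accompany a tile placed at the origin at bounded distance: a finite set, so
  -- the clusters, being subsets of it, are finite in number.
  let G : Set (LabelledTile d V) := (fun q : V × V × EuclideanSpace ℝ (Fin d) => q.2) ''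
    {q : V × V × EuclideanSpace ℝ (Fin d) | ‖q.2.2‖ ≤ 3 + 2 * r ∧
      ∃ T ∈ S.hull, ∃ x, (q.1, x) ∈ T ∧ (q.2.1, x + q.2.2) ∈ T}
  have hG : G.Finite := (hflc _).image _
  refine ⟨{C | C ⊆ G ∧ ∃ x m i, C ⊆ translate x (S.superTile m i)},
    hG.finite_subsets.subset fun C hC => hC.1, fun C hC => ⟨hG.subset hC.1, hC.2⟩, ?_⟩
  intro T hT n
  have hpos := S.pow_expansion_pos n
  obtain ⟨x, m, i, hwin, hcov⟩ := exists_desubstitution hd hflc hT n (S.expansion ^ n * 3)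
  set Q := translate x (S.superTile m i) with hQ
  have hcovQ := (closedBall_subset_cover_iterate_inflate_iff n).1 hcov
  have hcovK := closedBall_subset_cover_window hcovQ
  obtain ⟨t₀, ht₀, h0⟩ := mem_cover.1
    (hcovK (mem_closedBall_zero_iff.2 (by rw [norm_zero]; norm_num)))
  obtain ⟨T₁, hT₁, hQT₁⟩ := exists_hull_superset hprim x m i
  have hC : translate t₀.2 (translate (-t₀.2) (S.window Q 3)) = S.window Q 3 := by
    rw [translate_translate, neg_add_cancel, translate_zero]
  have hcov' : Metric.closedBall 0 (S.expansion ^ n * 3) ⊆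
      S.cover (S.inflate^[n] (S.window Q 3)) := (closedBall_subset_cover_iterate_inflate_iff n).2 hcovK
  -- The cluster is the window of radius `3` of the desubstituted patch, moved so that the tile
  -- covering the origin has its puncture at `0`.
  refine ⟨translate (-t₀.2) (S.window Q 3), ⟨?_, ?_⟩, t₀.1, t₀.2, ?_, h0, ?_, ?_⟩
  · intro t ht
    rw [mem_translate, sub_neg_eq_add] at ht
    refine ⟨(t₀.1, t), ⟨?_, T₁, hT₁, t₀.2, hQT₁ ht₀.1, ?_⟩, rfl⟩
    · have h1 := norm_le_of_mem_window hr ht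
      have h2 := tileSupp_subset_closedBall hr h0
      rw [zero_sub, norm_neg] at h2
      have h3 : t.2 = (t.2 + t₀.2) - t₀.2 := by abel
      change ‖t.2‖ ≤ _
      rw [h3]
      refine (norm_sub_le _ _).trans ?_
      change ‖t.2 + t₀.2‖ ≤ _ at h1
      linarith
    · rw [add_comm]
      exact hQT₁ ht.1
  · refine ⟨x + -t₀.2, m, i, ?_⟩
    rw [← translate_translate]
    exact translate_mono fun t ht => ht.1
  · rw [mem_translate, zero_sub, neg_neg]
    exact ht₀
  · rw [hC]
    exact hcov'
  · intro ρ hρ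
    rw [hC, S.window_eq_of_le (by linarith) hwin]
    refine IsPacking.window_eq ?_ (iterate_inflate_mono n fun t ht => ht.1)
      (show ρ < S.expansion ^ n * 3 by linarith) (Metric.ball_subset_closedBall.trans hcov')
    exact isPacking_iterate_inflate n (isPacking_translate x (isPacking_superTile m i))

/-! #### Complexity -/

theorem exists_finset_superTile [Fintype V] [DecidableEq V] :
    ∃ M : ℕ, ∀ n i, ∃ F : Finset (LabelledTile d V),
      (F : Set (LabelledTile d V)) = S.superTile n i ∧ F.card ≤ M ^ n := by
  classical
  refine ⟨Finset.univ.sup fun i => (S.rule i).card, fun n i => ?_⟩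
  induction n with
  | zero => exact ⟨{(i, 0)}, by simp [superTile], by simp⟩
  | succ n ih =>
    obtain ⟨F, hF, hcard⟩ := ih
    refine ⟨F.biUnion fun t => (S.rule t.1).image fun w => (w.1, S.expansion • t.2 + w.2), ?_, ?_⟩
    · rw [superTile, Function.iterate_succ_apply', ← superTile, ← hF]
      ext u
      simp only [Finset.coe_biUnion, Finset.coe_image, Set.mem_iUnion, Set.mem_image, mem_inflate,
        exists_prop, eq_comm, Finset.mem_coe]
    · rw [pow_succ]
      refine (Finset.card_biUnion_le_card_mul _ _ _ fun t _ => ?_).trans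
        (Nat.mul_le_mul_right _ hcard)
      exact Finset.card_image_le.trans
        (Finset.le_sup (f := fun i => (S.rule i).card) (Finset.mem_univ _))

/-- The number of windows of radius `λ ^ n` in the transversal grows at most exponentially. -/
theorem exists_card_window_le [Fintype V] [DecidableEq V] [Nonempty V] (hd : 0 < d)
    (hprim : S.abelMatrix.IsPrimitive) (hflc : S.FiniteLocalComplexity) :
    ∃ N M : ℕ, ∀ n, ∃ F : Finset (Set (LabelledTile d V)), F.card ≤ N * M ^ n ∧
      ∀ T ∈ S.hull, (∃ i, (i, 0) ∈ T) → S.window T (S.expansion ^ n) ∈ F := by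
  classical
  obtain ⟨K, hK, hKC, hKT⟩ := exists_clusters hd hprim hflc
  obtain ⟨M, hM⟩ := S.exists_finset_superTile
  choose F hF hFcard using hM
  have hfin : ∀ C : Set (LabelledTile d V), C ∈ K → C.Finite := fun C hC => (hKC C hC).1
  let B : Set (LabelledTile d V) → Finset (LabelledTile d V) := fun C =>
    if h : C.Finite then h.toFinset else ∅
  have hB : ∀ C ∈ K, ∀ t, t ∈ C ↔ t ∈ B C := fun C hC t => by simp [B, hfin C hC]
  let I : Finset (Σ _ : Set (LabelledTile d V), LabelledTile d V) := hK.toFinset.sigma B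
  -- A punctured window is determined by a cluster, a tile of the cluster and the tile of its `n`-th
  -- inflation that sits at the origin. The first two are bounded in number, the last has at most
  -- `M^n` choices.
  refine ⟨I.card, M, fun n => ⟨I.biUnion fun q => (F n q.2.1).image fun w =>
    S.window (translate (-w.2 - S.expansion ^ n • q.2.2) (S.inflate^[n] q.1)) (S.expansion ^ n),
    Finset.card_biUnion_le_card_mul _ _ _ fun q _ => Finset.card_image_le.trans (hFcard _ _), ?_⟩⟩
  rintro T hT ⟨i, hi⟩
  have hpos := S.pow_expansion_pos n
  obtain ⟨C, hC, v, y, -, -, -, hwin⟩ := hKT T hT n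
  have h1 : (i, 0) ∈ S.window T (S.expansion ^ n) :=
    mem_window_of_norm_le hi (by rw [norm_zero]; exact hpos.le)
  have hw := hwin (S.expansion ^ n) (by linarith)
  rw [hw] at h1
  obtain ⟨t, ht, hit⟩ := mem_iterate_inflate.1 h1.1
  rw [iterate_inflate_singleton, mem_translate] at hit
  rw [mem_translate] at ht
  refine Finset.mem_biUnion.2 ⟨⟨C, (t.1, t.2 - y)⟩, Finset.mem_sigma.2
    ⟨hK.mem_toFinset.2 hC, (hB C hC _).1 ht⟩, Finset.mem_image.2
    ⟨(i, 0 - S.expansion ^ n • t.2), ?_, ?_⟩⟩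
  · rw [← Finset.mem_coe, hF]
    exact hit
  · rw [hw, iterate_inflate_translate]
    congr 2
    simp only [smul_sub]
    abel

/-! #### Linear repetitivity -/

/-- Each cluster lies in some supertile, and by primitivity that supertile occurs in all supertiles
of sufficiently high order. Finiteness of `K` makes the order uniform. -/
theorem exists_forall_cluster_subset [Fintype V] [DecidableEq V]
    (hprim : S.abelMatrix.IsPrimitive) {K : Set (Set (LabelledTile d V))} (hK : K.Finite)
    (hKC : ∀ C ∈ K, ∃ x m i, C ⊆ translate x (S.superTile m i)) :
    ∃ m, ∀ C ∈ K, ∀ j, ∃ z, translate z C ⊆ S.superTile m j := by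
  obtain ⟨k, hk⟩ := exists_forall_mem_superTile hprim
  have h : ∀ᶠ m in Filter.atTop, ∀ C ∈ K, ∀ j, ∃ z, translate z C ⊆ S.superTile m j := by
    rw [Filter.eventually_all_finite hK]
    intro C hC
    obtain ⟨x, m₀, i, hsub⟩ := hKC C hC
    filter_upwards [Filter.eventually_ge_atTop (m₀ + k)] with m hm j
    obtain ⟨y, hy⟩ := hk (m - m₀) (by omega) j i
    have h1 := translate_superTile_subset (m := m₀) hy
    rw [Nat.add_sub_cancel' (by omega)] at h1
    refine ⟨-x + S.expansion ^ m₀ • y, ?_⟩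
    rw [← translate_translate]
    refine Set.Subset.trans (translate_mono ?_) h1
    have h2 := translate_mono (x := -x) hsub
    rwa [translate_translate, add_neg_cancel, translate_zero] at h2
  exact h.exists

/-- With `m` as in `exists_forall_cluster_subset`, each supertile of order `n + m` contains the
`n`-th inflation of every cluster, hence every window of radius `λ^n`. Its size is a constant times
`λ^n`, and one covers `z`. -/
theorem exists_linear_repetitivity [Fintype V] [DecidableEq V] [Nonempty V] (hd : 0 < d)
    (hprim : S.abelMatrix.IsPrimitive) (hflc : S.FiniteLocalComplexity) :
    ∃ c : ℝ, 0 < c ∧ ∀ n : ℕ, ∀ T ∈ S.hull, ∀ T₁ ∈ S.hull, ∀ z : EuclideanSpace ℝ (Fin d),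
      ∃ y, ‖y - z‖ ≤ c * S.expansion ^ n ∧
        S.window (translate (-y) T₁) (S.expansion ^ n) = S.window T (S.expansion ^ n) := by
  obtain ⟨r, hr0, hr⟩ := S.exists_radius
  obtain ⟨K, hK, hKC, hKT⟩ := exists_clusters hd hprim hflc
  obtain ⟨m, hm⟩ := exists_forall_cluster_subset hprim hK fun C hC => (hKC C hC).2
  have hm0 := S.pow_expansion_pos m
  refine ⟨2 * r * S.expansion ^ m + r, by positivity, fun n T hT T₁ hT₁ z => ?_⟩
  have hn0 := S.pow_expansion_pos n
  obtain ⟨C, hC, v, y₀, hv, h0, hcov, hwin⟩ := hKT T hT n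
  -- Move `z` to the origin and desubstitute to order `n + m`; the radius is large enough to contain
  -- the whole supertile over the origin.
  have hT₁' := translate_mem_hull (-z) hT₁
  obtain ⟨x, k, i, hwin₁, hcov₁⟩ := exists_desubstitution hd hflc hT₁' (n + m)
    (S.expansion ^ (n + m) * (2 * r))
  set Q := translate x (S.superTile k i)
  have hcovQ := (closedBall_subset_cover_iterate_inflate_iff (n + m)).1 hcov₁
  obtain ⟨t, ht, h0t⟩ := mem_cover.1
    (hcovQ (mem_closedBall_zero_iff.2 (by rw [norm_zero]; positivity)))
  obtain ⟨z', hz'⟩ := hm C hC t.1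
  set u := z' + S.expansion ^ m • t.2 with hu
  have hsub : S.inflate^[n] (translate u C) ⊆ S.inflate^[n + m] {t} := by
    rw [Function.iterate_add_apply, iterate_inflate_singleton, hu, ← translate_translate]
    exact iterate_inflate_mono n (translate_mono hz')
  have hbound : ∀ p ∈ S.cover (S.inflate^[n + m] {t}), ‖p‖ ≤ S.expansion ^ (n + m) * (2 * r) := by
    intro p hp
    rw [cover_iterate_inflate, cover_singleton] at hp
    obtain ⟨q, hq, rfl⟩ := hp
    change ‖S.expansion ^ (n + m) • q‖ ≤ _
    have hpos := S.pow_expansion_pos (n + m)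
    rw [norm_smul, Real.norm_of_nonneg hpos.le]
    refine mul_le_mul_of_nonneg_left ?_ hpos.le
    have h1 := tileSupp_subset_closedBall hr hq
    have h2 := tileSupp_subset_closedBall hr h0t
    have h3 : q = (q - t.2) - (0 - t.2) := by abel
    rw [h3]
    exact (norm_sub_le _ _).trans (by linarith)
  have hsub₁ : S.inflate^[n] (translate u C) ⊆ translate (-z) T₁ := by
    intro s hs
    have h1 : s ∈ S.window (S.inflate^[n + m] Q) (S.expansion ^ (n + m) * (2 * r)) := by
      refine mem_window_of_norm_le (iterate_inflate_mono _ (Set.singleton_subset_iff.2 ht) (hsub hs)) ?_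
      exact hbound _ (tileSupp_subset_cover (hsub hs) (puncture_mem s))
    rw [← hwin₁] at h1
    exact h1.1
  -- The cluster has a tile with puncture `0`, so `u` is the puncture of a tile whose inflation lies
  -- in the bounded supertile.
  have hunorm : ‖u‖ ≤ S.expansion ^ m * (2 * r) := by
    have h1 : (v, u) ∈ translate u C := mem_translate.2 (by simpa using hv)
    have h2 : S.expansion ^ n • u ∈ S.cover (S.inflate^[n] (translate u C)) := by
      rw [cover_iterate_inflate]
      exact Set.smul_mem_smul_set (tileSupp_subset_cover h1 (puncture_mem (v, u)))
    have h3 := hbound _ (cover_mono hsub h2)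
    rw [norm_smul, Real.norm_of_nonneg hn0.le, pow_add, mul_assoc] at h3
    exact le_of_mul_le_mul_left h3 hn0
  have hynorm : ‖y₀‖ ≤ r := by
    have := tileSupp_subset_closedBall hr h0
    rwa [zero_sub, norm_neg] at this
  refine ⟨z + S.expansion ^ n • (u - y₀), ?_, ?_⟩
  · rw [add_sub_cancel_left, norm_smul, Real.norm_of_nonneg hn0.le, mul_comm]
    refine mul_le_mul_of_nonneg_right ((norm_sub_le _ _).trans ?_) hn0.le
    linarith
  · have h1 : S.inflate^[n] (translate y₀ C) ⊆
        translate (-(z + S.expansion ^ n • (u - y₀))) T₁ := by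
      have h2 := translate_mono (x := -(S.expansion ^ n • (u - y₀))) hsub₁
      rw [translate_translate, iterate_inflate_translate, translate_translate] at h2
      rw [iterate_inflate_translate]
      convert h2 using 2
      · rw [smul_sub]; abel
      · abel
    rw [hwin (S.expansion ^ n) (by linarith)]
    exact (isTiling_translate _ hT₁.1).isPacking.window_eq h1
      (show S.expansion ^ n < S.expansion ^ n * 3 by linarith)
      (Metric.ball_subset_closedBall.trans hcov)

/-- The window of radius `λ ^ n` of a tiling without periods has two different extensions to a
window whose radius is larger by a constant factor. -/
theorem exists_window_eq_and_ne [Fintype V] [DecidableEq V] [Nonempty V] (hd : 0 < d)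
    (hprim : S.abelMatrix.IsPrimitive) (hflc : S.FiniteLocalComplexity) (haper : S.Aperiodic) :
    ∃ c : ℝ, 0 < c ∧ ∀ n : ℕ, ∀ T ∈ S.hull, (∃ i, (i, 0) ∈ T) →
      ∃ T' ∈ S.hull, (∃ i, (i, 0) ∈ T') ∧
        S.window T (S.expansion ^ n) = S.window T' (S.expansion ^ n) ∧
        S.window T (c * S.expansion ^ n) ≠ S.window T' (c * S.expansion ^ n) := by
  obtain ⟨c, hc, h⟩ := exists_linear_repetitivity hd hprim hflc
  refine ⟨4 * c, by positivity, fun n T hT hi => ?_⟩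
  obtain ⟨i, hi⟩ := hi
  have hn0 := S.pow_expansion_pos n
  set R := S.expansion ^ n with hR
  have hcR : 0 < c * R := mul_pos hc hn0
  -- Now the window of radius `R` forces the one of radius `4 c R`: every return vector `y` of the
  -- small window preserves all tiles with puncture within `4 c R`.
  by_contra! hcon
  have hext : ∀ y, S.window (translate (-y) T) R = S.window T R → ∀ t : LabelledTile d V,
      ‖t.2‖ ≤ 4 * c * R → (t ∈ T ↔ (t.1, t.2 + y) ∈ T) := by
    intro y hy t ht
    have h0 : (i, 0) ∈ S.window (translate (-y) T) R := by
      rw [hy]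
      exact mem_window_of_norm_le hi (by rw [norm_zero]; exact hn0.le)
    have h1 := hcon (translate (-y) T) (translate_mem_hull _ hT) ⟨i, h0.1⟩ hy.symm
    have h2 : t ∈ S.window T (4 * c * R) ↔ t ∈ S.window (translate (-y) T) (4 * c * R) := by rw [h1]
    have h3 : ∀ A : Set (LabelledTile d V), t ∈ S.window A (4 * c * R) ↔ t ∈ A := fun A =>
      ⟨fun h => h.1, fun h => mem_window_of_norm_le h ht⟩
    rw [h3, h3, mem_translate, sub_neg_eq_add] at h2
    exact h2
  -- Repetitivity near a point of norm `2 c R` yields a return vector `x` with `c R ≤ ‖x‖ ≤ 3 c R`,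
  -- in particular nonzero.
  obtain ⟨z, hz⟩ := exists_norm_eq hd (show 0 ≤ 2 * (c * R) by positivity)
  obtain ⟨x, hxz, hx⟩ := h n T hT T hT z
  have hx_le : ‖x‖ ≤ 3 * (c * R) := by
    have := norm_add_le (x - z) z
    rw [sub_add_cancel] at this
    linarith
  have hx0 : x ≠ 0 := by
    rintro rfl
    rw [zero_sub, norm_neg, hz] at hxz
    linarith
  refine hx0 (haper T hT x ?_)
  refine (isTiling_translate x hT.1).eq_of_subset hT.1 ?_
  rintro _ ⟨t, ht, rfl⟩
  -- To shift `t` by `x`: carry it near the origin by a return vector `y` close to it, shift there,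
  -- and carry it back. The shifted puncture has norm at most `c R + 3 c R`, whence the constant `4
  -- c`.
  obtain ⟨y, hyt, hy⟩ := h n T hT T hT t.2
  have hyt' : ‖t.2 - y‖ ≤ c * R := by rwa [norm_sub_rev]
  have h1 : (t.1, t.2 - y) ∈ T := (hext y hy (t.1, t.2 - y) (by
    change ‖t.2 - y‖ ≤ _; linarith)).2 (by simpa using ht)
  have h2 : (t.1, t.2 - y + x) ∈ T := (hext x hx (t.1, t.2 - y) (by
    change ‖t.2 - y‖ ≤ _; linarith)).1 h1
  have h3 := (hext y hy (t.1, t.2 - y + x) (by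
    change ‖t.2 - y + x‖ ≤ _
    refine (norm_add_le _ _).trans ?_
    linarith)).1 h2
  have h4 : t.2 - y + x + y = t.2 + x := by abel
  change (t.1, t.2 - y + x + y) ∈ T at h3
  rwa [h4] at h3

end TilingSubstitution

/-! ### The transversal -/

namespace TilingSubstitution

set_option linter.unusedSectionVars false

variable {d : ℕ} {V : Type*} {S : TilingSubstitution d V}

theorem window_eq_of_forall_mem_iff {T T' : Set (LabelledTile d V)} {ρ : ℝ}
    (h : ∀ t : LabelledTile d V, (S.tileSupp t ∩ Metric.closedBall 0 ρ).Nonempty →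
      (t ∈ T ↔ t ∈ T')) : S.window T ρ = S.window T' ρ :=
  Set.ext fun t => and_congr_left (h t)

/-! #### The metric of the transversal -/

theorem dist_le_of_window_eq {T T' : S.Transversal} {ρ : ℝ} (hρ : 0 ≤ ρ)
    (h : S.window T.1 ρ = S.window T'.1 ρ) : dist T T' ≤ 1 / (ρ + 1) :=
  csInf_le (S.bddBelow_agreement _ _) (Or.inr ⟨ρ, hρ, h, rfl⟩)

theorem dist_le_one (T T' : S.Transversal) : dist T T' ≤ 1 :=
  csInf_le (S.bddBelow_agreement _ _) (Or.inl rfl)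

theorem window_eq_of_dist_lt {T T' : S.Transversal} {ρ : ℝ} (hρ : 0 ≤ ρ)
    (h : dist T T' < 1 / (ρ + 1)) : S.window T.1 ρ = S.window T'.1 ρ := by
  obtain ⟨a, ha, haρ⟩ := exists_lt_of_csInf_lt
    (⟨1, Or.inl rfl⟩ : (S.agreement T.1 T'.1).Nonempty) h
  rcases ha with rfl | ⟨r, hr, hw, rfl⟩
  · have : 1 / (ρ + 1) ≤ 1 := by rw [div_le_one (by linarith)]; linarith
    linarith
  · have := (one_div_lt_one_div (by linarith) (by linarith)).1 haρ
    exact S.window_eq_of_le (by linarith) hw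

/-- Agreement on a ball is transitive, so the metric is an ultrametric and chains are no longer than
their largest step. -/
theorem dist_le_max (T T' T'' : S.Transversal) :
    dist T T'' ≤ max (dist T T') (dist T' T'') := by
  refine le_of_forall_gt fun ε hε => ?_
  obtain ⟨h1, h2⟩ := max_lt_iff.1 hε
  obtain ⟨a, ha, ha'⟩ := exists_lt_of_csInf_lt
    (⟨1, Or.inl rfl⟩ : (S.agreement T.1 T'.1).Nonempty) h1
  obtain ⟨b, hb, hb'⟩ := exists_lt_of_csInf_lt
    (⟨1, Or.inl rfl⟩ : (S.agreement T'.1 T''.1).Nonempty) h2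
  exact (csInf_le (S.bddBelow_agreement _ _) (S.max_mem_agreement ha hb)).trans_lt
    (max_lt ha' hb')

/-- Along a Cauchy sequence each window stabilises. The eventually present tiles form the limit, and
membership in the transversal is checked on bounded windows and finite patches. -/
instance : CompleteSpace S.Transversal := by
  refine Metric.complete_of_cauchySeq_tendsto fun u hu => ?_
  have hwin : ∀ ρ : ℝ, 0 ≤ ρ → ∃ N, ∀ m ≥ N, ∀ n ≥ N, S.window (u m).1 ρ = S.window (u n).1 ρ := by
    intro ρ hρ
    obtain ⟨N, hN⟩ := Metric.cauchySeq_iff.1 hu (1 / (ρ + 1)) (by positivity)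
    exact ⟨N, fun m hm n hn => window_eq_of_dist_lt hρ (hN m hm n hn)⟩
  let T : Set (LabelledTile d V) := {t | ∀ᶠ k in Filter.atTop, t ∈ (u k).1}
  have hT : ∀ ρ : ℝ, 0 ≤ ρ → ∀ᶠ k in Filter.atTop, S.window (u k).1 ρ = S.window T ρ := by
    intro ρ hρ
    obtain ⟨N, hN⟩ := hwin ρ hρ
    filter_upwards [Filter.eventually_ge_atTop N] with k hk
    refine window_eq_of_forall_mem_iff fun t ht => ⟨fun h => ?_, fun h => ?_⟩
    · change ∀ᶠ _ in _, _
      filter_upwards [Filter.eventually_ge_atTop N] with l hl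
      have h1 : t ∈ S.window (u k).1 ρ := ⟨h, ht⟩
      rw [hN k hk l hl] at h1
      exact h1.1
    · obtain ⟨l, hl, hlN⟩ := (Filter.Eventually.and h (Filter.eventually_ge_atTop N)).exists
      have h1 : t ∈ S.window (u l).1 ρ := ⟨hl, ht⟩
      rw [hN l hlN k hk] at h1
      exact h1.1
  have hhull : T ∈ S.hull := by
    refine ⟨⟨Set.eq_univ_of_forall fun p => ?_, fun t ht t' ht' hne => ?_⟩, fun F hF => ?_⟩
    · obtain ⟨k, hk⟩ := (hT ‖p‖ (norm_nonneg p)).exists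
      have hp : p ∈ S.cover (S.window (u k).1 ‖p‖) := closedBall_subset_cover_window
        (by rw [(u k).2.1.1.cover_eq]; exact Set.subset_univ _) (mem_closedBall_zero_iff.2 le_rfl)
      rw [hk] at hp
      exact cover_mono (fun t ht => ht.1) hp
    · obtain ⟨k, hk, hk'⟩ := (Filter.Eventually.and ht ht').exists
      exact (u k).2.1.1.isPacking hk hk' hne
    · have h : ∀ᶠ k in Filter.atTop, ∀ t ∈ F, t ∈ (u k).1 :=
        (Filter.eventually_all_finset F).2 fun t ht => hF ht
      obtain ⟨k, hk⟩ := h.exists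
      exact (u k).2.1.2 F hk
  have hzero : ∃ i, (i, 0) ∈ T := by
    obtain ⟨k, hk⟩ := (hT 0 le_rfl).exists
    obtain ⟨i, hi⟩ := (u k).2.2
    have h : (i, 0) ∈ S.window (u k).1 0 := mem_window_of_norm_le hi (by simp)
    rw [hk] at h
    exact ⟨i, h.1⟩
  refine ⟨⟨T, hhull, hzero⟩, Metric.tendsto_nhds.2 fun ε hε => ?_⟩
  filter_upwards [hT (1 / ε) (by positivity)] with k hk
  refine (dist_le_of_window_eq (by positivity) hk).trans_lt ?_
  rw [div_lt_iff₀ (by positivity), mul_add, mul_one_div_cancel hε.ne']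
  linarith

theorem nonempty_transversal [Fintype V] [DecidableEq V] [Nonempty V]
    (hprim : S.abelMatrix.IsPrimitive) : Nonempty S.Transversal := by
  obtain ⟨T, hT, -⟩ := exists_tiling hprim
  have h0 : (0 : EuclideanSpace ℝ (Fin d)) ∈ S.cover T := by
    rw [hT.1.cover_eq]; trivial
  obtain ⟨t, ht, -⟩ := mem_cover.1 h0
  exact ⟨⟨translate (-t.2) T, translate_mem_hull _ hT, t.1, mem_translate.2 (by simpa using ht)⟩⟩

/-- The transversal of an aperiodic primitive substitution with finite local complexity is bi-Hölder
equivalent to a Cantor space. -/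
theorem isHolderCantor_transversal [Fintype V] [DecidableEq V] [Nonempty V] (hd : 0 < d)
    (hprim : S.abelMatrix.IsPrimitive) (hflc : S.FiniteLocalComplexity) (haper : S.Aperiodic) :
    IsHolderCantor S.Transversal where
  complete := inferInstance
  nonempty := nonempty_transversal hprim
  uniformlyPerfect := by
    obtain ⟨c, hc, h⟩ := exists_window_eq_and_ne hd hprim hflc haper
    obtain ⟨p, hp⟩ := pow_unbounded_of_one_lt (c * S.expansion + 1) (one_lt_two (α := ℝ))
    refine ⟨p, fun T r hr hr1 => ?_⟩
    obtain ⟨n, hn, hn'⟩ := exists_nat_pow_near ((one_le_div hr).2 hr1) S.one_lt_expansion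
    -- Since `λ^n ≤ 1/r < λ^(n+1)`, agreement at radius `λ^(n+1)` gives distance at most `r`;
    -- disagreement at `c λ^(n+1) ≤ c λ/r` gives distance at least `r/(c λ + 1)`, up to `r ≤ 1`.
    obtain ⟨T', hT', hi, heq, hne⟩ := h (n + 1) T.1 T.2.1 T.2.2
    have hpos := S.pow_expansion_pos (n + 1)
    refine ⟨⟨T', hT', hi⟩, ?_, ?_⟩
    · by_contra! hlt
      refine hne (window_eq_of_dist_lt (T' := ⟨T', hT', hi⟩) (by positivity) (hlt.trans_le ?_))
      have h1 : c * S.expansion ^ (n + 1) ≤ c * S.expansion / r := by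
        rw [pow_succ, mul_comm _ S.expansion, ← mul_assoc, div_eq_mul_one_div (c * S.expansion)]
        exact mul_le_mul_of_nonneg_left hn (mul_pos hc S.expansion_pos).le
      rw [le_div_iff₀ (by positivity), one_div, inv_pow, mul_assoc, inv_mul_le_iff₀ (by positivity),
        mul_one]
      calc r * (c * S.expansion ^ (n + 1) + 1) ≤ r * (c * S.expansion / r + 1) := by gcongr
        _ = c * S.expansion + r := by field_simp
        _ ≤ 2 ^ p := by linarith
    · refine (dist_le_of_window_eq hpos.le heq).trans ?_
      rw [div_lt_iff₀ hr] at hn'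
      rw [div_le_iff₀ (by positivity)]
      nlinarith
  card_le := by
    classical
    obtain ⟨N, M, h⟩ := exists_card_window_le hd hprim hflc
    -- As `λ^c > 2`, points more than `2^(-n)` apart have different windows of radius `λ^(c n)`, and
    -- those are counted.
    obtain ⟨c, hc⟩ := pow_unbounded_of_one_lt 2 S.one_lt_expansion
    obtain ⟨a, ha⟩ := pow_unbounded_of_one_lt N (one_lt_two (α := ℕ))
    obtain ⟨b, hb⟩ := pow_unbounded_of_one_lt (M ^ c) (one_lt_two (α := ℕ))
    refine ⟨a + b, fun n hn F hF => ?_⟩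
    obtain ⟨G, hG, hGT⟩ := h (c * n)
    have hle : F.card ≤ G.card := by
      refine Finset.card_le_card_of_injOn (fun T => S.window T.1 (S.expansion ^ (c * n)))
        (fun T _ => hGT T.1 T.2.1 T.2.2) fun T hT T' hT' heq => ?_
      by_contra hne
      have h1 := hF T hT T' hT' hne
      have h2 := dist_le_of_window_eq (S.pow_expansion_pos (c * n)).le heq
      have h3 : (2 : ℝ) ^ n ≤ S.expansion ^ (c * n) := by
        rw [pow_mul]
        exact pow_le_pow_left₀ zero_le_two hc.le n
      have h4 : 1 / (S.expansion ^ (c * n) + 1) ≤ (1 / 2 : ℝ) ^ n := by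
        rw [one_div_pow]
        exact one_div_le_one_div_of_le (by positivity) (by linarith)
      linarith
    calc F.card ≤ N * M ^ (c * n) := hle.trans hG
      _ ≤ 2 ^ a * (2 ^ b) ^ n := by
          rw [pow_mul]
          exact Nat.mul_le_mul ha.le (Nat.pow_le_pow_left hb.le n)
      _ = 2 ^ (a + b * n) := by rw [← pow_mul, ← pow_add]
      _ ≤ 2 ^ ((a + b) * n) := by
          refine Nat.pow_le_pow_right two_pos ?_
          rw [add_mul]
          exact Nat.add_le_add_right (Nat.le_mul_of_pos_right a hn) _
  chain := by
    refine ⟨1, 0, le_rfl, fun T T' => by simpa using dist_le_one T T', fun n _ T T' h => ?_⟩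
    rw [pow_one, pow_zero, one_mul]
    induction h with
    | refl => rw [dist_self]; positivity
    | tail _ h ih => exact (dist_le_max _ _ _).trans (max_le ih h)

/-! #### The diagram of a substitution -/

/-- The ancestors of a tile in a supertile trace a path of edges upwards. The last substitution step
is the first edge, so it is put in front. -/
theorem exists_path_of_mem_superTile [Fintype V] [DecidableEq V] (P : S.diagram.PerronData)
    {n : ℕ} {w v : V} {y : EuclideanSpace ℝ (Fin d)} (h : (v, y) ∈ S.superTile n w) :
    ∃ x : S.diagram.InfPath, S.diagram.src (x.1 0) = v ∧ S.diagram.src (x.1 n) = w := by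
  induction n generalizing v y with
  | zero =>
    obtain ⟨e, he⟩ := P.exists_src_eq v
    obtain ⟨x, hx⟩ := P.exists_path e
    have : v = w := congrArg Prod.fst h
    exact ⟨x, by rw [hx, he], by rw [hx, he, this]⟩
  | succ n ih =>
    rw [superTile, Function.iterate_succ_apply', ← superTile] at h
    obtain ⟨t, ht, u, hu, huv⟩ := h
    obtain ⟨x, hx0, hxn⟩ := ih ht
    let e : S.Edge := ⟨t.1, u, hu⟩
    refine ⟨⟨fun k => Nat.casesOn k e x.1, fun k => ?_⟩, ?_, hxn⟩
    · cases k with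
      | zero => exact hx0.symm
      | succ k => exact x.2 k
    · exact (congrArg Prod.fst huv).symm

/-- Otherwise the inflated prototile of largest diameter would be a translate of a prototile, with a
strictly larger diameter. -/
theorem exists_one_lt_card_rule [Finite V] [Nonempty V] (hd : 0 < d) :
    ∃ i, 1 < (S.rule i).card := by
  by_contra! h
  obtain ⟨i, hi⟩ := Finite.exists_max fun i => Metric.diam (S.supp i)
  obtain ⟨w, hw⟩ := S.rule_nonempty i
  have hrule : S.rule i = {w} := Finset.eq_singleton_iff_unique_mem.2
    ⟨hw, fun t ht => Finset.card_le_one.1 (h i) t ht w hw⟩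
  have hsupp := S.iUnion_rule i
  rw [hrule] at hsupp
  simp only [Finset.mem_singleton, Set.iUnion_iUnion_eq_left] at hsupp
  have hdiam := congrArg Metric.diam hsupp
  rw [diam_vadd, diam_smul₀, Real.norm_of_nonneg S.expansion_pos.le] at hdiam
  have hpos : 0 < Metric.diam (S.supp i) := by
    obtain ⟨r, hr0, hr⟩ := S.exists_inradius
    obtain ⟨p, hp⟩ := exists_norm_eq hd (half_pos hr0).le
    have h1 := Metric.dist_le_diam_of_mem (S.isCompact_supp i).isBounded
      (hr i (mem_ball_zero_iff.2 (by linarith : ‖p‖ < r))) (hr i (Metric.mem_ball_self hr0))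
    rw [dist_zero_right, hp] at h1
    linarith
  have h1 := hi w.1
  simp only [hdiam] at h1
  nlinarith [S.one_lt_expansion]

/-- Adding the coordinates of `A ν = Λ ν` gives `Λ` as the mean, with weights `ν`, of the numbers of
tiles in the rules. All are at least `1` and one is larger. -/
theorem one_lt_eigenvalue [Fintype V] [DecidableEq V] [Nonempty V] (hd : 0 < d)
    (P : S.diagram.PerronData) : 1 < P.eigenvalue := by
  have h1 : P.eigenvalue = ∑ i, P.vec i * (S.rule i).card := by
    calc P.eigenvalue = ∑ v, P.eigenvalue * P.vec v := by
          rw [← Finset.mul_sum, P.sum_vec, mul_one]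
      _ = ∑ v, ∑ e : S.Edge, (if S.diagram.src e = v then P.vec (S.diagram.tgt e) else 0) :=
          Finset.sum_congr rfl fun v _ => (P.sum_edges v).symm
      _ = ∑ e : S.Edge, P.vec (S.diagram.tgt e) := by
          rw [Finset.sum_comm]
          simp
      _ = ∑ i, ∑ _t : S.rule i, P.vec i :=
          Fintype.sum_sigma (fun e : (i : V) × S.rule i => P.vec e.1)
      _ = ∑ i, P.vec i * (S.rule i).card := by
          simp [mul_comm]
  obtain ⟨i, hi⟩ := S.exists_one_lt_card_rule hd
  rw [h1, ← P.sum_vec]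
  refine Finset.sum_lt_sum (fun j _ => ?_) ⟨i, Finset.mem_univ _, ?_⟩
  · refine le_mul_of_one_le_right (P.vec_pos j).le ?_
    exact_mod_cast Finset.card_pos.2 (S.rule_nonempty j)
  · refine lt_mul_of_one_lt_right (P.vec_pos i) ?_
    exact_mod_cast hi

end TilingSubstitution

/-- Let `Ξ` be the canonical transversal of an aperiodic primitive substitution tiling of `ℝ^d` with
finite local complexity, whose Bratteli diagram satisfies the following: all edges are simple, the
coordinates of the Perron-Frobenius eigenvector are pairwise distinct, and for all `s > s₁`, if
`e ≠ f` then `β(e, s) ≠ β(f, s)`, or `β(e', s) ≠ β(f', s)` for all `e' ∈ ext(e)`, `f' ∈ ext(f)`.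
If `s₁ ≤ 2 (d + 1)`, then for all `s > 2 (d + 1)` for which the `ω`-spectrum of `Δ_s` is infinite,
`Ξ` is bi-Hölder homeomorphic to the `ω`-spectrum of `Δ_s`. -/
theorem mainTheorem7 {d : ℕ} (hd : 0 < d) {V : Type*} [Fintype V] [DecidableEq V]
    (S : TilingSubstitution d V)
    (hprim : S.abelMatrix.IsPrimitive)
    (hflc : S.FiniteLocalComplexity)
    (haper : S.Aperiodic)
    (P : S.diagram.PerronData)
    (hsimple : ∀ v v' : V, S.diagram.adjMatrix v v' ≤ 1)
    (hdistinct : Function.Injective P.vec)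
    (s₁ : ℝ)
    (htech : ∀ s : ℝ, s₁ < s → ∀ e f : S.Edge, e ≠ f →
      P.beta d s e ≠ P.beta d s f ∨
        ∀ e' f' : S.Edge, S.diagram.src e' = S.diagram.tgt e →
          S.diagram.src f' = S.diagram.tgt f → P.beta d s e' ≠ P.beta d s f')
    (hs₁ : s₁ ≤ 2 * ((d : ℝ) + 1))
    (s : ℝ) (hs : 2 * ((d : ℝ) + 1) < s)
    (hinf : (P.omegaSpectrum d s).Infinite) :
    BiHolderHomeomorphic S.Transversal (P.omegaSpectrum d s) := by
  have hV : Nonempty V := by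
    by_contra h
    rw [not_nonempty_iff] at h
    have := P.sum_vec
    rw [Finset.univ_eq_empty, Finset.sum_empty] at this
    exact zero_ne_one this
  have hd' : (0 : ℝ) < d := Nat.cast_pos.2 hd
  refine (TilingSubstitution.isHolderCantor_transversal hd hprim hflc haper).biHolderHomeomorphic
    (StationaryDiagram.PerronData.isHolderCantor_omegaSpectrum
      (TilingSubstitution.one_lt_eigenvalue hd P) ?_ (fun v w => ?_) hinf)
  -- The threshold on `s` is used here: `s > 2(d+1)` says `(s-2)/d > 2`, equivalently `Λ ρ < 1`.
  · rw [StationaryDiagram.PerronData.massExp, lt_div_iff₀ hd']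
    linarith
  · obtain ⟨k, hk⟩ := TilingSubstitution.exists_forall_mem_superTile hprim
    obtain ⟨y, hy⟩ := hk k le_rfl w v
    obtain ⟨x, hx⟩ := TilingSubstitution.exists_path_of_mem_superTile P hy
    exact ⟨x, k, hx⟩
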